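/- Let $\Omega=\{0,1\}^{\mathbb Z}$ with shifts $(\tau_x\eta)(y)=\eta(x+y)$, and let $\eta^{x,x+1}$ denote $\eta$ with the values at $x$ and $x+1$ interchanged. A function on $\Omega$ is local if it depends on finitely many coordinates. Let $c:\Omega\to[0,\infty)$ be a local function that does not depend on $\eta(0),\eta(1)$ and satisfies $c\ge\epsilon_0$ for some $\epsilon_0>0$; let $\mathcal R\subset\mathbb Z\setminus\{0\}$ be finite, and for each $z\in\mathcal R$ let $r_z:\Omega\to[0,\infty)$ be local. Let $\rho\in(0,1)$, and let $\nu_\rho$ be the Bernoulli product measure on $\Omega$ with density $\rho$. For $n\in\mathbb N=\{1,2,\dots\}$ let $(\eta^n_t,x^n_t)_{t\ge0}$ be the càdlàg Markov process on $\Omega\times\mathbb Z$ with generator $$L_nf(\eta,x)=n^2\sum_{y\in\mathbb Z}c(\tau_y\eta)\,\big(f(\eta^{y,y+1},x)-f(\eta,x)\big)+n\sum_{z\in\mathcal R}r_z(\tau_x\eta)\,\big(f(\eta,x+z)-f(\eta,x)\big)$$ (in the sense of the martingale problem for functions $f$ that are finitely supported in $x$ and local in $\eta$), started with $\eta^n_0\sim\nu_\rho$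 and $x^n_0=0$. Let $\xi^n_t=\tau_{x^n_t}\eta^n_t$ be the environment as seen by the walk, and put $\omega=\sum_{z\in\mathcal R}z\,r_z$, $v(\rho)=\int\omega\,d\nu_\rho$, and $A^n_t=\sqrt n\int_0^t\big(\omega(\xi^n_s)-v(\rho)\big)\,ds$. Fix $T>0$. 1. For every $\lambda\in(1,2)$ there is a constant $C=C(\lambda)$ (which may depend on $T$, $\rho$, $c$, $\mathcal R$ and $(r_z)_{z\in\mathcal R}$, but not on $n$, $t$, $\tau$) such that for all $t,\tau\in[0,T]$ and all $n\in\mathbb N$ $$\mathbb E\left[\left|\sqrt n\int_t^{t+\tau}\big(\omega(\xi^n_s)-v(\rho)\big)\,ds\right|^\lambda\right]\le C\,\tau^{3\lambda/4}.$$ 2. The sequence of processes $\{A^n_t:t\in[0,T]\}_{n\in\mathbb N}$ is tight in $C([0,T],\mathbb R)$ with the uniform topology. -/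

import Mathlib

open MeasureTheory ProbabilityTheory Filter Topology
open scoped NNReal

namespace ExclusionWalk

/-- Particle configurations on `ℤ`; `η x = true` means that the site `x` is occupied. It carries
the product topology and the product σ-algebra. -/
abbrev Config : Type := ℤ → Bool

/-- The canonical shift, `(τ_x η)(y) = η (x + y)`. -/
def shift (x : ℤ) (η : Config) : Config := fun y => η (x + y)

/-- The configuration obtained from `η` by interchanging the values at `x` and `x + 1`. -/
def exchange (x : ℤ) (η : Config) : Config := fun y => η (Equiv.swap x (x + 1) y)

/-- Local functions: the support is contained in a finite set of sites. -/
def IsLocal (f : Config → ℝ) : Prop :=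
  ∃ A : Finset ℤ, DependsOn f (A : Set ℤ)

/-- The Bernoulli product measure of density `ρ`. -/
noncomputable def bernoulliProduct (ρ : unitInterval) : Measure Config :=
  Measure.infinitePi fun _ : ℤ => bernoulliMeasure true false ρ

/-- The generator of the lattice gas, `∑_y c(τ_y η) (f(η^{y,y+1}) - f(η))`. For local `f` only
finitely many terms do not vanish. -/
noncomputable def latticeGasGenerator (c : Config → ℝ) (f : Config → ℝ) (η : Config) : ℝ :=
  ∑ᶠ y : ℤ, c (shift y η) * (f (exchange y η) - f η)

/-- The generator `L_n` of the pair (environment, position of the walk): the lattice gas is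
speeded up by `n ^ 2`, and the walk jumps from `x` to `x + z`, `z ∈ R`, at rate
`n * r z (τ_x η)`. -/
noncomputable def generator (c : Config → ℝ) (R : Finset ℤ) (r : ℤ → Config → ℝ) (n : ℕ+)
    (f : Config → ℤ → ℝ) (η : Config) (x : ℤ) : ℝ :=
  (n : ℝ) ^ 2 * latticeGasGenerator c (fun ζ => f ζ x) η +
    (n : ℝ) * ∑ z ∈ R, r z (shift x η) * (f η (x + z) - f η x)

/-- Test functions on `Config × ℤ`: finitely supported in the position, and for every position a
local function of the environment. -/
def IsTestFunction (f : Config → ℤ → ℝ) : Prop :=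
  (∀ x, IsLocal fun η => f η x) ∧ {x : ℤ | ∃ η, f η x ≠ 0}.Finite

/-- Right continuity with left limits, in continuous time. -/
def IsCadlag {E : Type*} [TopologicalSpace E] (f : ℝ≥0 → E) : Prop :=
  ∀ t, ContinuousWithinAt f (Set.Ici t) t ∧ ∃ l, Tendsto f (𝓝[<] t) (𝓝 l)

/-- `(η, x)` is, under `P`, the Markov process with generator `L_n`, started from the environment
law `bernoulliProduct ρ` with the walk at the origin: it is a càdlàg process, adapted to `𝓕`, that
solves the martingale problem for `L_n` with this initial law. -/
structure IsWalkInExclusion {S : Type*} [MeasurableSpace S] (ρ : unitInterval) (c : Config → ℝ)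
    (R : Finset ℤ) (r : ℤ → Config → ℝ) (n : ℕ+) (P : Measure S)
    (𝓕 : Filtration ℝ≥0 (inferInstance : MeasurableSpace S))
    (η : ℝ≥0 → S → Config) (x : ℝ≥0 → S → ℤ) : Prop where
  adapted_environment : ∀ t, Measurable[𝓕 t] (η t)
  adapted_position : ∀ t, Measurable[𝓕 t] (x t)
  cadlag_environment : ∀ a, IsCadlag fun t => η t a
  cadlag_position : ∀ a, IsCadlag fun t => x t a
  initial_environment : P.map (η 0) = bernoulliProduct ρ
  initial_position : ∀ᵐ a ∂P, x 0 a = 0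
  martingale_problem : ∀ f : Config → ℤ → ℝ, IsTestFunction f →
    Martingale
      (fun t a => f (η t a) (x t a) -
        ∫ s in (0 : ℝ)..t, generator c R r n f (η s.toNNReal a) (x s.toNNReal a))
      𝓕 P

/-- The environment as seen by the walk, `ξ_t(y) = η_t(y + x_t)`. -/
def seenEnvironment {S : Type*} (η : ℝ≥0 → S → Config) (x : ℝ≥0 → S → ℤ) (t : ℝ≥0) (a : S) :
    Config :=
  shift (x t a) (η t a)

/-- The local drift `ω = ∑_{z ∈ R} z r_z`. -/
def drift (R : Finset ℤ) (r : ℤ → Config → ℝ) (ξ : Config) : ℝ :=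
  ∑ z ∈ R, (z : ℝ) * r z ξ

/-- The asymptotic speed `v(ρ) = ∫ ∑_{z ∈ R} z r_z dν_ρ`. -/
noncomputable def speed (ρ : unitInterval) (R : Finset ℤ) (r : ℤ → Config → ℝ) : ℝ :=
  ∫ ξ, ∑ z ∈ R, (z : ℝ) * r z ξ ∂(bernoulliProduct ρ)

/-- `√n ∫_{t₁}^{t₂} (ω(ξ_s) - v(ρ)) ds`; the additive functional `A_t^n` is the case `t₁ = 0`,
`t₂ = t`. -/
noncomputable def additiveFunctional {S : Type*} (ρ : unitInterval) (R : Finset ℤ)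
    (r : ℤ → Config → ℝ) (n : ℕ+) (η : ℝ≥0 → S → Config) (x : ℝ≥0 → S → ℤ) (t₁ t₂ : ℝ) (a : S) :
    ℝ :=
  √(n : ℝ) * ∫ s in t₁..t₂, (drift R r (seenEnvironment η x s.toNNReal a) - speed ρ R r)

/-- The Borel σ-algebra of `C([0,T], ℝ)` with the uniform topology. -/
instance pathMeasurableSpace (T : ℝ) : MeasurableSpace C(Set.Icc (0 : ℝ) T, ℝ) := borel _

instance pathBorelSpace (T : ℝ) : BorelSpace C(Set.Icc (0 : ℝ) T, ℝ) := ⟨rfl⟩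

end ExclusionWalk

open ExclusionWalk

/-!
The theorem rests on one estimate, `exists_integral_sq_le`: the second moment of the additive
functional over a time interval of length `τ` is at most a constant times `τ ^ (3 / 2)`, uniformly
in `n`. Interpolation turns it into the moments of order `lam < 2`, and the Kolmogorov-type
criterion `isTightMeasureSet_of_integral_sq_le` turns it into tightness.

*Densities.* The environment seen by the walk has generator `n ^ 2` times the lattice gas plus `n`
times the jumps of the walk (`seenGenerator`). The lattice gas is reversible with respect to the
Bernoulli measure `ν`, with Dirichlet form at least `ε₀ / 2` times the sum of the bond forms
`∫ (f ∘ exchange y - f) ^ 2 ∂ν`. The jumps do not leave `ν` invariant: they contribute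
`n ∫ g * f ^ 2 ∂ν`, up to a nonpositive term, with `g` a combination of differences `h ∘ τ_z - h`.
Such a difference is a telescoping sum of exchanges, so `n ∫ g * f ^ 2` is absorbed by `n ^ 2`
times finitely many bond forms at the cost of a constant times `∫ f ^ 2`, independent of `n`. The
notion which expresses this is `IsFormBounded`, and `exists_energy_estimate` is the resulting bound
on `∫ f * (L f + θ V f) ∂ν` for a form-bounded potential `V`. It yields that the law of the
environment at every time has a density in `L²(ν)` and that `E[exp (θ ∫ V(X_s) ds)]` is bounded.

*From the energy estimate to the process.* No semigroup is constructed. Local functions are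
analytic vectors for `L + W` (`exists_analytic_bound`), so the Feynman-Kac functional
`G ↦ E[exp (∫ W) G(X_t)]`, which satisfies the forward equation by the martingale problem, can be
compared over short times with the Taylor polynomials of `exp (t (L + W)) G`; their norm in `L²(ν)`
is controlled by the energy estimate and Gronwall's inequality (`abs_functional_le`).

*Replacement.* A centred local function is a finite sum of products `g_i * (occ i - ρ)` with `g_i`
depending only on the sites to the left of `i`. Replacing `occ i` by the average over the block of
`l` sites that starts at `i` is form-bounded with a constant of order `l`, hence contributes
`τ l / n` to the second moment; the block average has fourth moment of order `l⁻²` under `ν`, hence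
contributes `n τ ^ 2 / l`. The choice `l ≈ √τ n` balances both at `τ ^ (3 / 2)`; for `√τ n < 1` the
trivial bound `n τ ^ 2` suffices.
-/

namespace ExclusionWalk

/-! ### Local functions -/

namespace IsLocal

variable {f g : Config → ℝ}

lemma exists_factor (hf : IsLocal f) :
    ∃ (A : Finset ℤ) (g : ((i : (A : Set ℤ)) → Bool) → ℝ), f = g ∘ (A : Set ℤ).domRestrict := by
  obtain ⟨A, hA⟩ := hf
  exact ⟨A, dependsOn_iff_exists_comp.1 hA⟩

lemma measurable (hf : IsLocal f) : Measurable f := by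
  obtain ⟨A, g, rfl⟩ := hf.exists_factor
  exact (Measurable.of_discrete (f := g)).comp
    (measurable_pi_lambda _ fun i => measurable_pi_apply _)

lemma continuous (hf : IsLocal f) : Continuous f := by
  obtain ⟨A, g, rfl⟩ := hf.exists_factor
  exact (continuous_of_discreteTopology (f := g)).comp (continuous_pi fun i => continuous_apply _)

lemma exists_bound (hf : IsLocal f) : ∃ B, 0 ≤ B ∧ ∀ η, |f η| ≤ B := by
  obtain ⟨A, g, rfl⟩ := hf.exists_factor
  obtain ⟨B, hB⟩ := (Set.finite_range fun ζ => |g ζ|).bddAbove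
  exact ⟨B, (abs_nonneg _).trans (hB ⟨fun _ => true, rfl⟩), fun η => hB ⟨_, rfl⟩⟩

lemma integrable (hf : IsLocal f) (μ : Measure Config) [IsFiniteMeasure μ] : Integrable f μ := by
  obtain ⟨B, -, hB⟩ := hf.exists_bound
  exact Integrable.of_bound hf.measurable.aestronglyMeasurable B (ae_of_all _ hB)

lemma const (a : ℝ) : IsLocal fun _ => a := ⟨∅, fun _ _ _ => rfl⟩

lemma op₂ (F : ℝ → ℝ → ℝ) (hf : IsLocal f) (hg : IsLocal g) : IsLocal fun η => F (f η) (g η) := by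
  classical
  obtain ⟨A, hA⟩ := hf
  obtain ⟨B, hB⟩ := hg
  refine ⟨A ∪ B, fun η ζ h => ?_⟩
  simp only
  rw [hA fun i hi => h i (by simp_all), hB fun i hi => h i (by simp_all)]

lemma add (hf : IsLocal f) (hg : IsLocal g) : IsLocal fun η => f η + g η := op₂ (· + ·) hf hg
lemma sub (hf : IsLocal f) (hg : IsLocal g) : IsLocal fun η => f η - g η := op₂ (· - ·) hf hg
lemma mul (hf : IsLocal f) (hg : IsLocal g) : IsLocal fun η => f η * g η := op₂ (· * ·) hf hg
lemma const_mul (a : ℝ) (hf : IsLocal f) : IsLocal fun η => a * f η := (const a).mul hf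
lemma neg (hf : IsLocal f) : IsLocal fun η => -f η := op₂ (fun a _ => -a) hf hf
lemma pow (hf : IsLocal f) (k : ℕ) : IsLocal fun η => f η ^ k := op₂ (fun a _ => a ^ k) hf hf

lemma sum {ι : Type*} (s : Finset ι) {f : ι → Config → ℝ} (h : ∀ i ∈ s, IsLocal (f i)) :
    IsLocal fun η => ∑ i ∈ s, f i η := by
  classical
  induction s using Finset.induction_on with
  | empty => simpa using const 0
  | insert a s ha ih =>
    simp only [Finset.sum_insert ha]
    exact (h a (by simp)).add (ih fun i hi => h i (by simp [hi]))

lemma comp_shift (hf : IsLocal f) (x : ℤ) : IsLocal fun η => f (shift x η) := by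
  classical
  obtain ⟨A, hA⟩ := hf
  refine ⟨A.image (x + ·), fun η ζ h => hA fun i hi => h _ ?_⟩
  simpa using hi

lemma comp_exchange (hf : IsLocal f) (y : ℤ) : IsLocal fun η => f (exchange y η) := by
  classical
  obtain ⟨A, hA⟩ := hf
  refine ⟨A.image (Equiv.swap y (y + 1)), fun η ζ h => hA fun i hi => h _ ?_⟩
  simpa using hi

lemma exists_box (hf : IsLocal f) : ∃ m : ℕ, DependsOn f (Set.Icc (-m : ℤ) m) := by
  obtain ⟨A, hA⟩ := hf
  refine ⟨∑ i ∈ A, i.natAbs, hA.mono fun i hi => ?_⟩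
  have := Finset.single_le_sum (f := fun i : ℤ => i.natAbs) (fun _ _ => Nat.zero_le _) hi
  generalize ∑ i ∈ A, i.natAbs = m at this
  simp only [Set.mem_Icc] at *
  omega

end IsLocal

/-- The real vector space of local functions. -/
def localFunctions : Submodule ℝ (Config → ℝ) where
  carrier := {f | IsLocal f}
  add_mem' hf hg := hf.add hg
  zero_mem' := IsLocal.const 0
  smul_mem' a _ hf := hf.const_mul a

/-- The occupation number of the site `i`, as a real number. -/
def occ (i : ℤ) (η : Config) : ℝ := if η i then 1 else 0

lemma dependsOn_occ (i : ℤ) : DependsOn (occ i) {i} := fun η ζ h => by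
  simp [occ, h i rfl]

lemma isLocal_occ (i : ℤ) : IsLocal (occ i) := ⟨{i}, by simpa using dependsOn_occ i⟩

lemma occ_mul_self (i : ℤ) (η : Config) : occ i η * occ i η = occ i η := by
  unfold occ; split_ifs <;> simp

lemma occ_nonneg (i : ℤ) (η : Config) : 0 ≤ occ i η := by unfold occ; split_ifs <;> simp
lemma occ_le_one (i : ℤ) (η : Config) : occ i η ≤ 1 := by unfold occ; split_ifs <;> simp

lemma shift_shift (x z : ℤ) (η : Config) : shift z (shift x η) = shift (x + z) η := by
  funext y; simp [shift, add_assoc]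

@[simp] lemma shift_zero (η : Config) : shift 0 η = η := by
  funext y; simp [shift]

@[simp] lemma exchange_exchange (y : ℤ) (η : Config) : exchange y (exchange y η) = η := by
  funext w; simp [exchange]

lemma exchange_apply_of_ne {y w : ℤ} (h : w ≠ y) (h' : w ≠ y + 1) (η : Config) :
    exchange y η w = η w := by
  simp [exchange, Equiv.swap_apply_of_ne_of_ne h h']

@[simp] lemma exchange_apply_left (y : ℤ) (η : Config) : exchange y η y = η (y + 1) := by
  simp [exchange]

@[simp] lemma exchange_apply_right (y : ℤ) (η : Config) : exchange y η (y + 1) = η y := by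
  simp [exchange]

lemma shift_exchange (x y : ℤ) (η : Config) :
    shift x (exchange y η) = exchange (y - x) (shift x η) := by
  funext w
  simp only [shift, exchange]
  congr 1
  simp only [Equiv.swap_apply_def]
  split_ifs <;> omega

/-- An exchange of two sites outside of the support does not change the value of a function. -/
lemma comp_exchange_of_notMem {f : Config → ℝ} {s : Set ℤ} (hf : DependsOn f s) {y : ℤ}
    (h : y ∉ s) (h' : y + 1 ∉ s) (η : Config) : f (exchange y η) = f η :=
  hf fun i hi => exchange_apply_of_ne (by rintro rfl; exact h hi) (by rintro rfl; exact h' hi) η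

/-! ### The Bernoulli product measure -/

section Bernoulli

variable {ρ : unitInterval}

instance : IsProbabilityMeasure (bernoulliProduct ρ) := by
  unfold bernoulliProduct; infer_instance

/-- The Bernoulli product measure is invariant under permutations of the sites. -/
lemma measurePreserving_perm (e : Equiv.Perm ℤ) :
    MeasurePreserving (fun (η : Config) y => η (e y)) (bernoulliProduct ρ) (bernoulliProduct ρ) :=
  ⟨measurable_pi_lambda _ fun _ => measurable_pi_apply _, by
    unfold bernoulliProduct
    exact Measure.map_infinitePi_infinitePi_of_inj
      (P := fun _ : ℤ => bernoulliMeasure true false ρ) e.injective⟩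

lemma measurePreserving_exchange (y : ℤ) :
    MeasurePreserving (exchange y) (bernoulliProduct ρ) (bernoulliProduct ρ) :=
  measurePreserving_perm (Equiv.swap y (y + 1))

lemma measurePreserving_shift (x : ℤ) :
    MeasurePreserving (shift x) (bernoulliProduct ρ) (bernoulliProduct ρ) :=
  measurePreserving_perm (Equiv.addLeft x)

lemma integral_comp_exchange {f : Config → ℝ} (hf : IsLocal f) (y : ℤ) :
    ∫ η, f (exchange y η) ∂(bernoulliProduct ρ) = ∫ η, f η ∂(bernoulliProduct ρ) := by
  have h := (measurePreserving_exchange (ρ := ρ) y)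
  conv_rhs => rw [← h.map_eq]
  exact (integral_map h.measurable.aemeasurable hf.measurable.aestronglyMeasurable).symm

lemma integral_comp_shift {f : Config → ℝ} (hf : IsLocal f) (x : ℤ) :
    ∫ η, f (shift x η) ∂(bernoulliProduct ρ) = ∫ η, f η ∂(bernoulliProduct ρ) := by
  have h := (measurePreserving_shift (ρ := ρ) x)
  conv_rhs => rw [← h.map_eq]
  exact (integral_map h.measurable.aemeasurable hf.measurable.aestronglyMeasurable).symm

lemma integral_occ (i : ℤ) : ∫ η, occ i η ∂(bernoulliProduct ρ) = (ρ : ℝ) := by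
  have h := Measure.infinitePi_map_eval (fun _ : ℤ => bernoulliMeasure true false ρ) i
  have h2 : ∫ η, occ i η ∂(bernoulliProduct ρ)
      = ∫ b, (if b then (1 : ℝ) else 0) ∂(bernoulliMeasure true false ρ) := by
    conv_rhs => rw [← h]
    rw [integral_map (measurable_pi_apply i).aemeasurable
      Measurable.of_discrete.aestronglyMeasurable]
    rfl
  rw [h2, integral_bernoulliMeasure]
  simp

/-- A centred occupation number is orthogonal to the functions of the other sites. -/
lemma integral_mul_occ_sub {g : Config → ℝ} {A : Finset ℤ} (hg : DependsOn g (A : Set ℤ)) {i : ℤ}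
    (hi : i ∉ A) : ∫ η, g η * (occ i η - ρ) ∂(bernoulliProduct ρ) = 0 := by
  have hind : iIndepFun (fun (j : ℤ) (η : Config) => η j) (bernoulliProduct ρ) :=
    iIndepFun_infinitePi (P := fun _ : ℤ => bernoulliMeasure true false ρ) (X := fun _ b => b)
      fun _ => measurable_id
  have h := hind.indepFun_finset A {i} (by simpa using hi) fun j => measurable_pi_apply j
  have hgl : IsLocal g := ⟨A, hg⟩
  obtain ⟨G, rfl⟩ := dependsOn_iff_exists_comp.1 hg
  have h' := h.comp (φ := G) (ψ := fun v : ({i} : Finset ℤ) → Bool =>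
    (if v ⟨i, by simp⟩ then (1 : ℝ) else 0) - ρ) Measurable.of_discrete Measurable.of_discrete
  have h3 : ∫ η, (occ i η - (ρ : ℝ)) ∂(bernoulliProduct ρ) = 0 := by
    rw [integral_sub ((isLocal_occ i).integrable _) (integrable_const _), integral_occ]
    simp
  have h4 := h'.integral_mul_eq_mul_integral hgl.measurable.aestronglyMeasurable
    (((isLocal_occ i).sub (IsLocal.const _)).measurable.aestronglyMeasurable)
  calc _ = _ := h4
    _ = _ * ∫ η, (occ i η - (ρ : ℝ)) ∂(bernoulliProduct ρ) := rfl
    _ = 0 := by rw [h3, mul_zero]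

end Bernoulli

/-! ### Moments of block sums -/

section Moments

variable {ρ : unitInterval}

lemma IsLocal.integral_add {f g : Config → ℝ} (hf : IsLocal f) (hg : IsLocal g) :
    ∫ η, f η + g η ∂(bernoulliProduct ρ)
      = ∫ η, f η ∂(bernoulliProduct ρ) + ∫ η, g η ∂(bernoulliProduct ρ) :=
  MeasureTheory.integral_add (hf.integrable _) (hg.integrable _)

lemma IsLocal.integral_mono {f g : Config → ℝ} (hf : IsLocal f) (hg : IsLocal g)
    (h : ∀ η, f η ≤ g η) :
    ∫ η, f η ∂(bernoulliProduct ρ) ≤ ∫ η, g η ∂(bernoulliProduct ρ) :=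
  MeasureTheory.integral_mono (hf.integrable _) (hg.integrable _) h

/-- The centred number of particles in the block `{i, …, i + l - 1}`. -/
def blockSum (ρ : unitInterval) (i : ℤ) (l : ℕ) (η : Config) : ℝ :=
  ∑ j ∈ Finset.range l, (occ (i + j) η - ρ)

lemma dependsOn_blockSum (i : ℤ) (l : ℕ) :
    DependsOn (blockSum ρ i l) (Finset.Ico i (i + l) : Finset ℤ) := by
  intro η ζ h
  refine Finset.sum_congr rfl fun j hj => ?_
  rw [dependsOn_occ (i + j) (y := ζ)]
  rintro _ rfl
  apply h
  simpa using hj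

lemma isLocal_blockSum (i : ℤ) (l : ℕ) : IsLocal (blockSum ρ i l) := ⟨_, dependsOn_blockSum i l⟩

lemma isLocal_occ_sub (i : ℤ) : IsLocal fun η => occ i η - (ρ : ℝ) :=
  (isLocal_occ i).sub (IsLocal.const _)

lemma abs_occ_sub_le (i : ℤ) (η : Config) : |occ i η - (ρ : ℝ)| ≤ 1 := by
  rw [abs_le]
  constructor <;> linarith [occ_nonneg i η, occ_le_one i η, ρ.2.1, ρ.2.2]

lemma integral_blockSum (i : ℤ) (l : ℕ) : ∫ η, blockSum ρ i l η ∂(bernoulliProduct ρ) = 0 := by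
  unfold blockSum
  rw [integral_finsetSum _ fun j _ => (isLocal_occ_sub _).integrable _]
  refine Finset.sum_eq_zero fun j _ => ?_
  simpa using integral_mul_occ_sub (ρ := ρ) (g := fun _ => 1) (A := ∅) (fun _ _ _ => rfl)
    (i := i + j) (by simp)

lemma integral_blockSum_pow_mul (i : ℤ) (l k : ℕ) :
    ∫ η, blockSum ρ i l η ^ k * (occ (i + l) η - ρ) ∂(bernoulliProduct ρ) = 0 :=
  integral_mul_occ_sub (A := Finset.Ico i (i + l))
    (fun η ζ h => by simp only [dependsOn_blockSum i l h]) (by simp)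

lemma integral_blockSum_sq_le (i : ℤ) (l : ℕ) :
    ∫ η, blockSum ρ i l η ^ 2 ∂(bernoulliProduct ρ) ≤ l := by
  induction l with
  | zero => simp [blockSum]
  | succ l ih =>
    have hS := isLocal_blockSum (ρ := ρ) i l
    have hY := isLocal_occ_sub (ρ := ρ) (i + l)
    have e : ∀ η, blockSum ρ i (l + 1) η ^ 2 ≤ (blockSum ρ i l η ^ 2 + 1) +
        2 * (blockSum ρ i l η ^ 1 * (occ (i + l) η - ρ)) := fun η => by
      have h1 := (sq_le_one_iff_abs_le_one _).2 (abs_occ_sub_le (ρ := ρ) (i + l) η)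
      unfold blockSum
      rw [Finset.sum_range_succ]
      nlinarith
    have hS1 : IsLocal fun η => blockSum ρ i l η ^ 2 + 1 := (hS.pow 2).add (IsLocal.const 1)
    have hS2 : IsLocal fun η => 2 * (blockSum ρ i l η ^ 1 * (occ (i + l) η - ρ)) :=
      ((hS.pow 1).mul hY).const_mul 2
    refine (((isLocal_blockSum i (l + 1)).pow 2).integral_mono (hS1.add hS2) e).trans ?_
    rw [hS1.integral_add hS2, (hS.pow 2).integral_add (IsLocal.const 1), integral_const_mul,
      integral_blockSum_pow_mul]
    simp
    linarith

/-- The fourth moment of a block sum has the order of the square of its length. -/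
lemma integral_blockSum_pow_four_le (i : ℤ) (l : ℕ) :
    ∫ η, blockSum ρ i l η ^ 4 ∂(bernoulliProduct ρ) ≤ 3 * (l : ℝ) ^ 2 := by
  induction l with
  | zero => simp [blockSum]
  | succ l ih =>
    have hS := isLocal_blockSum (ρ := ρ) i l
    have hY := isLocal_occ_sub (ρ := ρ) (i + l)
    -- `Y = occ - ρ` takes two values, so that `Y ^ 3` is an affine function of `Y`
    have e : ∀ η, blockSum ρ i (l + 1) η ^ 4 ≤ ((blockSum ρ i l η ^ 4 + 1) +
        6 * blockSum ρ i l η ^ 2) + ((4 * (blockSum ρ i l η ^ 3 * (occ (i + l) η - ρ)) +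
        (4 * ((1 - 2 * ρ) ^ 2 + ρ * (1 - ρ))) * (blockSum ρ i l η ^ 1 * (occ (i + l) η - ρ))) +
        (4 * (1 - 2 * ρ) * ρ * (1 - ρ)) * blockSum ρ i l η) := fun η => by
      have h1 := (sq_le_one_iff_abs_le_one _).2 (abs_occ_sub_le (ρ := ρ) (i + l) η)
      have hocc := occ_mul_self (i + l) η
      have e1 : blockSum ρ i (l + 1) η = blockSum ρ i l η + (occ (i + l) η - ρ) := by
        unfold blockSum
        rw [Finset.sum_range_succ]
      rw [e1]
      generalize blockSum ρ i l η = S at *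
      generalize occ (i + l) η = o at *
      have h2 : (o - ρ) ^ 2 = (1 - 2 * ρ) * (o - ρ) + ρ * (1 - ρ) := by linear_combination hocc
      have h3 : (o - ρ) ^ 3 = ((1 - 2 * ρ) ^ 2 + ρ * (1 - ρ)) * (o - ρ)
          + (1 - 2 * ρ) * ρ * (1 - ρ) := by
        linear_combination (o - ρ + (1 - 2 * ρ)) * h2
      have h4 : (o - (ρ : ℝ)) ^ 4 ≤ 1 := by nlinarith [sq_nonneg (o - (ρ : ℝ))]
      have h5 : S ^ 2 * (o - (ρ : ℝ)) ^ 2 ≤ S ^ 2 := mul_le_of_le_one_right (sq_nonneg _) h1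
      calc (S + (o - (ρ : ℝ))) ^ 4 = S ^ 4 + 4 * (S ^ 3 * (o - ρ)) + 6 * (S ^ 2 * (o - ρ) ^ 2)
            + 4 * S * (o - ρ) ^ 3 + (o - ρ) ^ 4 := by ring
        _ ≤ _ := by
          rw [h3]
          linarith
    have a1 : IsLocal fun η => blockSum ρ i l η ^ 4 + 1 := (hS.pow 4).add (IsLocal.const 1)
    have a2 : IsLocal fun η => 6 * blockSum ρ i l η ^ 2 := (hS.pow 2).const_mul 6
    have a3 : IsLocal fun η => 4 * (blockSum ρ i l η ^ 3 * (occ (i + l) η - ρ)) :=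
      ((hS.pow 3).mul hY).const_mul 4
    have a4 : IsLocal fun η => (4 * ((1 - 2 * (ρ : ℝ)) ^ 2 + ρ * (1 - ρ))) *
      (blockSum ρ i l η ^ 1 * (occ (i + l) η - ρ)) := ((hS.pow 1).mul hY).const_mul _
    have a5 : IsLocal fun η => (4 * (1 - 2 * (ρ : ℝ)) * ρ * (1 - ρ)) * blockSum ρ i l η :=
      hS.const_mul _
    refine (((isLocal_blockSum i (l + 1)).pow 4).integral_mono
      ((a1.add a2).add ((a3.add a4).add a5)) e).trans ?_
    rw [(a1.add a2).integral_add ((a3.add a4).add a5), a1.integral_add a2,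
      (a3.add a4).integral_add a5, a3.integral_add a4, (hS.pow 4).integral_add (IsLocal.const 1),
      integral_const_mul, integral_const_mul, integral_const_mul, integral_const_mul,
      integral_blockSum_pow_mul, integral_blockSum_pow_mul, integral_blockSum]
    have := integral_blockSum_sq_le (ρ := ρ) i l
    simp
    nlinarith

end Moments

/-! ### Decomposition of a local function along the sites -/

/-- A local function is its mean plus a sum of centred occupation numbers `η(i) - ρ`, each with a
coefficient that depends on sites to the left of `i` only. -/
lemma IsLocal.exists_decomposition {f : Config → ℝ} (hf : IsLocal f) (ρ : unitInterval) :
    ∃ (I : Finset ℤ) (g : ℤ → Config → ℝ) (B : ℝ), 0 ≤ B ∧ (∀ i ∈ I, ∀ η, |g i η| ≤ B) ∧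
      (∀ i, ∃ A : Finset ℤ, DependsOn (g i) (A : Set ℤ) ∧ ∀ j ∈ A, j < i) ∧
      ∀ η, f η = ∫ ζ, f ζ ∂(bernoulliProduct ρ) + ∑ i ∈ I, g i η * (occ i η - ρ) := by
  obtain ⟨A, hA⟩ := hf
  have key : ∃ (k : ℝ) (I : Finset ℤ) (g : ℤ → Config → ℝ), I ⊆ A ∧
      (∀ i, ∃ A : Finset ℤ, DependsOn (g i) (A : Set ℤ) ∧ ∀ j ∈ A, j < i) ∧
      ∀ η, f η = k + ∑ i ∈ I, g i η * (occ i η - ρ) := by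
    induction A using Finset.induction_on_max generalizing f with
    | empty =>
      refine ⟨f fun _ => true, ∅, fun _ _ => 0, by simp, fun i => ⟨∅, fun _ _ _ => rfl, by simp⟩,
        fun η => ?_⟩
      simpa using hA (by simp)
    | insert a s hs ih =>
      have hu : ∀ b, DependsOn (fun η : Config => f (Function.update η a b)) (s : Set ℤ) := by
        intro b η ζ h
        refine hA fun i hi => ?_
        by_cases e : i = a
        · subst e; simp
        · simp only [Function.update_of_ne e]
          exact h i (by simpa [e] using hi)
      obtain ⟨k, I, g, hI, hg, e⟩ := ih (f := fun η => ρ * f (Function.update η a true)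
        + (1 - ρ) * f (Function.update η a false)) fun η ζ h => by
          simp only [hu true h, hu false h]
      have ha : a ∉ I := fun h => (hs a (hI h)).false
      refine ⟨k, insert a I, Function.update g a fun η => f (Function.update η a true) -
        f (Function.update η a false), Finset.insert_subset_insert _ hI, fun i => ?_, fun η => ?_⟩
      · by_cases e : i = a
        · subst e
          refine ⟨s, fun η ζ h => ?_, hs⟩
          simp only [Function.update_self, hu true h, hu false h]
        · simpa [Function.update_of_ne e] using hg i
      · have e1 : ∑ i ∈ I, Function.update g a (fun η => f (Function.update η a true) -
            f (Function.update η a false)) i η * (occ i η - ρ) =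
            ∑ i ∈ I, g i η * (occ i η - ρ) :=
          Finset.sum_congr rfl fun i hi => by
            rw [Function.update_of_ne (by rintro rfl; exact ha hi)]
        rw [Finset.sum_insert ha, e1, Function.update_self]
        have e2 := e η
        by_cases h : η a
        · have : f (Function.update η a true) = f η := by rw [← h, Function.update_eq_self]
          simp only [occ, h, this, if_true] at *
          linarith
        · have h' : η a = false := by simpa using h
          have : f (Function.update η a false) = f η := by rw [← h', Function.update_eq_self]
          simp only [occ, h', this] at *
          simp
          linarith
  obtain ⟨k, I, g, -, hg, e⟩ := key
  have hgl : ∀ i, IsLocal (g i) := fun i => ⟨_, (hg i).choose_spec.1⟩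
  choose b hb0 hb using fun i => (hgl i).exists_bound
  refine ⟨I, g, ∑ i ∈ I, b i, Finset.sum_nonneg fun i _ => hb0 i, fun i hi η => (hb i η).trans
    (Finset.single_le_sum (fun i _ => hb0 i) hi), hg, fun η => ?_⟩
  have hk : ∫ ζ, f ζ ∂(bernoulliProduct ρ) = k := by
    have h0 : ∀ i, IsLocal fun η => g i η * (occ i η - ρ) :=
      fun i => (hgl i).mul (isLocal_occ_sub i)
    simp_rw [e]
    rw [(IsLocal.const k).integral_add (IsLocal.sum I fun i _ => h0 i),
      integral_finsetSum _ fun i _ => (h0 i).integrable _, Finset.sum_eq_zero]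
    · simp
    · intro i _
      obtain ⟨A, hA, hlt⟩ := hg i
      exact integral_mul_occ_sub hA fun h => (hlt i h).false
  rw [hk, e]

/-! ### Dirichlet forms and form-bounded potentials -/

section Forms

variable {ρ : unitInterval}

/-- The contribution of the bond `{y, y + 1}` to the Dirichlet form of the symmetric exclusion
process, without the factor `1 / 2`. -/
noncomputable def bondForm (ρ : unitInterval) (y : ℤ) (f : Config → ℝ) : ℝ :=
  ∫ η, (f (exchange y η) - f η) ^ 2 ∂(bernoulliProduct ρ)

lemma bondForm_nonneg (y : ℤ) (f : Config → ℝ) : 0 ≤ bondForm ρ y f :=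
  integral_nonneg fun _ => sq_nonneg _

/-- The potential `V` is bounded by the Dirichlet form of the bonds in `Y`, with an arbitrarily
small constant `δ` in front of it at the price of a constant `K / δ` in front of the `L²` norm.
Equivalently, `∫ V f² ≤ 2 √K ‖f‖ √(∑ y ∈ Y, bondForm ρ y f)`. -/
def IsFormBounded (ρ : unitInterval) (V : Config → ℝ) (Y : Finset ℤ) (K : ℝ) : Prop :=
  ∀ f, IsLocal f → ∀ δ : ℝ, 0 < δ → ∫ η, V η * f η ^ 2 ∂(bernoulliProduct ρ) ≤
    δ * ∑ y ∈ Y, bondForm ρ y f + K / δ * ∫ η, f η ^ 2 ∂(bernoulliProduct ρ)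

namespace IsFormBounded

lemma mono {V : Config → ℝ} {Y Y' : Finset ℤ} {K K' : ℝ} (h : IsFormBounded ρ V Y K)
    (hY : Y ⊆ Y') (hK : K ≤ K') : IsFormBounded ρ V Y' K' := by
  intro f hf δ hδ
  refine (h f hf δ hδ).trans ?_
  have h0 : 0 ≤ ∫ η, f η ^ 2 ∂(bernoulliProduct ρ) := integral_nonneg fun _ => sq_nonneg _
  gcongr
  exact fun _ _ _ => bondForm_nonneg _ _

lemma zero : IsFormBounded ρ (fun _ => 0) ∅ 0 := by
  intro f hf δ hδ
  simp

lemma sum {ι : Type*} (I : Finset ι) {V : ι → Config → ℝ} {Y : Finset ℤ} {K : ℝ}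
    (hV : ∀ i ∈ I, IsLocal (V i)) (h : ∀ i ∈ I, IsFormBounded ρ (V i) Y K) :
    IsFormBounded ρ (fun η => ∑ i ∈ I, V i η) Y ((I.card : ℝ) ^ 2 * K) := by
  intro f hf δ hδ
  rcases I.eq_empty_or_nonempty with rfl | hI
  · simp only [Finset.sum_empty, zero_mul, integral_zero, Finset.card_empty, Nat.cast_zero,
      ne_eq, OfNat.ofNat_ne_zero, not_false_eq_true, zero_pow, zero_div, add_zero]
    exact mul_nonneg hδ.le (Finset.sum_nonneg fun _ _ => bondForm_nonneg _ _)
  have hp : (0 : ℝ) < I.card := by exact_mod_cast hI.card_pos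
  simp_rw [Finset.sum_mul]
  rw [integral_finsetSum _ fun i hi => ((hV i hi).mul (hf.pow 2)).integrable _]
  refine (Finset.sum_le_sum fun i hi => h i hi f hf (δ / I.card) (by positivity)).trans ?_
  rw [Finset.sum_const, nsmul_eq_mul]
  apply le_of_eq
  field_simp

lemma add {V V' U : Config → ℝ} {Y Y' : Finset ℤ} {K K' : ℝ} (hV : IsLocal V) (hV' : IsLocal V')
    (h : IsFormBounded ρ V Y K) (h' : IsFormBounded ρ V' Y' K') (hU : ∀ η, U η = V η + V' η) :
    IsFormBounded ρ U (Y ∪ Y') (4 * max K K') := by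
  classical
  have := IsFormBounded.sum (ρ := ρ) (Finset.univ : Finset Bool) (V := fun b => if b then V else V')
    (Y := Y ∪ Y') (K := max K K') (by simp [hV, hV'])
    (by simp [h.mono Finset.subset_union_left (le_max_left _ _),
      h'.mono Finset.subset_union_right (le_max_right _ _)])
  norm_num at this
  rwa [funext hU]

/-- The function `h - h ∘ exchange y` is form bounded: by reversibility its integral against `f²`
is the integral of `h` against `f² - (f ∘ exchange y)²`. -/
lemma sub_exchange {h : Config → ℝ} (hh : IsLocal h) {b : ℝ} (hb : ∀ η, |h η| ≤ b) (y : ℤ) :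
    IsFormBounded ρ (fun η => h η - h (exchange y η)) {y} (b ^ 2) := by
  intro f hf δ hδ
  have hfy := hf.comp_exchange y
  have e : ∫ η, (h η - h (exchange y η)) * f η ^ 2 ∂(bernoulliProduct ρ)
      = ∫ η, h η * (f η ^ 2 - f (exchange y η) ^ 2) ∂(bernoulliProduct ρ) := by
    have := integral_comp_exchange (ρ := ρ) (hh.mul (hfy.pow 2)) y
    simp only [exchange_exchange] at this
    simp_rw [sub_mul, mul_sub]
    rw [integral_sub ((hh.mul (hf.pow 2)).integrable _)
      (((hh.comp_exchange y).mul (hf.pow 2)).integrable _),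
      integral_sub ((hh.mul (hf.pow 2)).integrable _) ((hh.mul (hfy.pow 2)).integrable _), this]
  have hpt : ∀ η, h η * (f η ^ 2 - f (exchange y η) ^ 2) ≤
      δ * (f (exchange y η) - f η) ^ 2 +
        b ^ 2 / δ * ((1 / 2) * (f η ^ 2 + f (exchange y η) ^ 2)) := by
    intro η
    have h1 : h η ^ 2 ≤ b ^ 2 := sq_le_sq' (abs_le.1 (hb η)).1 (abs_le.1 (hb η)).2
    generalize f η = u
    generalize f (exchange y η) = v
    generalize h η = w at *
    have h2 : w * (u ^ 2 - v ^ 2) ≤ δ * (v - u) ^ 2 + w ^ 2 / (4 * δ) * (u + v) ^ 2 := by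
      have : δ * (v - u) ^ 2 + w ^ 2 / (4 * δ) * (u + v) ^ 2 - w * (u ^ 2 - v ^ 2)
          = (2 * δ * (v - u) + w * (u + v)) ^ 2 / (4 * δ) := by
        field_simp
        ring
      have h3 : 0 ≤ (2 * δ * (v - u) + w * (u + v)) ^ 2 / (4 * δ) := by positivity
      linarith
    have h4 : w ^ 2 / (4 * δ) * (u + v) ^ 2 ≤ b ^ 2 / (4 * δ) * (2 * (u ^ 2 + v ^ 2)) := by
      gcongr
      nlinarith [sq_nonneg (u - v)]
    have h5 : b ^ 2 / (4 * δ) * (2 * (u ^ 2 + v ^ 2)) =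
        b ^ 2 / δ * ((1 / 2) * (u ^ 2 + v ^ 2)) := by
      field_simp
      ring
    linarith
  have i1 : IsLocal fun η => δ * (f (exchange y η) - f η) ^ 2 := ((hfy.sub hf).pow 2).const_mul δ
  have i2 : IsLocal fun η => b ^ 2 / δ * ((1 / 2) * (f η ^ 2 + f (exchange y η) ^ 2)) :=
    (((hf.pow 2).add (hfy.pow 2)).const_mul _).const_mul _
  rw [e]
  refine ((hh.mul ((hf.pow 2).sub (hfy.pow 2))).integral_mono (i1.add i2) hpt).trans ?_
  rw [i1.integral_add i2, integral_const_mul, integral_const_mul, integral_const_mul,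
    (hf.pow 2).integral_add (hfy.pow 2), integral_comp_exchange (hf.pow 2)]
  simp only [Finset.sum_singleton, bondForm]
  apply le_of_eq
  ring

/-- The replacement of an occupation number by its average over a block of sites that starts at the
same site costs the length of the block: each of the exchanges that carry the site `i` to a site of
the block leaves the coefficient `g`, which depends on sites to the left of `i`, unchanged. -/
lemma mul_occ_sub_average {g : Config → ℝ} {i : ℤ} {A : Finset ℤ}
    (hg : DependsOn g (A : Set ℤ)) (hA : ∀ j ∈ A, j < i) {b : ℝ} (hb : ∀ η, |g η| ≤ b)
    {l : ℕ} (hl : 0 < l) :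
    IsFormBounded ρ (fun η => g η * (occ i η - ρ - (l : ℝ)⁻¹ * blockSum ρ i l η))
      ((Finset.range l).image fun k : ℕ => i + k) (l * b ^ 2) := by
  intro f hf δ hδ
  have hgl : IsLocal g := ⟨A, hg⟩
  have hb0 : 0 ≤ b := (abs_nonneg _).trans (hb fun _ => true)
  set N := ∫ η, f η ^ 2 ∂(bernoulliProduct ρ)
  have hN : 0 ≤ N := integral_nonneg fun _ => sq_nonneg _
  have hloc : ∀ j : ℤ, IsLocal fun η => g η * (occ i η - occ j η) := fun j =>
    hgl.mul ((isLocal_occ i).sub (isLocal_occ j))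
  have h0 : ∀ k : ℕ, 0 ≤ δ * bondForm ρ (i + k) f + b ^ 2 / δ * N := fun k => by
    have := bondForm_nonneg (ρ := ρ) (i + k) f
    positivity
  -- moving a particle from `i` to `i + j` by nearest-neighbour exchanges
  have step : ∀ j : ℕ, ∫ η, g η * (occ i η - occ (i + j) η) * f η ^ 2 ∂(bernoulliProduct ρ) ≤
      ∑ k ∈ Finset.range j, (δ * bondForm ρ (i + k) f + b ^ 2 / δ * N) := by
    intro j
    induction j with
    | zero => simp
    | succ j ih =>
      have hh : IsLocal fun η => g η * occ (i + j) η := hgl.mul (isLocal_occ _)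
      have hex := sub_exchange (ρ := ρ) hh (b := b) (fun η => by
        rw [abs_mul, abs_of_nonneg (occ_nonneg _ _)]
        exact (mul_le_of_le_one_right (abs_nonneg _) (occ_le_one _ _)).trans (hb η))
        (i + j) f hf δ hδ
      have hge : ∀ η, g (exchange (i + j) η) = g η := comp_exchange_of_notMem hg
        (fun h => by have := hA _ h; omega) (fun h => by have := hA _ h; omega)
      have hoe : ∀ η, occ (i + j) (exchange (i + j) η) = occ (i + (j + 1 : ℕ)) η := fun η => by
        simp [occ, add_assoc]
      simp only [hge, hoe, Finset.sum_singleton] at hex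
      rw [Finset.sum_range_succ]
      refine le_trans (le_of_eq ?_) (add_le_add ih hex)
      rw [← ((hloc _).mul (hf.pow 2)).integral_add
        (((hgl.mul (isLocal_occ _)).sub (hgl.mul (isLocal_occ _))).mul (hf.pow 2))]
      congr 1
      funext η
      ring
  have hl' : (l : ℝ) ≠ 0 := by positivity
  have e : ∀ η, g η * (occ i η - ρ - (l : ℝ)⁻¹ * blockSum ρ i l η) * f η ^ 2 =
      (l : ℝ)⁻¹ * ∑ j ∈ Finset.range l, g η * (occ i η - occ (i + j) η) * f η ^ 2 := by
    intro η
    rw [← Finset.sum_mul, ← Finset.mul_sum, blockSum, Finset.sum_sub_distrib,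
      Finset.sum_sub_distrib]
    simp only [Finset.sum_const, Finset.card_range, nsmul_eq_mul]
    field_simp
    ring
  simp_rw [e]
  rw [integral_const_mul, integral_finsetSum _ fun j _ => ((hloc _).mul (hf.pow 2)).integrable _]
  have h1 : ∑ j ∈ Finset.range l,
      ∫ η, g η * (occ i η - occ (i + j) η) * f η ^ 2 ∂(bernoulliProduct ρ) ≤
      ∑ _j ∈ Finset.range l, ∑ k ∈ Finset.range l,
        (δ * bondForm ρ (i + k) f + b ^ 2 / δ * N) := by
    refine Finset.sum_le_sum fun j hj => (step j).trans ?_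
    exact Finset.sum_le_sum_of_subset_of_nonneg
      (Finset.range_subset_range.2 (Finset.mem_range.1 hj).le) fun k _ _ => h0 k
  refine (mul_le_mul_of_nonneg_left h1 (by positivity)).trans (le_of_eq ?_)
  rw [Finset.sum_const, Finset.card_range, nsmul_eq_mul, ← mul_assoc, inv_mul_cancel₀ hl', one_mul,
    Finset.sum_add_distrib, ← Finset.mul_sum, Finset.sum_image (by simp)]
  simp
  ring

end IsFormBounded

/-- The translation by one site acts on a local function as a composition of nearest-neighbour
exchanges. -/
lemma exists_formBounded_comp_shift_one {h : Config → ℝ} (hh : IsLocal h) :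
    ∃ Y K, IsFormBounded ρ (fun η => h (shift 1 η) - h η) Y K := by
  -- `cyc a k` moves the particles at `a + 1, …, a + k` by one site to the left
  let cyc : ℤ → ℕ → Config → Config := fun a k =>
    Nat.rec id (fun k F η => exchange (a + k) (F η)) k
  have cyc_succ : ∀ a k η, cyc a (k + 1) η = exchange (a + k) (cyc a k η) := fun _ _ _ => rfl
  have cyc_apply : ∀ (a : ℤ) (k : ℕ) (η : Config), (∀ w, a ≤ w → w < a + k →
      cyc a k η w = η (w + 1)) ∧ cyc a k η (a + k) = η a ∧ ∀ w, a + k < w → cyc a k η w = η w := by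
    intro a k η
    induction k with
    | zero => exact ⟨fun w h1 h2 => by simp at h2; omega, by simp [cyc], fun w _ => rfl⟩
    | succ k ih =>
      obtain ⟨h1, h2, h3⟩ := ih
      rw [cyc_succ]
      refine ⟨fun w ha hb => ?_, ?_, fun w hw => ?_⟩
      · rcases eq_or_ne w (a + k) with rfl | hne
        · rw [exchange_apply_left, h3 _ (by omega)]
        · push_cast at hb
          rw [exchange_apply_of_ne hne (by omega), h1 w ha (by omega)]
      · push_cast
        rw [← add_assoc, exchange_apply_right, h2]
      · push_cast at hw
        rw [exchange_apply_of_ne (by omega) (by omega), h3 w (by omega)]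
  have cyc_local : ∀ (h : Config → ℝ), IsLocal h → ∀ a k, IsLocal fun η => h (cyc a k η) := by
    intro h hh a k
    induction k generalizing h with
    | zero => exact hh
    | succ k ih => exact ih _ (hh.comp_exchange _)
  have hcyc : ∀ a k, ∀ (h : Config → ℝ), IsLocal h →
      ∃ Y K, IsFormBounded ρ (fun η => h (cyc a k η) - h η) Y K := by
    intro a k
    induction k with
    | zero =>
      intro h _
      exact ⟨∅, 0, by simpa [cyc] using IsFormBounded.zero⟩
    | succ k ih =>
      intro h hh
      have hh' := hh.comp_exchange (a + k)
      obtain ⟨Y, K, h1⟩ := ih _ hh'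
      obtain ⟨b, -, hb⟩ := hh.exists_bound
      have h2 := IsFormBounded.sub_exchange (ρ := ρ) hh' (fun η => hb _) (a + k)
      simp only [exchange_exchange] at h2
      exact ⟨_, _, h1.add ((cyc_local _ hh' a k).sub hh') (hh'.sub hh) h2 fun η => by
        rw [cyc_succ]
        ring⟩
  obtain ⟨m, hm⟩ := hh.exists_box
  obtain ⟨Y, K, h1⟩ := hcyc (-m) (2 * m + 1) h hh
  refine ⟨Y, K, ?_⟩
  convert h1 using 3 with η
  refine hm fun w hw => ?_
  rw [(cyc_apply (-m) (2 * m + 1) η).1 w hw.1 (by have := hw.2; push_cast; omega), shift, add_comm]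

lemma exists_formBounded_comp_shift {h : Config → ℝ} (hh : IsLocal h) (z : ℤ) :
    ∃ Y K, IsFormBounded ρ (fun η => h (shift z η) - h η) Y K := by
  induction z using Int.induction_on with
  | zero => exact ⟨∅, 0, by simpa using IsFormBounded.zero⟩
  | succ i ih =>
    obtain ⟨Y, K, h1⟩ := ih
    obtain ⟨Y', K', h2⟩ := exists_formBounded_comp_shift_one (ρ := ρ) (hh.comp_shift i)
    exact ⟨_, _, h1.add ((hh.comp_shift _).sub hh) (((hh.comp_shift _).comp_shift 1).sub
      (hh.comp_shift _)) h2 fun η => by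
        rw [shift_shift, add_comm 1]
        ring⟩
  | pred i ih =>
    obtain ⟨Y, K, h1⟩ := ih
    obtain ⟨Y', K', h2⟩ := exists_formBounded_comp_shift_one (ρ := ρ)
      (hh.comp_shift (-i - 1)).neg
    exact ⟨_, _, h1.add ((hh.comp_shift _).sub hh) (((hh.comp_shift _).neg.comp_shift 1).sub
      (hh.comp_shift _).neg) h2 fun η => by
        rw [shift_shift, add_sub_cancel]
        ring⟩

end Forms

/-! ### The generator of the environment as seen by the walk -/

section Generator

variable {ρ : unitInterval} {c : Config → ℝ} {R : Finset ℤ} {r : ℤ → Config → ℝ} {n : ℕ+}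

/-- The generator of the environment as seen by the walk: the lattice gas, and translations by the
jumps of the walk. -/
noncomputable def seenGenerator (c : Config → ℝ) (R : Finset ℤ) (r : ℤ → Config → ℝ) (n : ℕ+)
    (f : Config → ℝ) (ξ : Config) : ℝ :=
  (n : ℝ) ^ 2 * latticeGasGenerator c f ξ + (n : ℝ) * ∑ z ∈ R, r z ξ * (f (shift z ξ) - f ξ)

lemma latticeGasGenerator_eq_sum {f : Config → ℝ} {a b : ℤ} (hf : DependsOn f (Set.Icc a b))
    {Y : Finset ℤ} (hY : Finset.Icc (a - 1) b ⊆ Y) (η : Config) :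
    latticeGasGenerator c f η = ∑ y ∈ Y, c (shift y η) * (f (exchange y η) - f η) := by
  refine finsum_eq_sum_of_support_subset _ fun y hy => ?_
  apply hY
  by_contra h
  apply hy
  simp only [Finset.mem_Icc, not_and_or, not_le] at h
  beta_reduce
  rw [comp_exchange_of_notMem hf, sub_self, mul_zero]
  · simp only [Set.mem_Icc]; omega
  · simp only [Set.mem_Icc]; omega

lemma IsLocal.latticeGasGenerator (hc : IsLocal c) {f : Config → ℝ} (hf : IsLocal f) :
    IsLocal (latticeGasGenerator c f) := by
  obtain ⟨m, hm⟩ := hf.exists_box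
  rw [funext (latticeGasGenerator_eq_sum hm subset_rfl)]
  exact IsLocal.sum _ fun y _ => (hc.comp_shift y).mul ((hf.comp_exchange y).sub hf)

lemma IsLocal.seenGenerator (hc : IsLocal c) (hr : ∀ z ∈ R, IsLocal (r z)) (n : ℕ+)
    {f : Config → ℝ} (hf : IsLocal f) : IsLocal (seenGenerator c R r n f) :=
  ((hc.latticeGasGenerator hf).const_mul _).add
    ((IsLocal.sum R fun z hz => (hr z hz).mul ((hf.comp_shift z).sub hf)).const_mul _)

lemma latticeGasGenerator_add {f g : Config → ℝ} (hf : IsLocal f) (hg : IsLocal g) (η : Config) :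
    latticeGasGenerator c (fun η => f η + g η) η
      = latticeGasGenerator c f η + latticeGasGenerator c g η := by
  obtain ⟨m, hm⟩ := hf.exists_box
  obtain ⟨k, hk⟩ := hg.exists_box
  have hm' : DependsOn f (Set.Icc (-(m + k : ℕ) : ℤ) (m + k : ℕ)) :=
    hm.mono (Set.Icc_subset_Icc (by push_cast; omega) (by push_cast; omega))
  have hk' : DependsOn g (Set.Icc (-(m + k : ℕ) : ℤ) (m + k : ℕ)) :=
    hk.mono (Set.Icc_subset_Icc (by push_cast; omega) (by push_cast; omega))
  have h : DependsOn (fun η => f η + g η) (Set.Icc (-(m + k : ℕ) : ℤ) (m + k : ℕ)) :=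
    fun η ζ h => by simp only [hm' h, hk' h]
  rw [latticeGasGenerator_eq_sum h subset_rfl, latticeGasGenerator_eq_sum hm' subset_rfl,
    latticeGasGenerator_eq_sum hk' subset_rfl, ← Finset.sum_add_distrib]
  exact Finset.sum_congr rfl fun y _ => by ring

lemma latticeGasGenerator_const_mul (a : ℝ) (f : Config → ℝ) (η : Config) :
    latticeGasGenerator c (fun η => a * f η) η = a * latticeGasGenerator c f η := by
  unfold latticeGasGenerator
  rw [← smul_eq_mul a, smul_finsum]
  exact finsum_congr fun y => by rw [smul_eq_mul]; ring

/-- The generator of the environment as seen by the walk with the potential `W` added to it, as a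
linear operator on local functions. -/
noncomputable def potentialGenerator (hc : IsLocal c) (hr : ∀ z ∈ R, IsLocal (r z)) (n : ℕ+)
    {W : Config → ℝ} (hW : IsLocal W) : localFunctions →ₗ[ℝ] localFunctions where
  toFun f := ⟨fun ξ => seenGenerator c R r n f.1 ξ + W ξ * f.1 ξ,
    (hc.seenGenerator hr n f.2).add (hW.mul f.2)⟩
  map_add' f g := by
    ext ξ
    simp only [seenGenerator, Submodule.coe_add, Pi.add_apply]
    have := latticeGasGenerator_add (c := c) f.2 g.2 ξ
    simp only [mul_sub, mul_add, Finset.sum_sub_distrib, Finset.sum_add_distrib]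
    change _ * latticeGasGenerator c (fun η => f.1 η + g.1 η) ξ + _ + _ = _
    rw [this]
    ring
  map_smul' a f := by
    ext ξ
    simp only [seenGenerator, SetLike.val_smul, Pi.smul_apply, smul_eq_mul, RingHom.id_apply]
    change _ * latticeGasGenerator c (fun η => a * f.1 η) ξ + _ + _ = _
    rw [latticeGasGenerator_const_mul]
    simp only [← mul_sub, mul_left_comm _ a, ← Finset.mul_sum]
    ring

/-! ### The energy estimate -/

/-- By reversibility, the quadratic form of the lattice gas dominates the Dirichlet form of the
symmetric exclusion process. -/
lemma integral_mul_latticeGasGenerator_le (hc : IsLocal c) {ε₀ : ℝ} (hε : ∀ η, ε₀ ≤ c η)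
    (hrev : DependsOn c ({0, 1}ᶜ : Set ℤ)) (hε0 : 0 < ε₀) {f : Config → ℝ} (hf : IsLocal f)
    (Y : Finset ℤ) :
    ∫ η, f η * latticeGasGenerator c f η ∂(bernoulliProduct ρ) ≤
      -(ε₀ / 2) * ∑ y ∈ Y, bondForm ρ y f := by
  classical
  obtain ⟨m, hm⟩ := hf.exists_box
  have e : ∀ η, f η * latticeGasGenerator c f η =
      ∑ y ∈ Y ∪ Finset.Icc (-m - 1 : ℤ) m, f η * (c (shift y η) * (f (exchange y η) - f η)) := by
    intro η
    rw [latticeGasGenerator_eq_sum hm Finset.subset_union_right, Finset.mul_sum]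
  have hl : ∀ y, IsLocal fun η => f η * (c (shift y η) * (f (exchange y η) - f η)) := fun y =>
    hf.mul ((hc.comp_shift y).mul ((hf.comp_exchange y).sub hf))
  have hbond : ∀ y, ∫ η, f η * (c (shift y η) * (f (exchange y η) - f η)) ∂(bernoulliProduct ρ)
      ≤ -(ε₀ / 2) * bondForm ρ y f := by
    intro y
    have hcy : ∀ η, c (shift y (exchange y η)) = c (shift y η) := fun η => hrev fun i hi => by
      simp only [Set.mem_compl_iff, Set.mem_insert_iff, Set.mem_singleton_iff, not_or] at hi
      exact exchange_apply_of_ne (by omega) (by omega) η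
    have i1 : IsLocal fun η => c (shift y η) * f η ^ 2 := (hc.comp_shift y).mul (hf.pow 2)
    have h1 := integral_comp_exchange (ρ := ρ) i1 y
    simp only [hcy] at h1
    have i2 : IsLocal fun η => c (shift y η) * f (exchange y η) ^ 2 :=
      (hc.comp_shift y).mul ((hf.comp_exchange y).pow 2)
    have i3 : IsLocal fun η => -(ε₀ / 2) * (f (exchange y η) - f η) ^ 2 :=
      (((hf.comp_exchange y).sub hf).pow 2).const_mul _
    have i4 : IsLocal fun η => (1 / 2) * (c (shift y η) * f (exchange y η) ^ 2 -
        c (shift y η) * f η ^ 2) := (i2.sub i1).const_mul _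
    have hle : ∀ η, f η * (c (shift y η) * (f (exchange y η) - f η)) ≤
        -(ε₀ / 2) * (f (exchange y η) - f η) ^ 2 + (1 / 2) *
          (c (shift y η) * f (exchange y η) ^ 2 - c (shift y η) * f η ^ 2) := fun η => by
      have := mul_le_mul_of_nonneg_right (hε (shift y η)) (sq_nonneg (f (exchange y η) - f η))
      nlinarith
    refine ((hl y).integral_mono (i3.add i4) hle).trans (le_of_eq ?_)
    rw [i3.integral_add i4, integral_const_mul, integral_const_mul,
      integral_sub (i2.integrable _) (i1.integrable _), h1, bondForm]
    ring
  simp_rw [e]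
  rw [integral_finsetSum _ fun y _ => (hl y).integrable _, Finset.mul_sum]
  refine (Finset.sum_le_sum fun y _ => hbond y).trans ?_
  rw [← Finset.mul_sum, ← Finset.mul_sum]
  refine mul_le_mul_of_nonpos_left ?_ (by linarith)
  exact Finset.sum_le_sum_of_subset_of_nonneg Finset.subset_union_left
    fun _ _ _ => bondForm_nonneg _ _

/-- The quadratic form of the translations is controlled by the failure of the Bernoulli measure to
be invariant under them. -/
lemma integral_mul_translations_le (hr : ∀ z ∈ R, IsLocal (r z)) (hr0 : ∀ z ∈ R, ∀ η, 0 ≤ r z η)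
    {f : Config → ℝ} (hf : IsLocal f) :
    ∫ η, f η * ∑ z ∈ R, r z η * (f (shift z η) - f η) ∂(bernoulliProduct ρ) ≤
      (1 / 2) * ∫ η, (∑ z ∈ R, (r z (shift (-z) η) - r z η)) * f η ^ 2 ∂(bernoulliProduct ρ) := by
  simp_rw [Finset.mul_sum, Finset.sum_mul]
  have h0 : ∀ z ∈ R, IsLocal fun η => f η * (r z η * (f (shift z η) - f η)) := fun z hz =>
    hf.mul ((hr z hz).mul ((hf.comp_shift z).sub hf))
  have h1 : ∀ z ∈ R, IsLocal fun η => (r z (shift (-z) η) - r z η) * f η ^ 2 := fun z hz =>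
    (((hr z hz).comp_shift _).sub (hr z hz)).mul (hf.pow 2)
  rw [integral_finsetSum _ fun z hz => (h0 z hz).integrable _,
    integral_finsetSum _ fun z hz => (h1 z hz).integrable _, Finset.mul_sum]
  refine Finset.sum_le_sum fun z hz => ?_
  have i1 : IsLocal fun η => r z (shift (-z) η) * f η ^ 2 :=
    ((hr z hz).comp_shift _).mul (hf.pow 2)
  have i2 : IsLocal fun η => r z η * f η ^ 2 := (hr z hz).mul (hf.pow 2)
  have i3 : IsLocal fun η => r z η * f (shift z η) ^ 2 := (hr z hz).mul ((hf.comp_shift z).pow 2)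
  have h2 := integral_comp_shift (ρ := ρ) i1 z
  simp only [shift_shift, add_neg_cancel, shift_zero] at h2
  have hle : ∀ η, f η * (r z η * (f (shift z η) - f η)) ≤
      (1 / 2) * (r z η * f (shift z η) ^ 2 - r z η * f η ^ 2) := fun η => by
    have := mul_nonneg (hr0 z hz η) (sq_nonneg (f (shift z η) - f η))
    nlinarith
  refine ((h0 z hz).integral_mono ((i3.sub i2).const_mul _) hle).trans (le_of_eq ?_)
  simp_rw [sub_mul]
  rw [integral_const_mul, integral_sub (i3.integrable _) (i2.integrable _),
    integral_sub (i1.integrable _) (i2.integrable _), h2]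

/-- The energy estimate. The part `n² ε₀ / 2` of the Dirichlet form is split into two halves, which
absorb the failure of invariance under the translations and the potential. -/
theorem exists_energy_estimate (ρ : unitInterval) (hc : IsLocal c) {ε₀ : ℝ} (hε0 : 0 < ε₀)
    (hε : ∀ η, ε₀ ≤ c η) (hrev : DependsOn c ({0, 1}ᶜ : Set ℤ)) (hr : ∀ z ∈ R, IsLocal (r z))
    (hr0 : ∀ z ∈ R, ∀ η, 0 ≤ r z η) :
    ∃ C, 0 ≤ C ∧ ∀ (n : ℕ+) (V : Config → ℝ) (Y : Finset ℤ) (K θ : ℝ), IsLocal V →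
      IsFormBounded ρ V Y K → 0 < θ → ∀ f, IsLocal f →
      ∫ η, f η * (seenGenerator c R r n f η + θ * V η * f η) ∂(bernoulliProduct ρ) ≤
        (C + 4 * θ ^ 2 * K / (n ^ 2 * ε₀)) * ∫ η, f η ^ 2 ∂(bernoulliProduct ρ) := by
  classical
  have hg : ∃ Y K, IsFormBounded ρ (fun η => ∑ z ∈ R, (r z (shift (-z) η) - r z η)) Y K := by
    have : ∀ z : ℤ, ∃ Y K, z ∈ R → IsFormBounded ρ (fun η => r z (shift (-z) η) - r z η) Y K := by
      intro z
      by_cases hz : z ∈ R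
      · obtain ⟨Y, K, h⟩ := exists_formBounded_comp_shift (ρ := ρ) (hr z hz) (-z)
        exact ⟨Y, K, fun _ => h⟩
      · exact ⟨∅, 0, fun h => absurd h hz⟩
    choose Y K h using this
    refine ⟨R.biUnion Y, _, IsFormBounded.sum R (K := ∑ z ∈ R, |K z|)
      (fun z hz => ((hr z hz).comp_shift _).sub (hr z hz)) fun z hz => (h z hz).mono
        (Finset.subset_biUnion_of_mem Y hz) ((le_abs_self _).trans
          (Finset.single_le_sum (f := fun z => |K z|) (fun _ _ => abs_nonneg _) hz))⟩
  obtain ⟨Y₀, K₀, hg⟩ := hg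
  refine ⟨|K₀| / ε₀, by positivity, fun n V Y K θ hVl hV hθ f hf => ?_⟩
  have hn : (0 : ℝ) < n := by exact_mod_cast n.pos
  have hVf : IsLocal fun η => θ * V η * f η ^ 2 := (hVl.const_mul θ).mul (hf.pow 2)
  have hJ : IsLocal fun η => f η * ∑ z ∈ R, r z η * (f (shift z η) - f η) :=
    hf.mul (IsLocal.sum R fun z hz => (hr z hz).mul ((hf.comp_shift z).sub hf))
  have hL : IsLocal fun η => f η * latticeGasGenerator c f η :=
    hf.mul (hc.latticeGasGenerator hf)
  have e : ∀ η, f η * (seenGenerator c R r n f η + θ * V η * f η) =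
      ((n : ℝ) ^ 2 * (f η * latticeGasGenerator c f η) +
        n * (f η * ∑ z ∈ R, r z η * (f (shift z η) - f η))) + θ * (V η * f η ^ 2) := fun η => by
    unfold seenGenerator
    ring
  simp_rw [e]
  rw [((hL.const_mul _).add (hJ.const_mul _)).integral_add ((hVl.mul (hf.pow 2)).const_mul _),
    (hL.const_mul _).integral_add (hJ.const_mul _), integral_const_mul, integral_const_mul,
    integral_const_mul]
  have h1 := integral_mul_latticeGasGenerator_le (ρ := ρ) hc hε hrev hε0 hf (Y₀ ∪ Y)
  have h2 := (integral_mul_translations_le (ρ := ρ) hr hr0 hf).trans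
    (mul_le_mul_of_nonneg_left ((hg.mono Finset.subset_union_left (le_abs_self K₀)
      (Y' := Y₀ ∪ Y)) f hf (n * ε₀ / 2) (by positivity)) (by norm_num))
  have h3 := (hV.mono (Finset.subset_union_right (s₁ := Y₀)) le_rfl) f hf
    (n ^ 2 * ε₀ / (4 * θ)) (by positivity)
  set D := ∑ y ∈ Y₀ ∪ Y, bondForm ρ y f
  set N := ∫ η, f η ^ 2 ∂(bernoulliProduct ρ)
  have h1' := mul_le_mul_of_nonneg_left h1 (sq_nonneg (n : ℝ))
  have h2' := mul_le_mul_of_nonneg_left h2 hn.le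
  have h3' := mul_le_mul_of_nonneg_left h3 hθ.le
  refine (add_le_add (add_le_add h1' h2') h3').trans (le_of_eq ?_)
  field_simp
  ring

end Generator

/-! ### Local functions are analytic vectors -/

section Analytic

variable {c : Config → ℝ} {R : Finset ℤ} {r : ℤ → Config → ℝ} {n : ℕ+} {W : Config → ℝ}

/-- One application of the generator enlarges the support by a fixed number of sites, and the
sup norm by a factor that is proportional to the size of the support. -/
lemma exists_generator_bound (hc : IsLocal c) (hr : ∀ z ∈ R, IsLocal (r z)) (n : ℕ+)
    (hW : IsLocal W) :
    ∃ (q : ℕ) (κ : ℝ), 0 < q ∧ 0 < κ ∧ ∀ (m : ℕ) (f : localFunctions) (b : ℝ),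
      DependsOn f.1 (Set.Icc (-m : ℤ) m) → (∀ η, |f.1 η| ≤ b) →
      DependsOn (potentialGenerator hc hr n hW f).1 (Set.Icc (-(m + q : ℕ) : ℤ) (m + q : ℕ)) ∧
      ∀ η, |(potentialGenerator hc hr n hW f).1 η| ≤ κ * (m + 1) * b := by
  obtain ⟨pc, hpc⟩ := hc.exists_box
  obtain ⟨pW, hpW⟩ := hW.exists_box
  obtain ⟨bc, hbc0, hbc⟩ := hc.exists_bound
  obtain ⟨bW, hbW0, hbW⟩ := hW.exists_bound
  have hr' : ∀ z : ℤ, ∃ (p : ℕ) (b : ℝ), 0 ≤ b ∧ (z ∈ R → DependsOn (r z) (Set.Icc (-p : ℤ) p) ∧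
      ∀ η, |r z η| ≤ b) := by
    intro z
    by_cases hz : z ∈ R
    · obtain ⟨p, hp⟩ := (hr z hz).exists_box
      obtain ⟨b, hb0, hb⟩ := (hr z hz).exists_bound
      exact ⟨p, b, hb0, fun _ => ⟨hp, hb⟩⟩
    · exact ⟨0, 0, le_rfl, fun h => absurd h hz⟩
  choose pr br hbr0 hpr using hr'
  have hn : (0 : ℝ) < n := by exact_mod_cast n.pos
  refine ⟨pc + pW + 1 + ∑ z ∈ R, (pr z + z.natAbs),
    n ^ 2 * (2 * (bc * 2)) + n * (∑ z ∈ R, br z * 2) + bW + 1, by omega, ?_, ?_⟩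
  · have := Finset.sum_nonneg fun z (_ : z ∈ R) => mul_nonneg (hbr0 z) zero_le_two
    positivity
  intro m f b hf hfb
  have hb0 : 0 ≤ b := (abs_nonneg _).trans (hfb fun _ => true)
  have hsum := latticeGasGenerator_eq_sum (c := c) hf subset_rfl
  have hdiff : ∀ η ζ, |f.1 η - f.1 ζ| ≤ 2 * b := fun η ζ =>
    (abs_sub _ _).trans (by linarith [hfb η, hfb ζ])
  constructor
  · intro η ζ h
    set q := pc + pW + 1 + ∑ z ∈ R, (pr z + z.natAbs)
    have hfe : f.1 η = f.1 ζ := hf fun i hi => h i (by simp only [Set.mem_Icc] at *; omega)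
    change (n : ℝ) ^ 2 * latticeGasGenerator c f.1 η +
        (n : ℝ) * ∑ z ∈ R, r z η * (f.1 (shift z η) - f.1 η) + W η * f.1 η =
      (n : ℝ) ^ 2 * latticeGasGenerator c f.1 ζ +
        (n : ℝ) * ∑ z ∈ R, r z ζ * (f.1 (shift z ζ) - f.1 ζ) + W ζ * f.1 ζ
    rw [hfe, hpW fun i hi => h i (by simp only [Set.mem_Icc] at *; omega), hsum, hsum]
    congr 3
    · refine Finset.sum_congr rfl fun y hy => ?_
      rw [Finset.mem_Icc] at hy
      rw [hfe, hpc (x := shift y η) (y := shift y ζ) fun i hi => h _ (by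
          simp only [Set.mem_Icc] at *; omega),
        hf (x := exchange y η) (y := exchange y ζ) fun i hi => h _ (by
          simp only [Set.mem_Icc, Equiv.swap_apply_def] at *
          split_ifs <;> omega)]
    · refine Finset.sum_congr rfl fun z hz => ?_
      have hq := Finset.single_le_sum (f := fun z : ℤ => pr z + z.natAbs)
        (fun _ _ => Nat.zero_le _) hz
      rw [(hpr z hz).1 fun i hi => h i (by simp only [Set.mem_Icc] at *; omega),
        hf (x := shift z η) (y := shift z ζ) fun i hi => h _ (by
          simp only [Set.mem_Icc] at *; omega)]
  · intro η
    change |(n : ℝ) ^ 2 * latticeGasGenerator c f.1 η +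
        (n : ℝ) * ∑ z ∈ R, r z η * (f.1 (shift z η) - f.1 η) + W η * f.1 η| ≤ _
    have h1 : |latticeGasGenerator c f.1 η| ≤ (2 * m + 2) * (bc * (2 * b)) := by
      rw [hsum]
      refine (Finset.abs_sum_le_sum_abs _ _).trans
        ((Finset.sum_le_card_nsmul _ _ (bc * (2 * b)) fun y _ => ?_).trans (le_of_eq ?_))
      · rw [abs_mul]
        exact mul_le_mul (hbc _) (hdiff _ _) (abs_nonneg _) hbc0
      · have : (Finset.Icc (-m - 1 : ℤ) m).card = 2 * m + 2 := by
          rw [Int.card_Icc]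
          omega
        rw [this, nsmul_eq_mul]
        push_cast
        ring
    have h2 : |∑ z ∈ R, r z η * (f.1 (shift z η) - f.1 η)| ≤ ∑ z ∈ R, br z * (2 * b) := by
      refine (Finset.abs_sum_le_sum_abs _ _).trans (Finset.sum_le_sum fun z hz => ?_)
      rw [abs_mul]
      exact mul_le_mul ((hpr z hz).2 _) (hdiff _ _) (abs_nonneg _) (hbr0 z)
    have h3 : |W η * f.1 η| ≤ bW * b := by
      rw [abs_mul]
      exact mul_le_mul (hbW _) (hfb _) (abs_nonneg _) hbW0
    have e : ∑ z ∈ R, br z * (2 * b) = (∑ z ∈ R, br z * 2) * b := by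
      rw [Finset.sum_mul]
      exact Finset.sum_congr rfl fun z _ => by ring
    rw [e] at h2
    have hs : 0 ≤ ∑ z ∈ R, br z * 2 :=
      Finset.sum_nonneg fun z (_ : z ∈ R) => mul_nonneg (hbr0 z) zero_le_two
    set s := ∑ z ∈ R, br z * 2
    calc _ ≤ (n : ℝ) ^ 2 * ((2 * m + 2) * (bc * (2 * b))) + n * (s * b) + bW * b := by
          refine (abs_add_le _ _).trans (add_le_add ((abs_add_le _ _).trans (add_le_add ?_ ?_)) h3)
          · rw [abs_mul, abs_of_nonneg (by positivity : (0 : ℝ) ≤ n ^ 2)]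
            gcongr
          · rw [abs_mul, abs_of_pos hn]
            gcongr
      _ ≤ _ := by
          have : (0 : ℝ) ≤ n * s * m * b + bW * b * m + (m + 1) * b := by positivity
          nlinarith

/-- Local functions are analytic vectors of the generator, with a radius of convergence that does
not depend on the function. -/
theorem exists_analytic_bound (hc : IsLocal c) (hr : ∀ z ∈ R, IsLocal (r z)) (n : ℕ+)
    (hW : IsLocal W) :
    ∃ κ : ℝ, 0 < κ ∧ ∀ f : localFunctions, ∃ B, 0 ≤ B ∧ ∀ (k : ℕ) (η : Config),
      |((potentialGenerator hc hr n hW)^[k] f).1 η| ≤ B * κ ^ k * k.factorial := by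
  obtain ⟨q, κ, hq, hκ, h⟩ := exists_generator_bound hc hr n hW
  have hq' : (1 : ℝ) ≤ q := by exact_mod_cast hq
  refine ⟨2 * (κ * q), by positivity, fun f => ?_⟩
  obtain ⟨m, hm⟩ := IsLocal.exists_box f.2
  obtain ⟨b, hb0, hb⟩ := IsLocal.exists_bound f.2
  have key : ∀ k : ℕ, DependsOn ((potentialGenerator hc hr n hW)^[k] f).1
      (Set.Icc (-(m + k * q : ℕ) : ℤ) (m + k * q : ℕ)) ∧ ∀ η,
      |((potentialGenerator hc hr n hW)^[k] f).1 η| ≤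
        b * (κ * q) ^ k * ((m + 1).ascFactorial k : ℕ) := by
    intro k
    induction k with
    | zero => simpa using ⟨hm, hb⟩
    | succ k ih =>
      rw [Function.iterate_succ_apply']
      obtain ⟨h1, h2⟩ := h _ _ _ ih.1 ih.2
      refine ⟨by rw [add_mul, one_mul, ← add_assoc]; exact h1, fun η => (h2 η).trans ?_⟩
      rw [Nat.ascFactorial_succ]
      have h3 : (((m + k * q : ℕ) : ℝ) + 1) ≤ q * (m + 1 + k) := by
        push_cast
        have : (m : ℝ) * 1 ≤ m * q := by gcongr
        nlinarith
      calc κ * (((m + k * q : ℕ) : ℝ) + 1) * (b * (κ * q) ^ k * ((m + 1).ascFactorial k : ℕ))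
          ≤ κ * (q * (m + 1 + k)) * (b * (κ * q) ^ k * ((m + 1).ascFactorial k : ℕ)) := by gcongr
        _ = _ := by
          push_cast
          ring
  refine ⟨b * 2 ^ m, by positivity, fun k η => ((key k).2 η).trans ?_⟩
  have h4 : ((m + 1).ascFactorial k : ℝ) ≤ k.factorial * 2 ^ (m + k) := by
    rw [Nat.ascFactorial_eq_factorial_mul_choose]
    exact_mod_cast Nat.mul_le_mul_left _ (Nat.choose_le_two_pow _ _)
  calc _ ≤ b * (κ * q) ^ k * (k.factorial * 2 ^ (m + k)) := by gcongr
    _ = _ := by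
      rw [mul_pow 2, pow_add]
      ring

end Analytic

/-! ### A uniqueness estimate for weakly differentiable families of functionals -/

section Abstract

open Set

lemma hasDerivAt_exponential_partialSum {E : Type*} [NormedAddCommGroup E] [NormedSpace ℝ E]
    (x : ℕ → E) (m : ℕ) (s : ℝ) :
    HasDerivAt (fun s : ℝ => ∑ k ∈ Finset.range (m + 1), (s ^ k / k.factorial) • x k)
      (∑ k ∈ Finset.range m, (s ^ k / k.factorial) • x (k + 1)) s := by
  induction m with
  | zero => simpa using hasDerivAt_const s (x 0)
  | succ m ih =>
    simp_rw [Finset.sum_range_succ _ (m + 1)]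
    rw [Finset.sum_range_succ _ m]
    refine ih.add ?_
    have h := ((hasDerivAt_pow (m + 1) s).div_const ((m + 1).factorial : ℝ)).smul_const (x (m + 1))
    convert h using 2
    rw [Nat.factorial_succ]
    have : (m.factorial : ℝ) ≠ 0 := by positivity
    push_cast
    field_simp

/-- The Taylor polynomial of `y 0`, as a function of the point at which it is expanded, has the
derivative that appears in the integral form of the remainder. -/
lemma hasDerivWithinAt_taylor {y : ℕ → ℝ → ℝ} {s : ℝ}
    (hy : ∀ k, HasDerivWithinAt (y k) (y (k + 1) s) (Ici s) s) (b : ℝ) (m : ℕ) :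
    HasDerivWithinAt (fun s => ∑ k ∈ Finset.range (m + 1), (b - s) ^ k / k.factorial * y k s)
      ((b - s) ^ m / m.factorial * y (m + 1) s) (Ici s) s := by
  induction m with
  | zero => simpa using hy 0
  | succ m ih =>
    simp_rw [Finset.sum_range_succ _ (m + 1)]
    have h1 : HasDerivAt (fun x => (b - x) ^ (m + 1) / ((m + 1).factorial : ℝ))
        (-((b - s) ^ m / m.factorial)) s := by
      have := (((hasDerivAt_id' s).const_sub b).fun_pow (m + 1)).div_const ((m + 1).factorial : ℝ)
      refine this.congr_deriv ?_
      rw [Nat.factorial_succ]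
      have : (m.factorial : ℝ) ≠ 0 := by positivity
      push_cast
      field_simp
    refine (ih.fun_add (h1.hasDerivWithinAt.fun_mul (hy (m + 1)))).congr_deriv ?_
    ring

variable {V H : Type*} [AddCommGroup V] [Module ℝ V] [NormedAddCommGroup H] [InnerProductSpace ℝ H]
  {L : V →ₗ[ℝ] V} {ι : V →ₗ[ℝ] H} {C κ : ℝ}

/-- The partial sum of the exponential series of `s L`, applied to `f`. -/
noncomputable def expSum (L : V →ₗ[ℝ] V) (m : ℕ) (s : ℝ) (f : V) : V :=
  ∑ k ∈ Finset.range (m + 1), (s ^ k / k.factorial) • L^[k] f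

/-- The energy estimate for the partial sums of the exponential series: within half of the radius of
convergence, the growth rate is the dissipativity constant, up to an error that vanishes as the
number of terms grows. -/
lemma norm_expSum_sq_le (hκ : 0 < κ) (hdiss : ∀ f, inner ℝ (ι f) (ι (L f)) ≤ C * ‖ι f‖ ^ 2)
    {f : V} {B : ℝ} (hB0 : 0 ≤ B) (hB : ∀ k : ℕ, ‖ι (L^[k] f)‖ ≤ B * κ ^ k * k.factorial)
    {τ : ℝ} (hτ : 0 ≤ τ) (hτκ : κ * τ ≤ 1 / 2) (m : ℕ) :
    ‖ι (expSum L m τ f)‖ ^ 2 ≤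
      gronwallBound (‖ι f‖ ^ 2) (2 * C) (4 * B * (B * κ * (m + 1) * (1 / 2) ^ m)) τ := by
  have hι : ∀ s, ι (expSum L m s f) =
      ∑ k ∈ Finset.range (m + 1), (s ^ k / k.factorial) • ι (L^[k] f) := fun s => by
    simp [expSum, map_sum]
  have hd : ∀ s, HasDerivAt (fun s => ι (expSum L m s f))
      (ι (L (expSum L m s f)) - (s ^ m / m.factorial) • ι (L^[m + 1] f)) s := by
    intro s
    simp_rw [hι]
    convert hasDerivAt_exponential_partialSum (fun k => ι (L^[k] f)) m s using 1
    simp only [expSum, map_sum, map_smul]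
    rw [Finset.sum_range_succ]
    simp [Function.iterate_succ_apply']
  have hs : ∀ s ∈ Ico 0 τ, κ * s ≤ 1 / 2 := fun s hs =>
    (mul_le_mul_of_nonneg_left hs.2.le hκ.le).trans hτκ
  have hnorm : ∀ s ∈ Ico 0 τ, ‖ι (expSum L m s f)‖ ≤ 2 * B := by
    intro s h
    have h0 : 0 ≤ s := h.1
    rw [hι]
    calc _ ≤ ∑ k ∈ Finset.range (m + 1), B * (1 / 2 : ℝ) ^ k := by
          refine (norm_sum_le _ _).trans (Finset.sum_le_sum fun k _ => ?_)
          rw [norm_smul, Real.norm_of_nonneg (by positivity)]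
          have hk : (k.factorial : ℝ) ≠ 0 := by positivity
          calc s ^ k / k.factorial * ‖ι (L^[k] f)‖
              ≤ s ^ k / k.factorial * (B * κ ^ k * k.factorial) := by gcongr; exact hB k
            _ = B * (κ * s) ^ k := by
                field_simp
                ring
            _ ≤ _ := by gcongr; exact hs s h
      _ ≤ 2 * B := by
          rw [← Finset.mul_sum, mul_comm]
          gcongr
          exact (Summable.sum_le_tsum _ (fun _ _ => by positivity) summable_geometric_two).trans
            tsum_geometric_two.le
  have herr : ∀ s ∈ Ico 0 τ, ‖(s ^ m / m.factorial) • ι (L^[m + 1] f)‖ ≤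
      B * κ * (m + 1) * (1 / 2) ^ m := by
    intro s h
    have h0 : 0 ≤ s := h.1
    have hm : (m.factorial : ℝ) ≠ 0 := by positivity
    rw [norm_smul, Real.norm_of_nonneg (by positivity)]
    calc s ^ m / m.factorial * ‖ι (L^[m + 1] f)‖
        ≤ s ^ m / m.factorial * (B * κ ^ (m + 1) * (m + 1).factorial) := by gcongr; exact hB _
      _ = B * κ * (m + 1) * (κ * s) ^ m := by
          rw [Nat.factorial_succ]
          push_cast
          field_simp
          ring
      _ ≤ _ := by gcongr; exact hs s h
  have h := le_gronwallBound_of_liminf_deriv_right_le (a := 0) (b := τ)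
    (f := fun s => ‖ι (expSum L m s f)‖ ^ 2) (δ := ‖ι f‖ ^ 2) (K := 2 * C)
    (ε := 4 * B * (B * κ * (m + 1) * (1 / 2) ^ m))
    (fun s _ => (hd s).norm_sq.continuousAt.continuousWithinAt)
    (fun s _ q hq => (hd s).norm_sq.hasDerivWithinAt.liminf_right_slope_le hq)
    (by
      have : expSum L m 0 f = f := by
        rw [expSum, Finset.sum_range_succ']
        simp
      rw [this])
    (fun s hs' => by
      rw [inner_sub_right]
      have h1 := hdiss (expSum L m s f)
      have h2 := (abs_le.1 (abs_real_inner_le_norm (ι (expSum L m s f))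
        ((s ^ m / m.factorial) • ι (L^[m + 1] f)))).1
      have h3 := mul_le_mul (hnorm s hs') (herr s hs') (norm_nonneg _) (by positivity)
      linarith)
    τ ⟨hτ, le_rfl⟩
  simpa using h

/-- The step of `abs_functional_le` within half of the radius of convergence. The function
`s ↦ a s (expSum L m (t₁ - s) f)` interpolates between `a t₀ (expSum L m (t₁ - t₀) f)` and `a t₁ f`,
and by the forward equation its derivative is a single remainder term, which vanishes as `m`
grows. -/
lemma abs_functional_le_step (hκ : 0 < κ)
    (hdiss : ∀ f, inner ℝ (ι f) (ι (L f)) ≤ C * ‖ι f‖ ^ 2)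
    {a : ℝ → V →ₗ[ℝ] ℝ} {t₀ t₁ : ℝ} (hcont : ∀ f, ContinuousOn (fun t => a t f) (Icc t₀ t₁))
    (hderiv : ∀ f, ∀ t ∈ Ico t₀ t₁, HasDerivWithinAt (fun t => a t f) (a t (L f)) (Ici t) t)
    (hbound : ∀ f, ∃ B, 0 ≤ B ∧ ∀ k : ℕ, ‖ι (L^[k] f)‖ ≤ B * κ ^ k * k.factorial ∧
      ∀ t ∈ Icc t₀ t₁, |a t (L^[k] f)| ≤ B * κ ^ k * k.factorial)
    {K : ℝ} (hK : 0 ≤ K) (h0 : ∀ f, |a t₀ f| ≤ K * ‖ι f‖) (hle : t₀ ≤ t₁)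
    (hκt : κ * (t₁ - t₀) ≤ 1 / 2) (f : V) :
    |a t₁ f| ≤ K * Real.exp (C * (t₁ - t₀)) * ‖ι f‖ := by
  obtain ⟨B, hB0, hB⟩ := hbound f
  have hτ : 0 ≤ t₁ - t₀ := by linarith
  set τ := t₁ - t₀ with hτdef
  let e : ℕ → ℝ := fun m => B * κ * (m + 1) * (1 / 2) ^ m
  have he : Tendsto e atTop (𝓝 0) := by
    have h1 := tendsto_self_mul_const_pow_of_lt_one (r := (1 / 2 : ℝ)) (by norm_num) (by norm_num)
    have h2 := tendsto_pow_atTop_nhds_zero_of_lt_one (r := (1 / 2 : ℝ)) (by norm_num) (by norm_num)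
    have := (h1.add h2).const_mul (B * κ)
    simp only [add_zero, mul_zero] at this
    refine this.congr fun m => ?_
    simp only [e]
    ring
  have key : ∀ m : ℕ, |a t₁ f| ≤
      K * √(gronwallBound (‖ι f‖ ^ 2) (2 * C) (4 * B * e m) τ) + e m * τ := by
    intro m
    have hψ0 : a t₀ (expSum L m τ f) =
        ∑ k ∈ Finset.range (m + 1), (t₁ - t₀) ^ k / k.factorial * a t₀ (L^[k] f) := by
      simp [expSum, map_sum, hτdef]
    have hψ1 : a t₁ f =
        ∑ k ∈ Finset.range (m + 1), (t₁ - t₁) ^ k / k.factorial * a t₁ (L^[k] f) := by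
      rw [Finset.sum_range_succ']
      simp
    have hmv := norm_image_sub_le_of_norm_deriv_right_le_segment (a := t₀) (b := t₁)
      (f := fun s => ∑ k ∈ Finset.range (m + 1), (t₁ - s) ^ k / k.factorial * a s (L^[k] f))
      (f' := fun s => (t₁ - s) ^ m / m.factorial * a s (L^[m + 1] f)) (C := e m)
      (continuousOn_finsetSum _ fun k _ => ContinuousOn.mul (by fun_prop) (hcont _))
      (fun s hs => hasDerivWithinAt_taylor (y := fun k s => a s (L^[k] f))
        (fun k => by
          simp only [Function.iterate_succ_apply']
          exact hderiv _ s hs) t₁ m)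
      (fun s hs => by
        have h1 : 0 ≤ t₁ - s := by linarith [hs.2]
        have h2 : κ * (t₁ - s) ≤ 1 / 2 :=
          (mul_le_mul_of_nonneg_left (by linarith [hs.1]) hκ.le).trans hκt
        have hm : (m.factorial : ℝ) ≠ 0 := by positivity
        rw [norm_mul, Real.norm_of_nonneg (by positivity), Real.norm_eq_abs]
        calc (t₁ - s) ^ m / m.factorial * |a s (L^[m + 1] f)|
            ≤ (t₁ - s) ^ m / m.factorial * (B * κ ^ (m + 1) * (m + 1).factorial) := by
              gcongr
              exact (hB _).2 s ⟨hs.1, hs.2.le⟩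
          _ = B * κ * (m + 1) * (κ * (t₁ - s)) ^ m := by
              generalize t₁ - s = u
              rw [Nat.factorial_succ]
              push_cast
              field_simp
              ring
          _ ≤ _ := by
              simp only [e]
              gcongr)
      t₁ ⟨hle, le_rfl⟩
    rw [← hψ0, ← hψ1, Real.norm_eq_abs] at hmv
    have h3 : ‖ι (expSum L m τ f)‖ ≤ √(gronwallBound (‖ι f‖ ^ 2) (2 * C) (4 * B * e m) τ) :=
      Real.le_sqrt_of_sq_le
        (norm_expSum_sq_le hκ hdiss hB0 (fun k => (hB k).1) hτ hκt m)
    have h4 := (h0 (expSum L m τ f)).trans (mul_le_mul_of_nonneg_left h3 hK)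
    have h5 := abs_sub_abs_le_abs_sub (a t₁ f) (a t₀ (expSum L m τ f))
    linarith
  have hlim : Tendsto (fun m => K * √(gronwallBound (‖ι f‖ ^ 2) (2 * C) (4 * B * e m) τ) + e m * τ)
      atTop (𝓝 (K * √(gronwallBound (‖ι f‖ ^ 2) (2 * C) (4 * B * 0) τ) + 0 * τ)) :=
    ((((Real.continuous_sqrt.comp
      (gronwallBound_continuous_ε (‖ι f‖ ^ 2) (2 * C) τ)).tendsto _).comp
      (he.const_mul (4 * B))).const_mul K).add (he.mul_const τ)
  refine (ge_of_tendsto' hlim key).trans (le_of_eq ?_)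
  have : ‖ι f‖ ^ 2 * Real.exp (2 * C * τ) = (‖ι f‖ * Real.exp (C * τ)) ^ 2 := by
    rw [mul_pow, ← Real.exp_nat_mul]
    congr 2
    push_cast
    ring
  rw [mul_zero, gronwallBound_ε0, this, Real.sqrt_sq (by positivity)]
  ring

/-- Let the functionals `a t` on `V` solve the forward equation `d/dt (a t f) = a t (L f)`, for an
operator `L` that is dissipative up to a constant `C` for a Hilbert seminorm, and has every vector
as an analytic vector, with a common radius of convergence. Then the norm of `a t` with respect to
the Hilbert seminorm grows at most with the exponential rate `C`. -/
theorem abs_functional_le (hκ : 0 < κ)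
    (hdiss : ∀ f, inner ℝ (ι f) (ι (L f)) ≤ C * ‖ι f‖ ^ 2)
    {a : ℝ → V →ₗ[ℝ] ℝ} {t₀ t₁ : ℝ} (hcont : ∀ f, ContinuousOn (fun t => a t f) (Icc t₀ t₁))
    (hderiv : ∀ f, ∀ t ∈ Ico t₀ t₁, HasDerivWithinAt (fun t => a t f) (a t (L f)) (Ici t) t)
    (hbound : ∀ f, ∃ B, 0 ≤ B ∧ ∀ k : ℕ, ‖ι (L^[k] f)‖ ≤ B * κ ^ k * k.factorial ∧
      ∀ t ∈ Icc t₀ t₁, |a t (L^[k] f)| ≤ B * κ ^ k * k.factorial)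
    {K : ℝ} (hK : 0 ≤ K) (h0 : ∀ f, |a t₀ f| ≤ K * ‖ι f‖) {t : ℝ} (ht : t ∈ Icc t₀ t₁) (f : V) :
    |a t f| ≤ K * Real.exp (C * (t - t₀)) * ‖ι f‖ := by
  have key : ∀ j : ℕ, ∀ t ∈ Icc t₀ t₁, κ * (t - t₀) ≤ j * (1 / 2) →
      ∀ f, |a t f| ≤ K * Real.exp (C * (t - t₀)) * ‖ι f‖ := by
    intro j
    induction j with
    | zero =>
      intro t ht hj f
      have : t = t₀ := le_antisymm (by
        have := nonpos_of_mul_nonpos_right (by simpa using hj) hκ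
        linarith) ht.1
      simpa [this] using h0 f
    | succ j ih =>
      intro t ht hj f
      set s := max t₀ (t - 1 / (2 * κ)) with hs
      have hs0 : t₀ ≤ s := le_max_left _ _
      have hst : s ≤ t := max_le ht.1 (by
        have : 0 < 1 / (2 * κ) := by positivity
        linarith)
      have hκs : κ * (1 / (2 * κ)) = 1 / 2 := by field_simp
      have h1 : κ * (t - s) ≤ 1 / 2 := by
        rw [← hκs]
        have := le_max_right t₀ (t - 1 / (2 * κ))
        gcongr
        linarith
      have h2 : κ * (s - t₀) ≤ j * (1 / 2) := by
        rcases max_cases t₀ (t - 1 / (2 * κ)) with h | h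
        · rw [hs, h.1]
          simp
        · rw [hs, h.1]
          push_cast at hj
          nlinarith
      have h3 := ih s ⟨hs0, hst.trans ht.2⟩ h2
      have hsub : Icc s t ⊆ Icc t₀ t₁ := Icc_subset_Icc hs0 ht.2
      have h4 := abs_functional_le_step hκ hdiss (a := a) (t₀ := s) (t₁ := t)
        (fun f => (hcont f).mono hsub)
        (fun f u hu => hderiv f u ⟨hs0.trans hu.1, hu.2.trans_le ht.2⟩)
        (fun f => by
          obtain ⟨B, hB0, hB⟩ := hbound f
          exact ⟨B, hB0, fun k => ⟨(hB k).1, fun u hu => (hB k).2 u (hsub hu)⟩⟩)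
        (by positivity) h3 hst h1 f
      rw [mul_assoc K, ← Real.exp_add] at h4
      convert h4 using 4
      ring
  obtain ⟨j, hj⟩ := exists_nat_ge (κ * (t - t₀) * 2)
  exact key j t ht (by linarith) f

end Abstract

/-! ### Right-continuous processes -/

section RightContinuous

open Set

lemma measurable_uncurry_of_rightContinuous {S : Type*} [MeasurableSpace S] {v : ℝ → S → ℝ}
    (hv : ∀ s, Measurable (v s)) (hc : ∀ a s, ContinuousWithinAt (fun s => v s a) (Ici s) s) :
    Measurable (Function.uncurry v) := by
  -- the argument is rounded up to the next multiple of `1 / (j + 1)`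
  let up : ℕ → ℝ → ℝ := fun j s => ((⌊s * (j + 1)⌋ : ℝ) + 1) / (j + 1)
  have hup : ∀ (j : ℕ) (s : ℝ), s ≤ up j s ∧ up j s ≤ s + 1 / (j + 1) := fun j s => by
    have hj : (0 : ℝ) < j + 1 := by positivity
    constructor
    · rw [le_div_iff₀ hj]
      exact (Int.lt_floor_add_one _).le
    · rw [div_le_iff₀ hj, add_mul, one_div, inv_mul_cancel₀ hj.ne']
      linarith [Int.floor_le (s * (j + 1))]
  refine measurable_of_tendsto_metrizable (f := fun (j : ℕ) (p : ℝ × S) => v (up j p.1) p.2)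
    (fun j => ?_) (tendsto_pi_nhds.2 fun p => ?_)
  · have h1 : Measurable fun p : ℤ × S => v (((p.1 : ℝ) + 1) / (j + 1)) p.2 :=
      measurable_from_prod_countable_right fun k => hv (((k : ℝ) + 1) / (j + 1))
    have h2 : Measurable fun p : ℝ × S => (⌊p.1 * (j + 1)⌋, p.2) := by fun_prop
    exact h1.comp h2
  · have h1 : Tendsto (fun j : ℕ => up j p.1) atTop (𝓝[Ici p.1] p.1) := by
      refine tendsto_nhdsWithin_iff.2 ⟨?_, Eventually.of_forall fun j => (hup j p.1).1⟩
      have := (tendsto_one_div_add_atTop_nhds_zero_nat (𝕜 := ℝ)).const_add p.1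
      rw [add_zero] at this
      exact tendsto_of_tendsto_of_tendsto_of_le_of_le tendsto_const_nhds this
        (fun j => (hup j p.1).1) fun j => (hup j p.1).2
    exact (hc p.2 p.1).tendsto.comp h1

lemma measurable_intervalIntegral_of_rightContinuous {S : Type*} [MeasurableSpace S]
    {v : ℝ → S → ℝ} (hv : ∀ s, Measurable (v s))
    (hc : ∀ a s, ContinuousWithinAt (fun s => v s a) (Ici s) s) (p q : ℝ) :
    Measurable fun a => ∫ s in p..q, v s a := by
  have h := (measurable_uncurry_of_rightContinuous hv hc).stronglyMeasurable
  simp only [intervalIntegral]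
  exact (h.integral_prod_left.sub h.integral_prod_left).measurable

lemma measurable_of_rightContinuous {g : ℝ → ℝ}
    (hc : ∀ s, ContinuousWithinAt g (Ici s) s) : Measurable g := by
  have := measurable_uncurry_of_rightContinuous (S := Unit) (v := fun s _ => g s)
    (fun _ => measurable_const) fun _ s => hc s
  exact this.comp (measurable_id.prodMk (measurable_const (a := ())))

lemma intervalIntegrable_of_rightContinuous {g : ℝ → ℝ} {b : ℝ}
    (hc : ∀ s, ContinuousWithinAt g (Ici s) s) (hb : ∀ s, |g s| ≤ b) (p q : ℝ) :
    IntervalIntegrable g volume p q := by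
  rw [intervalIntegrable_iff]
  exact Measure.integrableOn_of_bounded (M := b) (by simp)
    (measurable_of_rightContinuous hc).aestronglyMeasurable (ae_of_all _ hb)

lemma hasDerivWithinAt_integral_of_rightContinuous {g : ℝ → ℝ} {b : ℝ}
    (hc : ∀ s, ContinuousWithinAt g (Ici s) s) (hb : ∀ s, |g s| ≤ b) (p t : ℝ) :
    HasDerivWithinAt (fun t => ∫ s in p..t, g s) (g t) (Ici t) t :=
  intervalIntegral.integral_hasDerivWithinAt_right (s := Ici t) (t := Ioi t)
    (intervalIntegrable_of_rightContinuous hc hb p t)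
    (measurable_of_rightContinuous hc).stronglyMeasurable.stronglyMeasurableAtFilter
    ((hc t).mono Ioi_subset_Ici_self)

lemma abs_intervalIntegral_le {g : ℝ → ℝ} {b : ℝ} (hb : ∀ s, |g s| ≤ b) (p q : ℝ) :
    |∫ s in p..q, g s| ≤ b * |q - p| :=
  intervalIntegral.norm_integral_le_of_norm_le_const (f := g) fun s _ => hb s

lemma abs_exp_sub_exp_le {x y m : ℝ} (hx : x ≤ m) (hy : y ≤ m) :
    |Real.exp x - Real.exp y| ≤ Real.exp m * |x - y| := by
  wlog h : x ≤ y generalizing x y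
  · rw [abs_sub_comm, abs_sub_comm x]
    exact this hy hx (le_of_not_ge h)
  rw [abs_sub_comm, abs_sub_comm x, abs_of_nonneg (sub_nonneg.2 (Real.exp_le_exp.2 h)),
    abs_of_nonneg (sub_nonneg.2 h)]
  have h1 : Real.exp y - Real.exp x = Real.exp y * (1 - Real.exp (x - y)) := by
    rw [mul_sub, ← Real.exp_add]
    simp
  have h2 : 1 - Real.exp (x - y) ≤ y - x := by linarith [Real.add_one_le_exp (x - y)]
  rw [h1]
  exact (mul_le_mul_of_nonneg_left h2 (Real.exp_pos _).le).trans
    (mul_le_mul_of_nonneg_right (Real.exp_le_exp.2 hy) (sub_nonneg.2 h))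

end RightContinuous

/-! ### The Feynman-Kac functional -/

section FeynmanKac

open Set

variable {S : Type*} [mS : MeasurableSpace S]

/-- `X` is a right-continuous process, adapted to `𝓕`, which solves the martingale problem for `L`
on local functions. The martingale property is stated as the orthogonality of the increments to
bounded random variables from the past. -/
structure SolvesMartingaleProblem (L : (Config → ℝ) → Config → ℝ) (P : Measure S)
    (𝓕 : Filtration ℝ≥0 mS) (X : ℝ → S → Config) : Prop where
  right_continuous : ∀ a s, ContinuousWithinAt (fun s => X s a) (Ici s) s
  adapted : ∀ s, Measurable[𝓕 s.toNNReal] (X s)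
  increment : ∀ f, IsLocal f → ∀ s t, 0 ≤ s → s ≤ t → ∀ Y : S → ℝ,
    Measurable[𝓕 s.toNNReal] Y → (∃ b, ∀ a, |Y a| ≤ b) →
    ∫ a, Y a * (f (X t a) - f (X s a)) ∂P = ∫ a, Y a * (∫ u in s..t, L f (X u a)) ∂P

namespace SolvesMartingaleProblem

variable {L : (Config → ℝ) → Config → ℝ} {P : Measure S} {𝓕 : Filtration ℝ≥0 mS}
  {X : ℝ → S → Config}

lemma rightContinuous_comp (h : SolvesMartingaleProblem L P 𝓕 X) {f : Config → ℝ} (hf : IsLocal f)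
    (a : S) (s : ℝ) : ContinuousWithinAt (fun s => f (X s a)) (Ici s) s :=
  hf.continuous.continuousAt.comp_continuousWithinAt (h.right_continuous a s)

lemma measurable_comp (h : SolvesMartingaleProblem L P 𝓕 X) {f : Config → ℝ} (hf : IsLocal f)
    (s : ℝ) : Measurable fun a => f (X s a) :=
  hf.measurable.comp ((h.adapted s).mono (𝓕.le _) le_rfl)

lemma measurable_integral (h : SolvesMartingaleProblem L P 𝓕 X) {f : Config → ℝ} (hf : IsLocal f)
    (p q : ℝ) : Measurable fun a => ∫ s in p..q, f (X s a) :=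
  measurable_intervalIntegral_of_rightContinuous (h.measurable_comp hf)
    (h.rightContinuous_comp hf) p q

lemma adapted_integral (h : SolvesMartingaleProblem L P 𝓕 X) {f : Config → ℝ} (hf : IsLocal f)
    {p q : ℝ} (hpq : p ≤ q) : Measurable[𝓕 q.toNNReal] fun a => ∫ s in p..q, f (X s a) := by
  have e : (fun a => ∫ s in p..q, f (X s a)) = fun a => ∫ s in p..q, f (X (min s q) a) := by
    funext a
    refine intervalIntegral.integral_congr fun s hs => ?_
    rw [uIcc_of_le hpq] at hs
    simp only [min_eq_left hs.2]
  rw [e]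
  refine @measurable_intervalIntegral_of_rightContinuous S (𝓕 q.toNNReal)
    (fun s a => f (X (min s q) a)) (fun s => hf.measurable.comp ((h.adapted _).mono
      (𝓕.mono (Real.toNNReal_mono (min_le_right _ _))) le_rfl)) (fun a s => ?_) p q
  have h1 : ContinuousWithinAt (fun s => min s q) (Ici s) s := by fun_prop
  exact ContinuousWithinAt.comp (f := fun s => min s q)
    (h.rightContinuous_comp hf a (min s q)) h1 fun u hu => min_le_min_right q hu

variable [IsProbabilityMeasure P]

lemma integrable_exp_mul (h : SolvesMartingaleProblem L P 𝓕 X) {W f : Config → ℝ} (hW : IsLocal W)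
    (hf : IsLocal f) (t₀ t : ℝ) :
    Integrable (fun a => Real.exp (∫ s in t₀..t, W (X s a)) * f (X t a)) P := by
  obtain ⟨b, -, hb⟩ := hW.exists_bound
  obtain ⟨d, -, hd⟩ := hf.exists_bound
  refine Integrable.of_bound ((Real.measurable_exp.comp (h.measurable_integral hW _ _)).mul
    (h.measurable_comp hf t)).aestronglyMeasurable (Real.exp (b * |t - t₀|) * d)
    (ae_of_all _ fun a => ?_)
  rw [norm_mul, Real.norm_eq_abs, Real.norm_eq_abs, Real.abs_exp]
  gcongr
  · exact (le_abs_self _).trans (abs_intervalIntegral_le (fun s => hb _) _ _)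
  · exact hd _

/-- The Feynman-Kac functional `f ↦ E[exp (∫ W(X_s) ds) f(X_t)]`, with the time integral taken over
`[t₀, t]`. -/
noncomputable def feynmanKac (h : SolvesMartingaleProblem L P 𝓕 X) {W : Config → ℝ}
    (hW : IsLocal W) (t₀ t : ℝ) : localFunctions →ₗ[ℝ] ℝ where
  toFun f := ∫ a, Real.exp (∫ s in t₀..t, W (X s a)) * f.1 (X t a) ∂P
  map_add' f g := by
    rw [← integral_add (h.integrable_exp_mul hW f.2 t₀ t) (h.integrable_exp_mul hW g.2 t₀ t)]
    refine integral_congr_ae (ae_of_all _ fun a => ?_)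
    simp [mul_add]
  map_smul' u f := by
    rw [RingHom.id_apply, smul_eq_mul, ← integral_const_mul]
    refine integral_congr_ae (ae_of_all _ fun a => ?_)
    simp only [SetLike.val_smul, Pi.smul_apply, smul_eq_mul]
    ring

lemma feynmanKac_apply (h : SolvesMartingaleProblem L P 𝓕 X) {W : Config → ℝ} (hW : IsLocal W)
    (t₀ t : ℝ) (f : localFunctions) :
    h.feynmanKac hW t₀ t f = ∫ a, Real.exp (∫ s in t₀..t, W (X s a)) * f.1 (X t a) ∂P := rfl

lemma abs_feynmanKac_le (h : SolvesMartingaleProblem L P 𝓕 X) {W : Config → ℝ} (hW : IsLocal W)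
    {b d : ℝ} (hb : ∀ η, |W η| ≤ b) {f : localFunctions} (hd : ∀ η, |f.1 η| ≤ d) (t₀ t : ℝ) :
    |h.feynmanKac hW t₀ t f| ≤ Real.exp (b * |t - t₀|) * d := by
  have hc : ∀ a, ‖Real.exp (∫ s in t₀..t, W (X s a)) * f.1 (X t a)‖ ≤
      Real.exp (b * |t - t₀|) * d := fun a => by
    rw [norm_mul, Real.norm_eq_abs, Real.norm_eq_abs, Real.abs_exp]
    gcongr
    · exact (le_abs_self _).trans (abs_intervalIntegral_le (fun s => hb _) _ _)
    · exact hd _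
  simpa [feynmanKac_apply] using norm_integral_le_of_norm_le_const (μ := P) (ae_of_all _ hc)

/-- The increment of the Feynman-Kac functional, by the martingale property. -/
lemma feynmanKac_sub (h : SolvesMartingaleProblem L P 𝓕 X) {W : Config → ℝ} (hW : IsLocal W)
    {f : localFunctions} (hLf : IsLocal (L f.1)) {t₀ t t' : ℝ} (ht₀ : 0 ≤ t₀) (ht : t₀ ≤ t)
    (htt' : t ≤ t') :
    h.feynmanKac hW t₀ t' f - h.feynmanKac hW t₀ t f =
      ∫ a, (Real.exp (∫ s in t₀..t, W (X s a)) * (∫ s in t..t', L f.1 (X s a)) +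
        (Real.exp (∫ s in t₀..t', W (X s a)) - Real.exp (∫ s in t₀..t, W (X s a))) *
          f.1 (X t' a)) ∂P := by
  obtain ⟨b, -, hb⟩ := hW.exists_bound
  obtain ⟨d, -, hd⟩ := IsLocal.exists_bound f.2
  obtain ⟨d', -, hd'⟩ := hLf.exists_bound
  have hZ : ∀ t, Measurable fun a => Real.exp (∫ s in t₀..t, W (X s a)) := fun t =>
    Real.measurable_exp.comp (h.measurable_integral hW t₀ t)
  have hZb : ∀ t a, |Real.exp (∫ s in t₀..t, W (X s a))| ≤ Real.exp (b * |t - t₀|) := fun t a => by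
    rw [Real.abs_exp]
    exact Real.exp_le_exp.2 ((le_abs_self _).trans (abs_intervalIntegral_le (fun s => hb _) _ _))
  have hinc := h.increment f.1 f.2 t t' (ht₀.trans ht) htt'
    (fun a => Real.exp (∫ s in t₀..t, W (X s a)))
    (Real.measurable_exp.comp (h.adapted_integral hW ht)) ⟨_, hZb t⟩
  have i1 : Integrable (fun a => Real.exp (∫ s in t₀..t, W (X s a)) *
      (∫ s in t..t', L f.1 (X s a))) P := by
    refine Integrable.of_bound ((hZ t).mul (h.measurable_integral hLf _ _)).aestronglyMeasurable
      (Real.exp (b * |t - t₀|) * (d' * |t' - t|)) (ae_of_all _ fun a => ?_)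
    rw [norm_mul]
    exact mul_le_mul (hZb t a) (abs_intervalIntegral_le (fun s => hd' _) _ _) (norm_nonneg _)
      (by positivity)
  have i2 : Integrable (fun a => Real.exp (∫ s in t₀..t, W (X s a)) * f.1 (X t' a)) P := by
    refine Integrable.of_bound ((hZ t).mul (h.measurable_comp f.2 t')).aestronglyMeasurable
      (Real.exp (b * |t - t₀|) * d) (ae_of_all _ fun a => ?_)
    rw [norm_mul]
    exact mul_le_mul (hZb t a) (hd _) (norm_nonneg _) (by positivity)
  have i3 := h.integrable_exp_mul hW f.2 t₀ t
  have i4 := h.integrable_exp_mul hW f.2 t₀ t'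
  have i5 : Integrable (fun a => Real.exp (∫ s in t₀..t', W (X s a)) * f.1 (X t' a) -
      Real.exp (∫ s in t₀..t, W (X s a)) * f.1 (X t' a)) P := i4.sub i2
  simp_rw [sub_mul]
  rw [integral_add i1 i5, ← hinc, integral_sub i4 i2]
  simp_rw [mul_sub]
  rw [integral_sub i2 i3, feynmanKac_apply, feynmanKac_apply]
  ring

/-- The integrand in `feynmanKac_sub` has the order of the length of the time interval. -/
lemma abs_feynmanKac_increment_le {Ω : Type*} {W f Lf : Config → ℝ} {X : ℝ → Ω → Config}
    {b d d' : ℝ} (hb0 : 0 ≤ b) (hb : ∀ η, |W η| ≤ b) (hd : ∀ η, |f η| ≤ d) (hd' : ∀ η, |Lf η| ≤ d')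
    {t₀ t t' t₁ : ℝ} (ht : t₀ ≤ t) (htt' : t ≤ t') (ht' : t' ≤ t₁) (a : Ω)
    (hint : ∀ p q, IntervalIntegrable (fun s => W (X s a)) volume p q) :
    |Real.exp (∫ s in t₀..t, W (X s a)) * (∫ s in t..t', Lf (X s a)) +
        (Real.exp (∫ s in t₀..t', W (X s a)) - Real.exp (∫ s in t₀..t, W (X s a))) *
          f (X t' a)| ≤ Real.exp (b * (t₁ - t₀)) * (d' + b * d) * (t' - t) := by
  have hm : ∀ u, t₀ ≤ u → u ≤ t₁ → ∫ s in t₀..u, W (X s a) ≤ b * (t₁ - t₀) := fun u h1 h2 => by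
    refine (le_abs_self _).trans ((abs_intervalIntegral_le (fun s => hb _) _ _).trans ?_)
    rw [abs_of_nonneg (by linarith)]
    gcongr
  have h1 := abs_intervalIntegral_le (fun s => hd' (X s a)) t t'
  have h2 := abs_exp_sub_exp_le (hm t' (ht.trans htt') ht') (hm t ht (htt'.trans ht'))
  rw [intervalIntegral.integral_interval_sub_left (hint _ _) (hint _ _)] at h2
  have h3 := abs_intervalIntegral_le (fun s => hb (X s a)) t t'
  rw [abs_of_nonneg (sub_nonneg.2 htt')] at h1 h3
  have hd0 : 0 ≤ d := (abs_nonneg _).trans (hd (X t a))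
  have hd0' : 0 ≤ d' := (abs_nonneg _).trans (hd' (X t a))
  have htt'' := sub_nonneg.2 htt'
  calc _ ≤ Real.exp (b * (t₁ - t₀)) * (d' * (t' - t)) +
        (Real.exp (b * (t₁ - t₀)) * (b * (t' - t))) * d := by
        refine (abs_add_le _ _).trans (add_le_add ?_ ?_)
        · rw [abs_mul, Real.abs_exp]
          gcongr
          exact hm t ht (htt'.trans ht')
        · rw [abs_mul]
          gcongr
          · exact h2.trans (by gcongr)
          · exact hd _
    _ = _ := by ring

lemma continuousOn_feynmanKac (h : SolvesMartingaleProblem L P 𝓕 X) {W : Config → ℝ}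
    (hW : IsLocal W) {f : localFunctions} (hLf : IsLocal (L f.1)) {t₀ : ℝ} (ht₀ : 0 ≤ t₀) (t₁ : ℝ) :
    ContinuousOn (fun t => h.feynmanKac hW t₀ t f) (Icc t₀ t₁) := by
  obtain ⟨b, hb0, hb⟩ := hW.exists_bound
  obtain ⟨d, hd0, hd⟩ := IsLocal.exists_bound f.2
  obtain ⟨d', hd0', hd'⟩ := hLf.exists_bound
  set M := Real.exp (b * (t₁ - t₀)) * (d' + b * d) with hM
  have hM0 : 0 ≤ M := by positivity
  have key : ∀ t ∈ Icc t₀ t₁, ∀ t' ∈ Icc t₀ t₁, t ≤ t' →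
      |h.feynmanKac hW t₀ t' f - h.feynmanKac hW t₀ t f| ≤ M * (t' - t) := by
    intro t ht t' ht' htt'
    rw [h.feynmanKac_sub hW hLf ht₀ ht.1 htt']
    have hpt := fun a => abs_feynmanKac_increment_le hb0 hb hd hd' ht.1 htt' ht'.2 a
      (intervalIntegrable_of_rightContinuous (h.rightContinuous_comp hW a) fun s => hb _)
    simp_rw [← Real.norm_eq_abs] at hpt
    simpa using norm_integral_le_of_norm_le_const (μ := P) (ae_of_all _ hpt)
  refine (LipschitzOnWith.of_dist_le_mul (K := M.toNNReal) fun t ht t' ht' => ?_).continuousOn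
  rw [Real.coe_toNNReal _ hM0, Real.dist_eq, Real.dist_eq]
  rcases le_total t t' with htt' | htt'
  · rw [abs_sub_comm, abs_sub_comm t, abs_of_nonneg (sub_nonneg.2 htt')]
    exact key t ht t' ht' htt'
  · rw [abs_of_nonneg (sub_nonneg.2 htt')]
    exact key t' ht' t ht htt'

/-- The forward equation for the Feynman-Kac functional. -/
lemma hasDerivWithinAt_feynmanKac (h : SolvesMartingaleProblem L P 𝓕 X) {W : Config → ℝ}
    (hW : IsLocal W) {f g : localFunctions} (hg : ∀ η, g.1 η = L f.1 η + W η * f.1 η)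
    {t₀ : ℝ} (ht₀ : 0 ≤ t₀) {t : ℝ} (ht : t₀ ≤ t) :
    HasDerivWithinAt (fun t => h.feynmanKac hW t₀ t f) (h.feynmanKac hW t₀ t g) (Ici t) t := by
  have hLf : IsLocal (L f.1) := by
    have : IsLocal fun η => g.1 η - W η * f.1 η := IsLocal.sub g.2 (hW.mul f.2)
    convert this using 2 with η
    rw [hg]
    ring
  obtain ⟨b, hb0, hb⟩ := hW.exists_bound
  obtain ⟨d, hd0, hd⟩ := IsLocal.exists_bound f.2
  obtain ⟨d', hd0', hd'⟩ := hLf.exists_bound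
  rw [hasDerivWithinAt_iff_tendsto_slope, Ici_sdiff_left]
  have hlt : ∀ᶠ t' in 𝓝[>] t, t < t' ∧ t' ≤ t + 1 := by
    filter_upwards [self_mem_nhdsWithin, mem_nhdsWithin_of_mem_nhds (Iic_mem_nhds (lt_add_one t))]
      with t' h1 h2 using ⟨h1, h2⟩
  let I : ℝ → S → ℝ := fun t' a =>
    Real.exp (∫ s in t₀..t, W (X s a)) * (∫ s in t..t', L f.1 (X s a)) +
      (Real.exp (∫ s in t₀..t', W (X s a)) - Real.exp (∫ s in t₀..t, W (X s a))) * f.1 (X t' a)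
  have hslope : (fun t' => ∫ a, (t' - t)⁻¹ * I t' a ∂P) =ᶠ[𝓝[>] t]
      slope (fun t => h.feynmanKac hW t₀ t f) t := by
    filter_upwards [hlt] with t' ht'
    rw [slope_def_module, smul_eq_mul, h.feynmanKac_sub hW hLf ht₀ ht ht'.1.le, integral_const_mul]
  refine Tendsto.congr' hslope ?_
  rw [feynmanKac_apply]
  have hmeas : ∀ t', Measurable (I t') := fun t' =>
    ((Real.measurable_exp.comp (h.measurable_integral hW _ _)).mul
      (h.measurable_integral hLf _ _)).add (((Real.measurable_exp.comp
        (h.measurable_integral hW _ _)).sub (Real.measurable_exp.comp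
          (h.measurable_integral hW _ _))).mul (h.measurable_comp f.2 t'))
  refine tendsto_integral_filter_of_dominated_convergence
    (fun _ => Real.exp (b * (t + 1 - t₀)) * (d' + b * d))
    (Eventually.of_forall fun t' => ((hmeas t').const_mul _).aestronglyMeasurable) ?_
    (integrable_const _) (ae_of_all _ fun a => ?_)
  · filter_upwards [hlt] with t' ht'
    refine ae_of_all _ fun a => ?_
    have h1 := abs_feynmanKac_increment_le hb0 hb hd hd' ht ht'.1.le ht'.2 a
        (intervalIntegrable_of_rightContinuous (h.rightContinuous_comp hW a) fun s => hb _)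
    have h2 : 0 < t' - t := sub_pos.2 ht'.1
    rw [norm_mul, norm_inv, Real.norm_of_nonneg h2.le, Real.norm_eq_abs, inv_mul_le_iff₀ h2]
    linarith
  · have h1 := hasDerivWithinAt_integral_of_rightContinuous (h.rightContinuous_comp hLf a)
      (fun s => hd' _) t t
    have h2 := (hasDerivWithinAt_integral_of_rightContinuous (h.rightContinuous_comp hW a)
      (fun s => hb _) t₀ t).exp
    rw [hasDerivWithinAt_iff_tendsto_slope, Ici_sdiff_left] at h1 h2
    have h3 : Tendsto (fun t' => f.1 (X t' a)) (𝓝[>] t) (𝓝 (f.1 (X t a))) :=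
      (h.rightContinuous_comp f.2 a t).tendsto.mono_left (nhdsWithin_mono _ Ioi_subset_Ici_self)
    have h4 := (h1.const_mul (Real.exp (∫ s in t₀..t, W (X s a)))).add (h2.mul h3)
    rw [hg]
    convert h4 using 1
    · funext t'
      simp only [I, slope_def_module, smul_eq_mul, intervalIntegral.integral_same]
      ring
    · congr 1
      ring

end SolvesMartingaleProblem

end FeynmanKac

/-! ### The martingale problem of the environment as seen by the walk -/

section SeenProcess

open Set

lemma continuous_shift : Continuous (Function.uncurry shift) :=
  continuous_prod_of_discrete_left.2 fun x => continuous_pi fun y => continuous_apply (x + y)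

lemma measurable_shift : Measurable (Function.uncurry shift) :=
  measurable_from_prod_countable_right fun x =>
    measurable_pi_lambda _ fun y => measurable_pi_apply (x + y)

/-- The cutoff that turns a local function of the seen environment into a test function. -/
noncomputable def cutoff (k : ℕ) (x : ℤ) : ℝ := if |x| ≤ k then 1 else 0

lemma abs_cutoff_mul_le (k : ℕ) (x : ℤ) (u : ℝ) : |cutoff k x * u| ≤ |u| := by
  unfold cutoff
  split_ifs <;> simp

lemma isTestFunction_cutoff {f : Config → ℝ} (hf : IsLocal f) (k : ℕ) :
    IsTestFunction fun η x => cutoff k x * f (shift x η) := by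
  refine ⟨fun x => (hf.comp_shift x).const_mul _, (finite_Icc (-k : ℤ) k).subset ?_⟩
  rintro x ⟨η, hx⟩
  by_contra h
  apply hx
  change cutoff k x * _ = 0
  unfold cutoff
  rw [if_neg (by rwa [abs_le]), zero_mul]

/-- On functions of the seen environment the generator of the pair acts, away from the boundary of
the cutoff, as the generator of the seen environment. -/
lemma generator_cutoff {c : Config → ℝ} {R : Finset ℤ} {r : ℤ → Config → ℝ} {n : ℕ+}
    (f : Config → ℝ) (k : ℕ) (η : Config) (x : ℤ) :
    generator c R r n (fun η x => cutoff k x * f (shift x η)) η x =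
      (n : ℝ) ^ 2 * (cutoff k x * latticeGasGenerator c f (shift x η)) +
        n * ∑ z ∈ R, r z (shift x η) *
          (cutoff k (x + z) * f (shift z (shift x η)) - cutoff k x * f (shift x η)) := by
  simp only [generator, shift_shift]
  congr 2
  rw [latticeGasGenerator_const_mul]
  congr 1
  unfold latticeGasGenerator
  conv_rhs => rw [← finsum_comp_equiv (Equiv.subRight x)]
  refine finsum_congr fun y => ?_
  simp only [Equiv.subRight_apply, shift_exchange, shift_shift, add_sub_cancel]

/-- The increments of a martingale are orthogonal to the bounded random variables from the past. -/
lemma integral_mul_martingale_sub_eq_zero {S : Type*} {mS : MeasurableSpace S} {P : Measure S}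
    [IsFiniteMeasure P] {𝓕 : Filtration ℝ≥0 mS} {M : ℝ≥0 → S → ℝ} (hM : Martingale M 𝓕 P)
    {s t : ℝ≥0} (hst : s ≤ t) {Y : S → ℝ} (hY : Measurable[𝓕 s] Y) {b : ℝ} (hb : ∀ a, |Y a| ≤ b) :
    ∫ a, Y a * (M t a - M s a) ∂P = 0 := by
  have hYm : Measurable Y := hY.mono (𝓕.le s) le_rfl
  have hi : ∀ u, Integrable (Y * M u) P := fun u =>
    (hM.integrable u).bdd_mul hYm.aestronglyMeasurable (ae_of_all _ hb)
  have h1 : ∫ a, (Y * M t) a ∂P = ∫ a, (Y * M s) a ∂P := by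
    rw [← integral_condExp (𝓕.le s)]
    refine integral_congr_ae ?_
    filter_upwards [condExp_mul_of_stronglyMeasurable_left hY.stronglyMeasurable (hi t)
      (hM.integrable t), hM.2 s t hst] with a h1 h2
    rw [h1, Pi.mul_apply, h2, Pi.mul_apply]
  simp_rw [mul_sub]
  exact (integral_sub (hi t) (hi s)).trans (sub_eq_zero.2 h1)

variable {S : Type*} [mS : MeasurableSpace S] {ρ : unitInterval} {c : Config → ℝ} {R : Finset ℤ}
  {r : ℤ → Config → ℝ} {n : ℕ+} {P : Measure S}
  {𝓕 : Filtration ℝ≥0 mS} {η : ℝ≥0 → S → Config} {x : ℝ≥0 → S → ℤ}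

namespace IsWalkInExclusion

lemma rightContinuous_position (h : IsWalkInExclusion ρ c R r n P 𝓕 η x) (a : S) (s : ℝ) :
    ContinuousWithinAt (fun s : ℝ => x s.toNNReal a) (Ici s) s :=
  ContinuousWithinAt.comp (f := Real.toNNReal) (h.cadlag_position a s.toNNReal).1
    continuous_real_toNNReal.continuousWithinAt fun _ hu => Real.toNNReal_mono hu

lemma rightContinuous_seenEnvironment (h : IsWalkInExclusion ρ c R r n P 𝓕 η x) (a : S) (s : ℝ) :
    ContinuousWithinAt (fun s : ℝ => seenEnvironment η x s.toNNReal a) (Ici s) s := by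
  have h1 : ContinuousWithinAt (fun s : ℝ => η s.toNNReal a) (Ici s) s :=
    ContinuousWithinAt.comp (f := Real.toNNReal) (h.cadlag_environment a s.toNNReal).1
      continuous_real_toNNReal.continuousWithinAt fun _ hu => Real.toNNReal_mono hu
  exact ContinuousAt.comp_continuousWithinAt (g := Function.uncurry shift)
    (f := fun s : ℝ => (x s.toNNReal a, η s.toNNReal a)) continuous_shift.continuousAt
    ((h.rightContinuous_position a s).prodMk h1)

lemma adapted_seenEnvironment (h : IsWalkInExclusion ρ c R r n P 𝓕 η x) (t : ℝ≥0) :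
    Measurable[𝓕 t] (seenEnvironment η x t) :=
  measurable_shift.comp ((h.adapted_position t).prodMk (h.adapted_environment t))

lemma integral_initial (h : IsWalkInExclusion ρ c R r n P 𝓕 η x) {f : Config → ℝ}
    (hf : IsLocal f) :
    ∫ a, f (seenEnvironment η x (0 : ℝ).toNNReal a) ∂P = ∫ ξ, f ξ ∂(bernoulliProduct ρ) := by
  rw [← h.initial_environment, integral_map
    ((h.adapted_environment 0).mono (𝓕.le _) le_rfl).aemeasurable
    hf.measurable.aestronglyMeasurable]
  refine integral_congr_ae ?_
  filter_upwards [h.initial_position] with a ha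
  simp [seenEnvironment, ha]

variable [IsProbabilityMeasure P]

/-- The environment as seen by the walk solves the martingale problem for its generator: a local
function of it is a limit of test functions, as the cutoff is removed. -/
theorem solvesMartingaleProblem (h : IsWalkInExclusion ρ c R r n P 𝓕 η x) (hc : IsLocal c)
    (hr : ∀ z ∈ R, IsLocal (r z)) :
    SolvesMartingaleProblem (seenGenerator c R r n) P 𝓕
      fun s : ℝ => seenEnvironment η x s.toNNReal where
  right_continuous := h.rightContinuous_seenEnvironment
  adapted s := h.adapted_seenEnvironment _
  increment := by
    rintro f hf s t hs hst Y hY ⟨b, hb⟩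
    set X : ℝ → S → Config := fun s => seenEnvironment η x s.toNNReal with hX
    have hXm : ∀ u, Measurable (X u) := fun u =>
      (h.adapted_seenEnvironment _).mono (𝓕.le _) le_rfl
    have hxm : ∀ u : ℝ, Measurable (x u.toNNReal) := fun u =>
      (h.adapted_position _).mono (𝓕.le _) le_rfl
    have hYm : Measurable Y := hY.mono (𝓕.le _) le_rfl
    have hL := hc.latticeGasGenerator hf
    obtain ⟨d, hd0, hd⟩ := hf.exists_bound
    obtain ⟨dL, hdL0, hdL⟩ := hL.exists_bound
    let v : ℕ → ℝ → S → ℝ := fun k u a =>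
      generator c R r n (fun η x => cutoff k x * f (shift x η)) (η u.toNNReal a) (x u.toNNReal a)
    have hv : ∀ k u a, v k u a = (n : ℝ) ^ 2 * (cutoff k (x u.toNNReal a) *
        latticeGasGenerator c f (X u a)) + n * ∑ z ∈ R, r z (X u a) *
          (cutoff k (x u.toNNReal a + z) * f (shift z (X u a)) -
            cutoff k (x u.toNNReal a) * f (X u a)) := fun k u a => generator_cutoff _ _ _ _
    have hvm : ∀ k u, Measurable (v k u) := by
      intro k u
      rw [funext (hv k u)]
      have h1 : ∀ z, Measurable fun a => cutoff k (x u.toNNReal a + z) := fun z =>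
        (Measurable.of_discrete (f := fun x => cutoff k (x + z))).comp (hxm u)
      have h0 : Measurable fun a => cutoff k (x u.toNNReal a) := by simpa using h1 0
      refine ((h0.mul (hL.measurable.comp (hXm u))).const_mul _).add
        ((Finset.measurable_fun_sum R fun z hz => ?_).const_mul _)
      exact ((hr z hz).measurable.comp (hXm u)).mul
        (((h1 z).mul ((hf.comp_shift z).measurable.comp (hXm u))).sub
          (h0.mul (hf.measurable.comp (hXm u))))
    have hvc : ∀ k a u, ContinuousWithinAt (fun u => v k u a) (Ici u) u := by
      intro k a u
      simp_rw [hv]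
      have h1 : ∀ z, ContinuousWithinAt (fun u : ℝ => cutoff k (x u.toNNReal a + z)) (Ici u) u :=
        fun z => (continuous_of_discreteTopology
          (f := fun x => cutoff k (x + z))).continuousAt.comp_continuousWithinAt
            (h.rightContinuous_position a u)
      have h0 : ContinuousWithinAt (fun u : ℝ => cutoff k (x u.toNNReal a)) (Ici u) u := by
        simpa using h1 0
      have h2 : ∀ {g : Config → ℝ}, IsLocal g →
          ContinuousWithinAt (fun u => g (X u a)) (Ici u) u := fun hg =>
        hg.continuous.continuousAt.comp_continuousWithinAt (h.rightContinuous_seenEnvironment a u)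
      refine (continuousWithinAt_const.mul (h0.mul (h2 hL))).add
        (continuousWithinAt_const.mul (tendsto_finsetSum R fun z hz => ?_))
      exact (h2 (hr z hz)).mul (((h1 z).mul (h2 (hf.comp_shift z))).sub (h0.mul (h2 hf)))
    have hbr : ∀ z : ℤ, ∃ b, 0 ≤ b ∧ (z ∈ R → ∀ η, |r z η| ≤ b) := fun z => by
      by_cases hz : z ∈ R
      · obtain ⟨b, hb0, hb⟩ := (hr z hz).exists_bound
        exact ⟨b, hb0, fun _ => hb⟩
      · exact ⟨0, le_rfl, fun h => absurd h hz⟩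
    choose br hbr0 hbr using hbr
    have hvb : ∃ D, ∀ k u a, |v k u a| ≤ D := by
      refine ⟨(n : ℝ) ^ 2 * dL + n * ∑ z ∈ R, br z * (d + d), fun k u a => ?_⟩
      rw [hv]
      refine (abs_add_le _ _).trans (add_le_add ?_ ?_)
      · rw [abs_mul, abs_of_nonneg (by positivity : (0 : ℝ) ≤ n ^ 2)]
        gcongr
        exact (abs_cutoff_mul_le _ _ _).trans (hdL _)
      · rw [abs_mul, abs_of_nonneg (by positivity : (0 : ℝ) ≤ n)]
        gcongr
        refine (Finset.abs_sum_le_sum_abs _ _).trans (Finset.sum_le_sum fun z hz => ?_)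
        rw [abs_mul]
        refine mul_le_mul (hbr z hz _) ((abs_sub _ _).trans (add_le_add ?_ ?_)) (abs_nonneg _)
          (hbr0 z)
        · exact (abs_cutoff_mul_le _ _ _).trans (hd _)
        · exact (abs_cutoff_mul_le _ _ _).trans (hd _)
    obtain ⟨D, hD⟩ := hvb
    have hcut : ∀ y : ℤ, ∀ᶠ k : ℕ in atTop, cutoff k y = 1 := fun y => by
      filter_upwards [eventually_ge_atTop y.natAbs] with k hk
      rw [cutoff, if_pos (by rw [Int.abs_eq_natAbs]; omega)]
    have hvlim : ∀ u a, Tendsto (fun k => v k u a) atTop (𝓝 (seenGenerator c R r n f (X u a))) := by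
      intro u a
      refine tendsto_const_nhds.congr' ?_
      have h1 : ∀ᶠ k : ℕ in atTop, ∀ z ∈ R, cutoff k (x u.toNNReal a + z) = 1 :=
        (eventually_all_finset R).2 fun z _ => hcut _
      filter_upwards [h1, hcut (x u.toNNReal a)] with k h1 h0
      rw [hv, h0, seenGenerator, one_mul]
      congr 2
      exact Finset.sum_congr rfl fun z hz => by rw [h1 z hz, one_mul, one_mul]
    have hint : ∀ k a p q, IntervalIntegrable (fun u => v k u a) volume p q := fun k a p q =>
      intervalIntegrable_of_rightContinuous (hvc k a) (fun u => hD k u a) p q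
    -- the increment of the martingale for the test function with cutoff `k`
    let I : ℕ → S → ℝ := fun k a => Y a * (cutoff k (x t.toNNReal a) * f (X t a) -
      cutoff k (x s.toNNReal a) * f (X s a) - ∫ u in s..t, v k u a)
    have hI0 : ∀ k, ∫ a, I k a ∂P = 0 := by
      intro k
      have h1 := integral_mul_martingale_sub_eq_zero
        (h.martingale_problem _ (isTestFunction_cutoff hf k)) (Real.toNNReal_mono hst) hY hb
      rw [← h1]
      congr 1
      funext a
      simp only [I, Real.coe_toNNReal _ hs, Real.coe_toNNReal _ (hs.trans hst)]
      rw [← intervalIntegral.integral_interval_sub_left (hint k a 0 t) (hint k a 0 s)]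
      simp only [v, hX, seenEnvironment]
      ring
    have hIlim : Tendsto (fun k => ∫ a, I k a ∂P) atTop (𝓝 (∫ a, Y a * (f (X t a) - f (X s a) -
        ∫ u in s..t, seenGenerator c R r n f (X u a)) ∂P)) := by
      refine tendsto_integral_of_dominated_convergence (fun _ => b * (d + d + D * |t - s|))
        (fun k => ?_) (integrable_const _) (fun k => ae_of_all _ fun a => ?_)
        (ae_of_all _ fun a => ?_)
      · have hcm : ∀ u : ℝ, Measurable fun a => cutoff k (x u.toNNReal a) * f (X u a) := fun u =>
          ((Measurable.of_discrete (f := cutoff k)).comp (hxm u)).mul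
            (hf.measurable.comp (hXm u))
        exact (hYm.mul (((hcm t).sub (hcm s)).sub (measurable_intervalIntegral_of_rightContinuous
          (hvm k) (hvc k) s t))).aestronglyMeasurable
      · rw [norm_mul]
        refine mul_le_mul (hb a) ((abs_sub _ _).trans (add_le_add ((abs_sub _ _).trans
          (add_le_add ?_ ?_)) (abs_intervalIntegral_le (fun u => hD k u a) s t)))
          (norm_nonneg _) ((abs_nonneg _).trans (hb a))
        · exact (abs_cutoff_mul_le _ _ _).trans (hd _)
        · exact (abs_cutoff_mul_le _ _ _).trans (hd _)
      · have h1 : ∀ u : ℝ, Tendsto (fun k => cutoff k (x u.toNNReal a) * f (X u a)) atTop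
            (𝓝 (f (X u a))) := fun u => by
          refine tendsto_const_nhds.congr' ?_
          filter_upwards [hcut (x u.toNNReal a)] with k hk
          rw [hk, one_mul]
        refine (((h1 t).sub (h1 s)).sub ?_).const_mul _
        exact intervalIntegral.tendsto_integral_filter_of_dominated_convergence (fun _ => D)
          (Eventually.of_forall fun k =>
            (measurable_of_rightContinuous (hvc k a)).aestronglyMeasurable)
          (Eventually.of_forall fun k => ae_of_all _ fun u _ => hD k u a)
          intervalIntegrable_const (ae_of_all _ fun u _ => hvlim u a)
    have h0 := tendsto_nhds_unique hIlim (by simp only [hI0]; exact tendsto_const_nhds)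
    have hLf := hc.seenGenerator hr n hf
    obtain ⟨d', hd0', hd'⟩ := hLf.exists_bound
    have i1 : Integrable (fun a => Y a * (f (X t a) - f (X s a))) P := by
      refine Integrable.of_bound (hYm.mul ((hf.measurable.comp (hXm t)).sub
        (hf.measurable.comp (hXm s)))).aestronglyMeasurable (b * (d + d)) (ae_of_all _ fun a => ?_)
      rw [norm_mul]
      exact mul_le_mul (hb a) ((abs_sub _ _).trans (add_le_add (hd _) (hd _))) (norm_nonneg _)
        ((abs_nonneg _).trans (hb a))
    have i2 : Integrable (fun a => Y a * ∫ u in s..t, seenGenerator c R r n f (X u a)) P := by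
      refine Integrable.of_bound (hYm.mul (measurable_intervalIntegral_of_rightContinuous
        (fun u => hLf.measurable.comp (hXm u)) (fun a u =>
          hLf.continuous.continuousAt.comp_continuousWithinAt
            (h.rightContinuous_seenEnvironment a u)) s t)).aestronglyMeasurable
        (b * (d' * |t - s|)) (ae_of_all _ fun a => ?_)
      rw [norm_mul]
      exact mul_le_mul (hb a) (abs_intervalIntegral_le (fun u => hd' _) s t) (norm_nonneg _)
        ((abs_nonneg _).trans (hb a))
    simp_rw [mul_sub (Y _) (_ - _) (∫ u in s..t, _)] at h0
    rw [integral_sub i1 i2] at h0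
    exact sub_eq_zero.1 h0

end IsWalkInExclusion

end SeenProcess

/-! ### Bounds in terms of the `L²` norm for the Bernoulli measure -/

section L2

open Set

variable {ρ : unitInterval}

lemma IsLocal.memLp {f : Config → ℝ} (hf : IsLocal f) (ρ : unitInterval) :
    MemLp f 2 (bernoulliProduct ρ) := by
  obtain ⟨B, -, hB⟩ := hf.exists_bound
  exact MemLp.of_bound hf.measurable.aestronglyMeasurable B (ae_of_all _ hB)

/-- The embedding of the local functions into the Hilbert space of the Bernoulli measure. -/
noncomputable def toL2 (ρ : unitInterval) : localFunctions →ₗ[ℝ] Lp ℝ 2 (bernoulliProduct ρ) where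
  toFun f := (IsLocal.memLp f.2 ρ).toLp
  map_add' f g := MemLp.toLp_add (IsLocal.memLp f.2 ρ) (IsLocal.memLp g.2 ρ)
  map_smul' a f := MemLp.toLp_const_smul a (IsLocal.memLp f.2 ρ)

lemma inner_toL2 (f g : localFunctions) :
    inner ℝ (toL2 ρ f) (toL2 ρ g) = ∫ ξ, f.1 ξ * g.1 ξ ∂(bernoulliProduct ρ) := by
  rw [L2.inner_def]
  refine integral_congr_ae ?_
  filter_upwards [(IsLocal.memLp f.2 ρ).coeFn_toLp, (IsLocal.memLp g.2 ρ).coeFn_toLp] with ξ h1 h2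
  change inner ℝ ((IsLocal.memLp f.2 ρ).toLp f.1 ξ) ((IsLocal.memLp g.2 ρ).toLp g.1 ξ) = _
  rw [h1, h2, real_inner_eq_re_inner]
  simp [mul_comm]

lemma norm_toL2_sq (f : localFunctions) :
    ‖toL2 ρ f‖ ^ 2 = ∫ ξ, f.1 ξ ^ 2 ∂(bernoulliProduct ρ) := by
  rw [← real_inner_self_eq_norm_sq, inner_toL2]
  simp_rw [sq]

lemma norm_toL2 (f : localFunctions) :
    ‖toL2 ρ f‖ = √(∫ ξ, f.1 ξ ^ 2 ∂(bernoulliProduct ρ)) := by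
  rw [← norm_toL2_sq, Real.sqrt_sq (norm_nonneg _)]

lemma norm_toL2_le {f : localFunctions} {b : ℝ} (hb : ∀ η, |f.1 η| ≤ b) : ‖toL2 ρ f‖ ≤ b := by
  have hb0 : 0 ≤ b := (abs_nonneg _).trans (hb fun _ => true)
  refine abs_le_of_sq_le_sq' ?_ hb0 |>.2
  rw [norm_toL2_sq]
  refine ((IsLocal.pow f.2 2).integral_mono (IsLocal.const (b ^ 2)) fun η => ?_).trans (by simp)
  exact sq_le_sq' (abs_le.1 (hb η)).1 (abs_le.1 (hb η)).2

lemma abs_integral_le_sqrt {f : Config → ℝ} (hf : IsLocal f) :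
    |∫ ξ, f ξ ∂(bernoulliProduct ρ)| ≤ √(∫ ξ, f ξ ^ 2 ∂(bernoulliProduct ρ)) := by
  have h1 := inner_toL2 (ρ := ρ) ⟨fun _ => 1, IsLocal.const 1⟩ ⟨f, hf⟩
  have h2 := abs_real_inner_le_norm (toL2 ρ ⟨fun _ => 1, IsLocal.const 1⟩) (toL2 ρ ⟨f, hf⟩)
  rw [h1, norm_toL2, norm_toL2] at h2
  simpa using h2

variable {S : Type*} [mS : MeasurableSpace S] {c : Config → ℝ} {R : Finset ℤ}
  {r : ℤ → Config → ℝ} {n : ℕ+} {P : Measure S} [IsProbabilityMeasure P]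
  {𝓕 : Filtration ℝ≥0 mS} {X : ℝ → S → Config}

/-- If the law of the process at time `t₀` is bounded by the `L²` norm on local functions, that is,
has a density in `L²`, then the norm of the Feynman-Kac
functional grows at most with the exponential rate of the energy estimate. -/
theorem SolvesMartingaleProblem.abs_integral_exp_le
    (h : SolvesMartingaleProblem (seenGenerator c R r n) P 𝓕 X) (hc : IsLocal c)
    (hr : ∀ z ∈ R, IsLocal (r z)) {W : Config → ℝ} (hW : IsLocal W) {C : ℝ}
    (hdiss : ∀ f, IsLocal f → ∫ η, f η * (seenGenerator c R r n f η + W η * f η)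
      ∂(bernoulliProduct ρ) ≤ C * ∫ η, f η ^ 2 ∂(bernoulliProduct ρ))
    {t₀ t K : ℝ} (ht₀ : 0 ≤ t₀) (ht : t₀ ≤ t) (hK : 0 ≤ K)
    (h0 : ∀ f, IsLocal f → |∫ a, f (X t₀ a) ∂P| ≤ K * √(∫ η, f η ^ 2 ∂(bernoulliProduct ρ)))
    {f : Config → ℝ} (hf : IsLocal f) :
    |∫ a, Real.exp (∫ s in t₀..t, W (X s a)) * f (X t a) ∂P| ≤
      K * Real.exp (C * (t - t₀)) * √(∫ η, f η ^ 2 ∂(bernoulliProduct ρ)) := by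
  obtain ⟨κ, hκ, hB⟩ := exists_analytic_bound hc hr n hW
  obtain ⟨b, hb0, hb⟩ := hW.exists_bound
  have key := abs_functional_le (L := potentialGenerator hc hr n hW) (ι := toL2 ρ) (C := C) hκ
    (fun f => by
      rw [inner_toL2, norm_toL2_sq]
      exact hdiss f.1 f.2)
    (a := fun t => h.feynmanKac hW t₀ t) (t₀ := t₀) (t₁ := t)
    (fun f => h.continuousOn_feynmanKac hW (hc.seenGenerator hr n f.2) ht₀ t)
    (fun f s hs => h.hasDerivWithinAt_feynmanKac hW (fun _ => rfl) ht₀ hs.1)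
    (fun f => by
      obtain ⟨B, hB0, hB⟩ := hB f
      refine ⟨Real.exp (b * (t - t₀)) * B, by positivity, fun k => ⟨?_, fun s hs => ?_⟩⟩
      · refine (norm_toL2_le (hB k)).trans ?_
        have : 1 ≤ Real.exp (b * (t - t₀)) :=
          Real.one_le_exp (mul_nonneg hb0 (sub_nonneg.2 ht))
        gcongr
        exact le_mul_of_one_le_left hB0 this
      · refine (h.abs_feynmanKac_le hW hb (hB k) t₀ s).trans ?_
        rw [abs_of_nonneg (sub_nonneg.2 hs.1), mul_assoc, mul_assoc, mul_assoc]
        gcongr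
        exact hs.2)
    hK
    (fun f => by
      rw [norm_toL2, h.feynmanKac_apply]
      simpa using h0 f.1 f.2)
    ⟨ht, le_rfl⟩ ⟨f, hf⟩
  rwa [norm_toL2, h.feynmanKac_apply] at key

end L2

/-! ### Second moments of additive functionals -/

section SecondMoment

open Set

variable {ρ : unitInterval} {S : Type*} [mS : MeasurableSpace S] {c : Config → ℝ} {R : Finset ℤ}
  {r : ℤ → Config → ℝ} {n : ℕ+} {P : Measure S}
  {𝓕 : Filtration ℝ≥0 mS} {X : ℝ → S → Config} {C ε₀ : ℝ}

/-- The growth rate of the quadratic form of the generator, perturbed by a form-bounded potential: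
the conclusion of `exists_energy_estimate` for fixed `n`. -/
def EnergyEstimate (ρ : unitInterval) (c : Config → ℝ) (R : Finset ℤ) (r : ℤ → Config → ℝ)
    (n : ℕ+) (C ε₀ : ℝ) : Prop :=
  ∀ (V : Config → ℝ) (Y : Finset ℤ) (K θ : ℝ), IsLocal V → IsFormBounded ρ V Y K → 0 < θ →
    ∀ f, IsLocal f →
      ∫ η, f η * (seenGenerator c R r n f η + θ * V η * f η) ∂(bernoulliProduct ρ) ≤
        (C + 4 * θ ^ 2 * K / (n ^ 2 * ε₀)) * ∫ η, f η ^ 2 ∂(bernoulliProduct ρ)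

namespace SolvesMartingaleProblem

lemma abs_integral_comp_path_le {Ω : Type*} {X : ℝ → Ω → Config} {V : Config → ℝ} {b : ℝ}
    (hb : ∀ η, |V η| ≤ b) {t τ : ℝ} (hτ : 0 ≤ τ) (a : Ω) :
    |∫ s in t..t + τ, V (X s a)| ≤ b * τ := by
  refine (abs_intervalIntegral_le (fun s => hb _) _ _).trans (le_of_eq ?_)
  rw [add_sub_cancel_left, abs_of_nonneg hτ]

lemma measurable_uncurry_comp {L : (Config → ℝ) → Config → ℝ}
    (h : SolvesMartingaleProblem L P 𝓕 X) {f : Config → ℝ} (hf : IsLocal f) :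
    Measurable fun p : ℝ × S => f (X p.1 p.2) :=
  measurable_uncurry_of_rightContinuous (v := fun s a => f (X s a)) (h.measurable_comp hf)
    (h.rightContinuous_comp hf)

variable [IsProbabilityMeasure P]

/-- The law of the process at every time has a density in `L²`, stated as a bound on local
functions. -/
lemma abs_integral_comp_le (h : SolvesMartingaleProblem (seenGenerator c R r n) P 𝓕 X)
    (hc : IsLocal c) (hr : ∀ z ∈ R, IsLocal (r z)) (hE : EnergyEstimate ρ c R r n C ε₀)
    (h0 : ∀ f, IsLocal f → ∫ a, f (X 0 a) ∂P = ∫ η, f η ∂(bernoulliProduct ρ))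
    {t : ℝ} (ht : 0 ≤ t) {f : Config → ℝ} (hf : IsLocal f) :
    |∫ a, f (X t a) ∂P| ≤ Real.exp (C * t) * √(∫ η, f η ^ 2 ∂(bernoulliProduct ρ)) := by
  have := h.abs_integral_exp_le (ρ := ρ) (C := C) hc hr (IsLocal.const 0)
    (fun f hf => by simpa using hE _ _ 0 1 (IsLocal.const 0) IsFormBounded.zero one_pos f hf)
    le_rfl ht zero_le_one (fun f hf => by
      rw [h0 f hf, one_mul]
      exact abs_integral_le_sqrt hf) hf
  simpa using this

/-- The exponential moments of the time integral of a form-bounded potential: first the law at time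
`t` is bounded in `L²`, then the Feynman-Kac functional is evaluated at the constant `1`. -/
lemma integral_exp_le (h : SolvesMartingaleProblem (seenGenerator c R r n) P 𝓕 X)
    (hc : IsLocal c) (hr : ∀ z ∈ R, IsLocal (r z)) (hE : EnergyEstimate ρ c R r n C ε₀)
    (h0 : ∀ f, IsLocal f → ∫ a, f (X 0 a) ∂P = ∫ η, f η ∂(bernoulliProduct ρ))
    {V : Config → ℝ} (hV : IsLocal V) {Y : Finset ℤ} {K : ℝ} (hVK : IsFormBounded ρ V Y K)
    {t τ θ : ℝ} (ht : 0 ≤ t) (hτ : 0 ≤ τ) (hθ : 0 < θ) :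
    ∫ a, Real.exp (θ * ∫ s in t..t + τ, V (X s a)) ∂P ≤
      Real.exp (C * (t + τ) + 4 * θ ^ 2 * K / (n ^ 2 * ε₀) * τ) := by
  have := h.abs_integral_exp_le (ρ := ρ) hc hr (hV.const_mul θ)
    (fun f hf => hE V Y K θ hV hVK hθ f hf) ht (le_add_of_nonneg_right hτ)
    (Real.exp_pos _).le (fun f hf => h.abs_integral_comp_le hc hr hE h0 ht hf)
    (IsLocal.const 1)
  simp only [intervalIntegral.integral_const_mul, mul_one, add_sub_cancel_left] at this
  refine (le_abs_self _).trans (this.trans (le_of_eq ?_))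
  rw [← Real.exp_add]
  simp
  ring

lemma integrable_integral_sq {L : (Config → ℝ) → Config → ℝ}
    (h : SolvesMartingaleProblem L P 𝓕 X) {V : Config → ℝ} (hV : IsLocal V) {t τ : ℝ}
    (hτ : 0 ≤ τ) : Integrable (fun a => (∫ s in t..t + τ, V (X s a)) ^ 2) P := by
  obtain ⟨b, -, hb⟩ := hV.exists_bound
  refine Integrable.of_bound ((h.measurable_integral hV _ _).pow_const 2).aestronglyMeasurable
    ((b * τ) ^ 2) (ae_of_all _ fun a => ?_)
  rw [norm_pow]
  exact pow_le_pow_left₀ (norm_nonneg _) (abs_integral_comp_path_le hb hτ a) 2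

/-- The second moment of the time integral of a form-bounded potential, by exponential moments. -/
lemma integral_sq_le_of_isFormBounded
    (h : SolvesMartingaleProblem (seenGenerator c R r n) P 𝓕 X)
    (hc : IsLocal c) (hr : ∀ z ∈ R, IsLocal (r z)) (hE : EnergyEstimate ρ c R r n C ε₀)
    (h0 : ∀ f, IsLocal f → ∫ a, f (X 0 a) ∂P = ∫ η, f η ∂(bernoulliProduct ρ)) (hε₀ : 0 < ε₀)
    {V : Config → ℝ} (hV : IsLocal V) {Y : Finset ℤ} {K : ℝ} (hK : 0 < K)
    (hVK : IsFormBounded ρ V Y K) (hVK' : IsFormBounded ρ (fun η => -V η) Y K)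
    {t τ : ℝ} (ht : 0 ≤ t) (hτ : 0 < τ) :
    ∫ a, (∫ s in t..t + τ, V (X s a)) ^ 2 ∂P ≤
      4 * Real.exp (C * (t + τ) + 4 / ε₀) * (τ * K / n ^ 2) := by
  have hn : (0 : ℝ) < n := by exact_mod_cast n.pos
  -- this choice makes the exponential moments of order one
  set θ : ℝ := n / √(τ * K) with hθ
  have hθ0 : 0 < θ := by positivity
  have hθ2 : θ ^ 2 = n ^ 2 / (τ * K) := by
    rw [hθ, div_pow, Real.sq_sqrt (by positivity)]
  have he : C * (t + τ) + 4 * θ ^ 2 * K / (n ^ 2 * ε₀) * τ = C * (t + τ) + 4 / ε₀ := by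
    rw [hθ2]
    field_simp
  have h1 := h.integral_exp_le hc hr hE h0 hV hVK ht hτ.le hθ0
  have h2 := h.integral_exp_le hc hr hE h0 hV.neg hVK' ht hτ.le hθ0
  rw [he] at h1 h2
  simp only [intervalIntegral.integral_neg, mul_neg] at h2
  have hpt : ∀ u : ℝ, u ^ 2 ≤ 2 * (Real.exp u + Real.exp (-u)) := by
    intro u
    rcases le_total 0 u with hu | hu
    · have := Real.quadratic_le_exp_of_nonneg hu
      have := Real.exp_pos (-u)
      nlinarith
    · have := Real.quadratic_le_exp_of_nonneg (neg_nonneg.2 hu)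
      have := Real.exp_pos u
      nlinarith
  have i1 : Integrable (fun a => Real.exp (θ * ∫ s in t..t + τ, V (X s a))) P := by
    have := h.integrable_exp_mul (hV.const_mul θ) (IsLocal.const 1) t (t + τ)
    simpa only [intervalIntegral.integral_const_mul, mul_one] using this
  have i2 : Integrable (fun a => Real.exp (-(θ * ∫ s in t..t + τ, V (X s a)))) P := by
    have := h.integrable_exp_mul (hV.neg.const_mul θ) (IsLocal.const 1) t (t + τ)
    simpa only [intervalIntegral.integral_const_mul, mul_one, intervalIntegral.integral_neg,
      mul_neg] using this
  have h3 : ∫ a, (θ * ∫ s in t..t + τ, V (X s a)) ^ 2 ∂P ≤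
      ∫ a, 2 * (Real.exp (θ * ∫ s in t..t + τ, V (X s a)) +
        Real.exp (-(θ * ∫ s in t..t + τ, V (X s a)))) ∂P := by
    refine integral_mono ?_ ((i1.add i2).const_mul 2) fun a => hpt _
    simp_rw [mul_pow]
    exact (h.integrable_integral_sq hV hτ.le).const_mul _
  rw [integral_const_mul, integral_add i1 i2] at h3
  simp_rw [mul_pow] at h3
  rw [integral_const_mul, hθ2, div_mul_eq_mul_div, div_le_iff₀ (by positivity)] at h3
  set Q := ∫ a, (∫ s in t..t + τ, V (X s a)) ^ 2 ∂P
  set F := Real.exp (C * (t + τ) + 4 / ε₀)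
  rw [← mul_div_assoc, le_div_iff₀ (by positivity)]
  have h4 : 0 ≤ τ * K := by positivity
  nlinarith

/-- The second moment of the time integral of a function of small norm, by the bound for the
density at fixed times. -/
lemma integral_sq_le_of_norm (h : SolvesMartingaleProblem (seenGenerator c R r n) P 𝓕 X)
    (hc : IsLocal c) (hr : ∀ z ∈ R, IsLocal (r z)) (hE : EnergyEstimate ρ c R r n C ε₀)
    (h0 : ∀ f, IsLocal f → ∫ a, f (X 0 a) ∂P = ∫ η, f η ∂(bernoulliProduct ρ)) (hC : 0 ≤ C)
    {U : Config → ℝ} (hU : IsLocal U) {t τ : ℝ} (ht : 0 ≤ t) (hτ : 0 < τ) :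
    ∫ a, (∫ s in t..t + τ, U (X s a)) ^ 2 ∂P ≤
      Real.exp (C * (t + τ)) * (τ ^ 2 * √(∫ η, U η ^ 4 ∂(bernoulliProduct ρ))) := by
  have hle : t ≤ t + τ := by linarith
  have hU2 := hU.pow 2
  obtain ⟨b, -, hb⟩ := hU.exists_bound
  obtain ⟨b2, -, hb2⟩ := hU2.exists_bound
  have hCS : ∀ a, (∫ s in t..t + τ, U (X s a)) ^ 2 ≤ τ * ∫ s in t..t + τ, U (X s a) ^ 2 := by
    intro a
    set m := (∫ s in t..t + τ, U (X s a)) / τ with hm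
    have i1 := intervalIntegrable_of_rightContinuous (h.rightContinuous_comp hU a)
      (fun s => hb _) t (t + τ)
    have i2 := intervalIntegrable_of_rightContinuous (h.rightContinuous_comp hU2 a)
      (fun s => hb2 _) t (t + τ)
    have hpos : 0 ≤ ∫ s in t..t + τ, (U (X s a) ^ 2 - 2 * m * U (X s a) + m ^ 2) :=
      intervalIntegral.integral_nonneg hle fun s _ => by nlinarith [sq_nonneg (U (X s a) - m)]
    rw [intervalIntegral.integral_add (i2.sub (i1.const_mul _)) intervalIntegrable_const,
      intervalIntegral.integral_sub i2 (i1.const_mul _), intervalIntegral.integral_const_mul,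
      intervalIntegral.integral_const] at hpos
    have hmτ : ∫ s in t..t + τ, U (X s a) = m * τ := by
      rw [hm]
      field_simp
    rw [hmτ] at hpos ⊢
    simp only [add_sub_cancel_left, smul_eq_mul] at hpos
    nlinarith
  have hm := h.measurable_uncurry_comp hU2
  have hprod : Integrable (Function.uncurry fun (s : ℝ) (a : S) => U (X s a) ^ 2)
      ((volume.restrict (Ioc t (t + τ))).prod P) :=
    Integrable.of_bound hm.aestronglyMeasurable b2 (ae_of_all _ fun p => hb2 _)
  have hswap : ∫ a, (∫ s in t..t + τ, U (X s a) ^ 2) ∂P =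
      ∫ s in t..t + τ, (∫ a, U (X s a) ^ 2 ∂P) := by
    simp only [intervalIntegral.integral_of_le hle]
    exact (integral_integral_swap hprod).symm
  have hs : ∀ s ∈ Icc t (t + τ), ‖∫ a, U (X s a) ^ 2 ∂P‖ ≤
      Real.exp (C * (t + τ)) * √(∫ η, U η ^ 4 ∂(bernoulliProduct ρ)) := by
    intro s hs
    have h1 := h.abs_integral_comp_le hc hr hE h0 (ht.trans hs.1) hU2
    simp_rw [← pow_mul] at h1
    refine h1.trans ?_
    gcongr
    exact hs.2
  have h2 : ∫ s in t..t + τ, (∫ a, U (X s a) ^ 2 ∂P) ≤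
      Real.exp (C * (t + τ)) * √(∫ η, U η ^ 4 ∂(bernoulliProduct ρ)) * τ := by
    have := intervalIntegral.norm_integral_le_of_norm_le_const (a := t) (b := t + τ)
      fun s hs' => hs s (by
        rw [uIoc_of_le hle] at hs'
        exact ⟨hs'.1.le, hs'.2⟩)
    rw [add_sub_cancel_left, abs_of_pos hτ] at this
    exact (le_abs_self _).trans this
  have i3 : Integrable (fun a => τ * ∫ s in t..t + τ, U (X s a) ^ 2) P := by
    refine (Integrable.of_bound (h.measurable_integral hU2 _ _).aestronglyMeasurable (b2 * τ)
      (ae_of_all _ fun a => ?_)).const_mul _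
    exact abs_integral_comp_path_le hb2 hτ.le a
  refine (integral_mono (h.integrable_integral_sq hU hτ.le) i3 hCS).trans ?_
  rw [integral_const_mul, hswap]
  refine (mul_le_mul_of_nonneg_left h2 hτ.le).trans (le_of_eq ?_)
  ring

end SolvesMartingaleProblem

/-- The fourth moment of a sum of block averages with bounded coefficients. -/
lemma integral_sum_blockAverage_pow_four_le {I : Finset ℤ} {g : ℤ → Config → ℝ} {B : ℝ}
    (hg : ∀ i, IsLocal (g i)) (hB : ∀ i ∈ I, ∀ η, |g i η| ≤ B) {l : ℕ} (hl : 0 < l) :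
    ∫ η, (∑ i ∈ I, g i η * ((l : ℝ)⁻¹ * blockSum ρ i l η)) ^ 4 ∂(bernoulliProduct ρ) ≤
      (2 * I.card ^ 2 * B ^ 2 / l) ^ 2 := by
  have hl' : (0 : ℝ) < l := by exact_mod_cast hl
  have hS : ∀ i, IsLocal fun η => (I.card : ℝ) ^ 3 * (B ^ 4 * (l : ℝ)⁻¹ ^ 4 *
      blockSum ρ i l η ^ 4) := fun i => (((isLocal_blockSum i l).pow 4).const_mul _).const_mul _
  have hpt : ∀ η, (∑ i ∈ I, g i η * ((l : ℝ)⁻¹ * blockSum ρ i l η)) ^ 4 ≤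
      ∑ i ∈ I, (I.card : ℝ) ^ 3 * (B ^ 4 * (l : ℝ)⁻¹ ^ 4 * blockSum ρ i l η ^ 4) := by
    intro η
    set u : ℤ → ℝ := fun i => g i η * ((l : ℝ)⁻¹ * blockSum ρ i l η) with hu
    have h1 : (∑ i ∈ I, u i) ^ 2 ≤ I.card * ∑ i ∈ I, u i ^ 2 := sq_sum_le_card_mul_sum_sq
    have h2 : (∑ i ∈ I, u i ^ 2) ^ 2 ≤ I.card * ∑ i ∈ I, (u i ^ 2) ^ 2 := sq_sum_le_card_mul_sum_sq
    have h3 : ∀ i ∈ I, (u i ^ 2) ^ 2 ≤ B ^ 4 * (l : ℝ)⁻¹ ^ 4 * blockSum ρ i l η ^ 4 := by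
      intro i hi
      have h4 : g i η ^ 4 ≤ B ^ 4 := by
        have := pow_le_pow_left₀ (abs_nonneg _) (hB i hi η) 4
        rwa [Even.pow_abs (by decide)] at this
      have e : (u i ^ 2) ^ 2 = g i η ^ 4 * ((l : ℝ)⁻¹ ^ 4 * blockSum ρ i l η ^ 4) := by
        rw [hu]
        ring
      rw [e, mul_assoc]
      gcongr
    calc (∑ i ∈ I, u i) ^ 4 = ((∑ i ∈ I, u i) ^ 2) ^ 2 := by ring
      _ ≤ (I.card * ∑ i ∈ I, u i ^ 2) ^ 2 := by gcongr
      _ = (I.card : ℝ) ^ 2 * (∑ i ∈ I, u i ^ 2) ^ 2 := by ring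
      _ ≤ (I.card : ℝ) ^ 2 * (I.card * ∑ i ∈ I, (u i ^ 2) ^ 2) := by gcongr
      _ = (I.card : ℝ) ^ 3 * ∑ i ∈ I, (u i ^ 2) ^ 2 := by ring
      _ ≤ (I.card : ℝ) ^ 3 * ∑ i ∈ I, B ^ 4 * (l : ℝ)⁻¹ ^ 4 * blockSum ρ i l η ^ 4 := by
        gcongr with i hi
        exact h3 i hi
      _ = _ := by rw [Finset.mul_sum]
  refine (((IsLocal.sum I fun i _ => (hg i).mul ((isLocal_blockSum i l).const_mul _)).pow
    4).integral_mono (IsLocal.sum I fun i _ => hS i) hpt).trans ?_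
  rw [integral_finsetSum _ fun i _ => (hS i).integrable _]
  have h5 : ∀ i ∈ I, ∫ η, (I.card : ℝ) ^ 3 * (B ^ 4 * (l : ℝ)⁻¹ ^ 4 * blockSum ρ i l η ^ 4)
      ∂(bernoulliProduct ρ) ≤ (I.card : ℝ) ^ 3 * (B ^ 4 * (l : ℝ)⁻¹ ^ 4 * (3 * l ^ 2)) := by
    intro i _
    rw [integral_const_mul, integral_const_mul]
    have := integral_blockSum_pow_four_le (ρ := ρ) i l
    have : 0 ≤ B ^ 4 := by positivity
    gcongr
  refine (Finset.sum_le_sum h5).trans ?_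
  rw [Finset.sum_const, nsmul_eq_mul]
  have e : (I.card : ℝ) * ((I.card : ℝ) ^ 3 * (B ^ 4 * (l : ℝ)⁻¹ ^ 4 * (3 * l ^ 2))) =
      3 * ((I.card : ℝ) ^ 2 * B ^ 2 / l) ^ 2 := by
    field_simp
  have e' : (2 * (I.card : ℝ) ^ 2 * B ^ 2 / l) ^ 2 = 4 * ((I.card : ℝ) ^ 2 * B ^ 2 / l) ^ 2 := by
    ring
  rw [e, e']
  nlinarith [sq_nonneg ((I.card : ℝ) ^ 2 * B ^ 2 / l)]

/-- The second moment of the additive functional of a centred local function. The function is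
replaced by its average over a block of length of order `√τ n`, for which the cost of the
replacement and the size of the average are of the same order. -/
theorem exists_integral_sq_le {ω : Config → ℝ} (hω : IsLocal ω) (ρ : unitInterval)
    (hC : 0 ≤ C) (hε₀ : 0 < ε₀) (T : ℝ) :
    ∃ D, 0 ≤ D ∧ ∀ {S : Type*} [mS : MeasurableSpace S] {c : Config → ℝ} {R : Finset ℤ}
      {r : ℤ → Config → ℝ} {n : ℕ+} {P : Measure S} [IsProbabilityMeasure P]
      {𝓕 : Filtration ℝ≥0 mS} {X : ℝ → S → Config},
      SolvesMartingaleProblem (seenGenerator c R r n) P 𝓕 X → IsLocal c →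
      (∀ z ∈ R, IsLocal (r z)) → EnergyEstimate ρ c R r n C ε₀ →
      (∀ f, IsLocal f → ∫ a, f (X 0 a) ∂P = ∫ η, f η ∂(bernoulliProduct ρ)) →
      ∀ t ∈ Icc 0 T, ∀ τ ∈ Icc 0 T,
        ∫ a, (√(n : ℝ) * ∫ s in t..t + τ, (ω (X s a) - ∫ η, ω η ∂(bernoulliProduct ρ))) ^ 2 ∂P ≤
          D * √τ ^ 3 := by
  classical
  obtain ⟨I, g, B, hB0, hB, hg, hdec⟩ := hω.exists_decomposition ρ
  have hgl : ∀ i, IsLocal (g i) := fun i => ⟨_, (hg i).choose_spec.1⟩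
  set v := ∫ η, ω η ∂(bernoulliProduct ρ)
  have hωv : IsLocal fun η => ω η - v := hω.sub (IsLocal.const v)
  obtain ⟨b, hb0, hb⟩ := hωv.exists_bound
  obtain ⟨p, hp0, hp⟩ : ∃ p : ℝ, 0 ≤ p ∧ (I.card : ℝ) = p := ⟨_, Nat.cast_nonneg _, rfl⟩
  obtain ⟨K₀, hK₀pos, hK₀⟩ : ∃ K₀ : ℝ, 0 < K₀ ∧ p ^ 2 * B ^ 2 ≤ K₀ :=
    ⟨p ^ 2 * B ^ 2 + 1, by positivity, by linarith⟩
  obtain ⟨E, hE0, hE1⟩ : ∃ E, 0 < E ∧ Real.exp (C * (T + T) + 4 / ε₀) ≤ E :=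
    ⟨_, Real.exp_pos _, le_rfl⟩
  refine ⟨b ^ 2 + E * (16 * K₀ + 4 * (p ^ 2 * B ^ 2)), by positivity, ?_⟩
  intro S mS c R r n P _ 𝓕 X h hc hr hE h0 t ht τ hτ
  have hn : (0 : ℝ) < n := by exact_mod_cast n.pos
  rcases hτ.1.eq_or_lt with rfl | hτ0
  · simp
  have hs0 : 0 < √τ := Real.sqrt_pos.2 hτ0
  have hss : √τ ^ 2 = τ := Real.sq_sqrt hτ.1
  simp_rw [mul_pow, Real.sq_sqrt hn.le]
  rw [integral_const_mul]
  rcases lt_or_ge (√τ * n) 1 with hsmall | hlarge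
  · -- on very short time intervals the trivial bound suffices
    have h1 : ∫ a, (∫ s in t..t + τ, (ω (X s a) - v)) ^ 2 ∂P ≤ (b * τ) ^ 2 := by
      refine (integral_mono (h.integrable_integral_sq hωv hτ.1) (integrable_const ((b * τ) ^ 2))
        fun a => ?_).trans (by simp)
      have := SolvesMartingaleProblem.abs_integral_comp_path_le (X := X) hb hτ.1 (t := t) a
      exact sq_le_sq' (abs_le.1 this).1 (abs_le.1 this).2
    calc (n : ℝ) * ∫ a, (∫ s in t..t + τ, (ω (X s a) - v)) ^ 2 ∂P ≤ n * (b * τ) ^ 2 := by gcongr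
      _ = (√τ * n) * (b ^ 2 * √τ ^ 3) := by
        rw [← hss, Real.sqrt_sq hs0.le]
        ring
      _ ≤ 1 * (b ^ 2 * √τ ^ 3) := by gcongr
      _ ≤ _ := by
        rw [one_mul]
        gcongr
        have : 0 ≤ E * (16 * K₀ + 4 * (p ^ 2 * B ^ 2)) := by positivity
        linarith
  · set l := ⌈√τ * n⌉₊ with hl
    have hl0 : 0 < l := Nat.ceil_pos.2 (by positivity)
    have hl0' : (0 : ℝ) < l := by exact_mod_cast hl0
    have hl1 : √τ * n ≤ l := Nat.le_ceil _
    have hl2 : (l : ℝ) ≤ 2 * (√τ * n) := by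
      have := (Nat.ceil_lt_add_one (by positivity : 0 ≤ √τ * n)).le
      linarith
    let V : Config → ℝ := fun η => ∑ i ∈ I, g i η * (occ i η - ρ - (l : ℝ)⁻¹ * blockSum ρ i l η)
    let U : Config → ℝ := fun η => ∑ i ∈ I, g i η * ((l : ℝ)⁻¹ * blockSum ρ i l η)
    let Y : Finset ℤ := I.biUnion fun i => (Finset.range l).image fun k : ℕ => i + k
    have hterm : ∀ i, IsLocal fun η => occ i η - ρ - (l : ℝ)⁻¹ * blockSum ρ i l η := fun i =>
      (isLocal_occ_sub i).sub ((isLocal_blockSum i l).const_mul _)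
    have hVl : IsLocal V := IsLocal.sum I fun i _ => (hgl i).mul (hterm i)
    have hUl : IsLocal U :=
      IsLocal.sum I fun i _ => (hgl i).mul ((isLocal_blockSum i l).const_mul _)
    have hK : p ^ 2 * (l * B ^ 2) ≤ l * K₀ := by
      have := mul_le_mul_of_nonneg_left hK₀ hl0'.le
      linarith
    have hform : ∀ g' : ℤ → Config → ℝ, (∀ i, ∃ A : Finset ℤ, DependsOn (g' i) (A : Set ℤ) ∧
        ∀ j ∈ A, j < i) → (∀ i ∈ I, ∀ η, |g' i η| ≤ B) → IsFormBounded ρ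
        (fun η => ∑ i ∈ I, g' i η * (occ i η - ρ - (l : ℝ)⁻¹ * blockSum ρ i l η)) Y (l * K₀) := by
      intro g' hg' hB'
      refine (IsFormBounded.sum I (Y := Y) (K := l * B ^ 2)
        (fun i _ => IsLocal.mul ⟨_, (hg' i).choose_spec.1⟩ (hterm i)) fun i hi => ?_).mono
          subset_rfl (by rwa [hp])
      obtain ⟨A, hA, hlt⟩ := hg' i
      exact (IsFormBounded.mul_occ_sub_average hA hlt (hB' i hi) hl0).mono
        (Finset.subset_biUnion_of_mem (fun i : ℤ => (Finset.range l).image fun k : ℕ => i + k) hi)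
        le_rfl
    have hV1 : IsFormBounded ρ V Y (l * K₀) := hform g hg hB
    have hV2 : IsFormBounded ρ (fun η => -V η) Y (l * K₀) := by
      have := hform (fun i η => -g i η) (fun i => by
        obtain ⟨A, hA, hlt⟩ := hg i
        exact ⟨A, fun η ζ h => congrArg Neg.neg (hA h), hlt⟩) (fun i hi η => by
          rw [abs_neg]
          exact hB i hi η)
      simpa only [V, neg_mul, Finset.sum_neg_distrib] using this
    have hsplit : ∀ η, ω η - v = V η + U η := fun η => by
      simp only [V, U]
      rw [hdec η, ← Finset.sum_add_distrib, add_sub_cancel_left]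
      exact Finset.sum_congr rfl fun i _ => by ring
    have h1 := h.integral_sq_le_of_isFormBounded hc hr hE h0 hε₀ hVl
      (by positivity : 0 < l * K₀) hV1 hV2 ht.1 hτ0
    have h2 := h.integral_sq_le_of_norm hc hr hE h0 hC hUl ht.1 hτ0
    have hU4 : √(∫ η, U η ^ 4 ∂(bernoulliProduct ρ)) ≤ 2 * p ^ 2 * B ^ 2 / l := by
      rw [Real.sqrt_le_left (by positivity)]
      rw [← hp]
      exact integral_sum_blockAverage_pow_four_le hgl hB hl0
    obtain ⟨bV, -, hbV⟩ := hVl.exists_bound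
    obtain ⟨bU, -, hbU⟩ := hUl.exists_bound
    have hpt : ∀ a, (∫ s in t..t + τ, (ω (X s a) - v)) ^ 2 ≤
        2 * (∫ s in t..t + τ, V (X s a)) ^ 2 + 2 * (∫ s in t..t + τ, U (X s a)) ^ 2 := by
      intro a
      simp_rw [hsplit]
      rw [intervalIntegral.integral_add
        (intervalIntegrable_of_rightContinuous (h.rightContinuous_comp hVl a) (fun s => hbV _) _ _)
        (intervalIntegrable_of_rightContinuous (h.rightContinuous_comp hUl a) (fun s => hbU _) _ _)]
      nlinarith [sq_nonneg ((∫ s in t..t + τ, V (X s a)) - ∫ s in t..t + τ, U (X s a))]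
    have h3 := integral_mono (h.integrable_integral_sq hωv hτ.1)
      (((h.integrable_integral_sq hVl hτ.1).const_mul 2).add
        ((h.integrable_integral_sq hUl hτ.1).const_mul 2)) hpt
    simp only [Pi.add_apply] at h3
    rw [integral_add ((h.integrable_integral_sq hVl hτ.1).const_mul 2)
      ((h.integrable_integral_sq hUl hτ.1).const_mul 2), integral_const_mul,
      integral_const_mul] at h3
    replace hE1 : Real.exp (C * (t + τ) + 4 / ε₀) ≤ E := by
      refine le_trans (Real.exp_le_exp.2 ?_) hE1
      have := mul_le_mul_of_nonneg_left (add_le_add ht.2 hτ.2) hC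
      linarith
    have hE2 : Real.exp (C * (t + τ)) ≤ E := by
      refine le_trans (Real.exp_le_exp.2 ?_) hE1
      have : 0 < 4 / ε₀ := by positivity
      linarith
    have h4 : 4 * Real.exp (C * (t + τ) + 4 / ε₀) * (τ * (l * K₀) / n ^ 2) ≤
        4 * E * (τ * ((2 * (√τ * n)) * K₀) / n ^ 2) := by gcongr
    have h5 : Real.exp (C * (t + τ)) * (τ ^ 2 * √(∫ η, U η ^ 4 ∂(bernoulliProduct ρ))) ≤
        E * (τ ^ 2 * (2 * p ^ 2 * B ^ 2 / (√τ * n))) := by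
      have : 2 * p ^ 2 * B ^ 2 / l ≤ 2 * p ^ 2 * B ^ 2 / (√τ * n) := by gcongr
      have := hU4.trans this
      gcongr
    calc (n : ℝ) * ∫ a, (∫ s in t..t + τ, (ω (X s a) - v)) ^ 2 ∂P
        ≤ n * (2 * (4 * E * (τ * ((2 * (√τ * n)) * K₀) / n ^ 2)) +
          2 * (E * (τ ^ 2 * (2 * p ^ 2 * B ^ 2 / (√τ * n))))) := by
          gcongr
          linarith
      _ = E * (16 * K₀ + 4 * (p ^ 2 * B ^ 2)) * √τ ^ 3 := by
          rw [← hss, Real.sqrt_sq hs0.le]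
          field_simp
          ring
      _ ≤ _ := by
          gcongr
          have : 0 ≤ b ^ 2 := by positivity
          linarith

end SecondMoment

/-! ### Tightness in the space of continuous paths -/

section Tightness

open Set

/-- Chaining: a continuous function whose increments over dyadic intervals decay geometrically has
a modulus of continuity that depends on the rate of decay only. -/
lemma abs_sub_le_of_dyadic {g : ℝ → ℝ} (hg : Continuous g) {M r : ℝ} (hM : 0 ≤ M) (hr : 0 ≤ r)
    (hr1 : r < 1)
    (h : ∀ k i : ℕ, i < 2 ^ k → |g ((i + 1) / 2 ^ k) - g (i / 2 ^ k)| ≤ M * r ^ k) (k : ℕ)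
    {s t : ℝ} (hs : 0 ≤ s) (hst : s ≤ t) (ht : t ≤ 1) (hk : t - s ≤ 1 / 2 ^ k) :
    |g s - g t| ≤ M * (1 + 2 * r / (1 - r)) * r ^ k := by
  have hr1' : 0 < 1 - r := sub_pos.2 hr1
  -- `g` is close to its values at the dyadic approximations from below
  have key : ∀ u : ℝ, 0 ≤ u → u ≤ 1 → dist (g (⌊u * 2 ^ k⌋₊ / 2 ^ k)) (g u) ≤
      M * r * r ^ k / (1 - r) := by
    intro u hu hu1
    refine dist_le_of_le_geometric_of_tendsto (f := fun j : ℕ => g (⌊u * 2 ^ j⌋₊ / 2 ^ j)) r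
      (M * r) hr1 (fun j => ?_) ?_ k
    · have hp : (0 : ℝ) < 2 ^ j := by positivity
      set x := u * 2 ^ j with hx
      have hx0 : 0 ≤ x := by positivity
      have hx2 : u * 2 ^ (j + 1) = 2 * x := by rw [hx]; ring
      have h1 : 2 * ⌊x⌋₊ ≤ ⌊2 * x⌋₊ := Nat.le_floor (by
        push_cast; linarith [Nat.floor_le hx0])
      have h2 : ⌊2 * x⌋₊ < 2 * ⌊x⌋₊ + 2 := (Nat.floor_lt (by positivity)).2 (by
        push_cast; linarith [Nat.lt_floor_add_one x])
      have h0 : ((2 * ⌊x⌋₊ : ℕ) : ℝ) / 2 ^ (j + 1) = ⌊x⌋₊ / 2 ^ j := by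
        push_cast; field_simp; ring
      rw [hx2, ← h0, dist_comm, Real.dist_eq]
      obtain h3 | h3 : ⌊2 * x⌋₊ = 2 * ⌊x⌋₊ ∨ ⌊2 * x⌋₊ = 2 * ⌊x⌋₊ + 1 := by omega
      · rw [h3, sub_self, abs_zero]; positivity
      · have hlt : 2 * ⌊x⌋₊ < 2 ^ (j + 1) := by
          have : ((2 * ⌊x⌋₊ + 1 : ℕ) : ℝ) ≤ (2 ^ (j + 1) : ℕ) := by
            rw [← h3]
            refine (Nat.floor_le (by positivity)).trans ?_
            push_cast
            rw [hx, pow_succ]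
            nlinarith
          have := Nat.cast_le.1 this
          omega
        have := h (j + 1) _ hlt
        rw [h3]
        push_cast at this ⊢
        rwa [mul_assoc, ← pow_succ']
    · refine (hg.tendsto u).comp ?_
      have := (tendsto_nat_floor_mul_div_atTop hu).comp
        (tendsto_pow_atTop_atTop_of_one_lt (one_lt_two (α := ℝ)))
      exact this
  have hp : (0 : ℝ) < 2 ^ k := by positivity
  have hmid : dist (g (⌊s * 2 ^ k⌋₊ / 2 ^ k)) (g (⌊t * 2 ^ k⌋₊ / 2 ^ k)) ≤ M * r ^ k := by
    have hs0 : 0 ≤ s * 2 ^ k := by positivity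
    have h1 : ⌊s * 2 ^ k⌋₊ ≤ ⌊t * 2 ^ k⌋₊ := Nat.floor_mono (by gcongr)
    have h2 : ⌊t * 2 ^ k⌋₊ ≤ ⌊s * 2 ^ k⌋₊ + 1 := by
      rw [← Nat.floor_add_one hs0]
      refine Nat.floor_mono ?_
      rw [le_div_iff₀ hp] at hk
      linarith
    rw [dist_comm, Real.dist_eq]
    obtain h3 | h3 : ⌊t * 2 ^ k⌋₊ = ⌊s * 2 ^ k⌋₊ ∨ ⌊t * 2 ^ k⌋₊ = ⌊s * 2 ^ k⌋₊ + 1 := by omega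
    · rw [h3, sub_self, abs_zero]; positivity
    · have hlt : ⌊s * 2 ^ k⌋₊ < 2 ^ k := by
        have : ((⌊s * 2 ^ k⌋₊ + 1 : ℕ) : ℝ) ≤ (2 ^ k : ℕ) := by
          rw [← h3]
          refine (Nat.floor_le (by nlinarith)).trans ?_
          push_cast
          nlinarith
        have := Nat.cast_le.1 this
        omega
      have := h k _ hlt
      rw [h3]
      push_cast
      exact this
  have h1 := key s hs (hst.trans ht)
  have h2 := key t (hs.trans hst) ht
  rw [← Real.dist_eq]
  calc dist (g s) (g t) ≤ dist (g (⌊s * 2 ^ k⌋₊ / 2 ^ k)) (g s) +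
        dist (g (⌊s * 2 ^ k⌋₊ / 2 ^ k)) (g (⌊t * 2 ^ k⌋₊ / 2 ^ k)) +
        dist (g (⌊t * 2 ^ k⌋₊ / 2 ^ k)) (g t) := by
        rw [dist_comm _ (g s)]; exact dist_triangle4 _ _ _ _
    _ ≤ M * r * r ^ k / (1 - r) + M * r ^ k + M * r * r ^ k / (1 - r) := by gcongr
    _ = _ := by field_simp; ring

variable {T : ℝ}

/-- The path at time `u * T`, for `u ∈ [0, 1]`, extended by constants to all real `u`. -/
noncomputable def rescaledPath (hT : 0 < T) (f : C(Icc (0 : ℝ) T, ℝ)) (u : ℝ) : ℝ :=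
  f (projIcc 0 T hT.le (u * T))

lemma continuous_rescaledPath (hT : 0 < T) (f : C(Icc (0 : ℝ) T, ℝ)) :
    Continuous (rescaledPath hT f) :=
  f.continuous.comp (continuous_projIcc.comp (continuous_id.mul continuous_const))

lemma rescaledPath_div (hT : 0 < T) (f : C(Icc (0 : ℝ) T, ℝ)) (t : Icc (0 : ℝ) T) :
    rescaledPath hT f (t / T) = f t := by
  rw [rescaledPath, div_mul_cancel₀ _ hT.ne', projIcc_val]

/-- The paths started at `0` whose increments over the dyadic intervals of level `k` are at most
`M * r ^ k`. -/
def dyadicPaths (hT : 0 < T) (M r : ℝ) : Set C(Icc (0 : ℝ) T, ℝ) :=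
  {f | rescaledPath hT f 0 = 0 ∧ ∀ k i : ℕ, i < 2 ^ k →
    |rescaledPath hT f ((i + 1) / 2 ^ k) - rescaledPath hT f (i / 2 ^ k)| ≤ M * r ^ k}

lemma isClosed_dyadicPaths (hT : 0 < T) (M r : ℝ) : IsClosed (dyadicPaths hT M r) := by
  have hev : ∀ u, Continuous fun f => rescaledPath hT f u := fun u => continuous_eval_const _
  have : dyadicPaths hT M r = {f | rescaledPath hT f 0 = 0} ∩ ⋂ (k : ℕ) (i : ℕ) (_ : i < 2 ^ k),
      {f | |rescaledPath hT f ((i + 1) / 2 ^ k) - rescaledPath hT f (i / 2 ^ k)| ≤ M * r ^ k} := by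
    ext f
    simp [dyadicPaths]
  rw [this]
  exact (isClosed_eq (hev 0) continuous_const).inter <| isClosed_iInter fun k =>
    isClosed_iInter fun i => isClosed_iInter fun _ =>
      isClosed_le ((hev _).sub (hev _)).abs continuous_const

lemma abs_sub_le_of_mem_dyadicPaths (hT : 0 < T) {M r : ℝ} (hM : 0 ≤ M) (hr : 0 ≤ r)
    (hr1 : r < 1) {f : C(Icc (0 : ℝ) T, ℝ)} (hf : f ∈ dyadicPaths hT M r) (k : ℕ)
    (s t : Icc (0 : ℝ) T) (hk : dist s t ≤ T / 2 ^ k) :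
    dist (f s) (f t) ≤ M * (1 + 2 * r / (1 - r)) * r ^ k := by
  wlog hst : (s : ℝ) ≤ t generalizing s t
  · rw [dist_comm]
    exact this t s (by rwa [dist_comm]) (le_of_not_ge hst)
  rw [Subtype.dist_eq, dist_comm, Real.dist_eq, abs_of_nonneg (sub_nonneg.2 hst)] at hk
  rw [Real.dist_eq, ← rescaledPath_div hT f s, ← rescaledPath_div hT f t]
  refine abs_sub_le_of_dyadic (continuous_rescaledPath hT f) hM hr hr1 hf.2 k
    (div_nonneg s.2.1 hT.le) (by gcongr) ((div_le_one hT).2 t.2.2) ?_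
  rw [← sub_div, div_le_iff₀ hT]
  exact hk.trans (le_of_eq (by ring))

lemma isCompact_dyadicPaths (hT : 0 < T) {M r : ℝ} (hM : 0 ≤ M) (hr : 0 ≤ r) (hr1 : r < 1) :
    IsCompact (dyadicPaths hT M r) := by
  have hr1' : 0 < 1 - r := sub_pos.2 hr1
  set N := M * (1 + 2 * r / (1 - r)) with hN
  let e := ContinuousMap.isometryEquivBoundedOfCompact (Icc (0 : ℝ) T) ℝ
  have : IsCompact (e.symm ⁻¹' dyadicPaths hT M r) := by
    refine BoundedContinuousFunction.arzela_ascoli₂ (Icc (-N) N) isCompact_Icc _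
      ((isClosed_dyadicPaths hT M r).preimage e.symm.continuous) (fun f t hf => ?_)
      (UniformEquicontinuous.equicontinuous (Metric.uniformEquicontinuous_iff.2
        fun ε hε => ?_))
    · have h0 : (e.symm f) ⟨0, le_rfl, hT.le⟩ = 0 := by
        have := rescaledPath_div hT (e.symm f) ⟨0, le_rfl, hT.le⟩
        simp only [zero_div] at this
        exact this.symm.trans hf.1
      have := abs_sub_le_of_mem_dyadicPaths hT hM hr hr1 hf 0 t ⟨0, le_rfl, hT.le⟩ (by
        rw [Subtype.dist_eq, Real.dist_eq, sub_zero, abs_of_nonneg t.2.1]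
        simpa using t.2.2)
      rw [h0, dist_zero_right, pow_zero, mul_one] at this
      exact abs_le.1 this
    · obtain ⟨k, hk⟩ := ((tendsto_pow_atTop_nhds_zero_of_lt_one hr hr1).const_mul N).eventually
        (gt_mem_nhds (by simpa using hε)) |>.exists
      refine ⟨T / 2 ^ k, by positivity, fun s t hst f => lt_of_le_of_lt ?_ hk⟩
      exact abs_sub_le_of_mem_dyadicPaths hT hM hr hr1 f.2 k s t hst.le
  have h2 := this.image e.symm.continuous
  rwa [image_preimage_eq _ e.symm.surjective] at h2

/-- The Borel σ-algebra of the space of continuous paths is generated by the evaluations: a path is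
the uniform limit of its Bernstein polynomials. -/
lemma measurable_of_measurable_eval (hT : 0 < T) {S : Type*} [MeasurableSpace S]
    {A : S → C(Icc (0 : ℝ) T, ℝ)} (hA : ∀ t, Measurable fun a => A a t) : Measurable A := by
  let h := iccHomeoI (0 : ℝ) T hT
  -- the Bernstein approximations depend on finitely many evaluations
  let B : ℕ → S → C(Icc (0 : ℝ) T, ℝ) := fun m a =>
    (bernsteinApproximation m ((A a).comp ⟨h.symm, h.symm.continuous⟩)).comp ⟨h, h.continuous⟩
  refine measurable_of_tendsto_metrizable (f := B) (fun m => ?_) (tendsto_pi_nhds.2 fun a => ?_)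
  · let F : (Fin (m + 1) → ℝ) → C(Icc (0 : ℝ) T, ℝ) := fun y =>
      (∑ k : Fin (m + 1), y k • bernstein m k).comp ⟨h, h.continuous⟩
    have hF : Continuous F :=
      (ContinuousMap.continuous_precomp _).comp (continuous_finsetSum _ fun k _ =>
        (continuous_apply k).smul continuous_const)
    have : B m = fun a => F fun k => A a (h.symm (bernstein.z k)) := by
      funext a
      ext t
      simp [B, F, bernsteinApproximation, mul_comm]
    rw [this]
    exact hF.measurable.comp (measurable_pi_lambda _ fun k => hA _)
  · have h1 := bernsteinApproximation_uniform ((A a).comp ⟨h.symm, h.symm.continuous⟩)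
    have h2 := ((ContinuousMap.continuous_precomp (⟨h, h.continuous⟩ :
      C(Icc (0 : ℝ) T, unitInterval))).tendsto _).comp h1
    refine h2.trans (le_of_eq (congrArg _ ?_))
    ext t
    simp

/-- A moment criterion for tightness, by a union bound over the dyadic increments: paths with
measurable evaluations, started at `0`, whose increments have second moments of order `3 / 2` in
time. -/
lemma isTightMeasureSet_of_integral_sq_le (hT : 0 < T) {ι : Type*} {S : ι → Type*}
    [∀ i, MeasurableSpace (S i)] {P : ∀ i, Measure (S i)} [∀ i, IsProbabilityMeasure (P i)]
    {A : ∀ i, S i → C(Icc (0 : ℝ) T, ℝ)} (hA : ∀ i t, Measurable fun a => A i a t)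
    (h0 : ∀ i a (t : Icc (0 : ℝ) T), (t : ℝ) = 0 → A i a t = 0) {D : ℝ} (hD : 0 ≤ D)
    (hint : ∀ i s t, s ≤ t → Integrable (fun a => (A i a t - A i a s) ^ 2) (P i))
    (hle : ∀ i s t, s ≤ t → ∫ a, (A i a t - A i a s) ^ 2 ∂(P i) ≤ D * √((t : ℝ) - s) ^ 3) :
    IsTightMeasureSet (range fun i => (P i).map (A i)) := by
  -- `r` is chosen such that `2 ^ k * √(2 ^ (-k)) ^ 3 = r ^ (4 * k)`
  obtain ⟨r, hr, hr8⟩ : ∃ r : ℝ, 0 < r ∧ r ^ 8 = 1 / 2 :=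
    ⟨(1 / 2) ^ ((8 : ℕ) : ℝ)⁻¹, by positivity,
      Real.rpow_inv_natCast_pow (by norm_num) (by norm_num)⟩
  have hr1 : r < 1 := by
    by_contra! h
    have := one_le_pow₀ h (n := 8)
    rw [hr8] at this
    norm_num at this
  have hr2 : r ^ 2 < 1 := pow_lt_one₀ hr.le hr1 two_ne_zero
  have hr2' : 0 < 1 - r ^ 2 := sub_pos.2 hr2
  have hpow : ∀ k : ℕ, (2 : ℝ) ^ k * (r ^ k) ^ 8 = 1 := fun k => by
    rw [← pow_mul, mul_comm k 8, pow_mul, hr8, ← mul_pow]; norm_num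
  rw [isTightMeasureSet_iff_exists_isCompact_measure_compl_le]
  intro ε hε
  obtain ⟨δ, hδ, hδε⟩ : ∃ δ : ℝ, 0 < δ ∧ ENNReal.ofReal δ ≤ ε := by
    obtain ⟨δ, -, h1, h2⟩ := ENNReal.lt_iff_exists_real_btwn.1 hε
    exact ⟨δ, ENNReal.ofReal_pos.1 h1, h2.le⟩
  set B := D * √T ^ 3 / (1 - r ^ 2) with hB
  have hB0 : 0 ≤ B := by positivity
  obtain ⟨M, hM, hMB⟩ : ∃ M : ℝ, 0 < M ∧ B / M ^ 2 ≤ δ := by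
    refine ⟨√(B / δ + 1), by positivity, ?_⟩
    rw [Real.sq_sqrt (by positivity), div_le_iff₀ (by positivity)]
    field_simp
    linarith
  refine ⟨dyadicPaths hT M r, isCompact_dyadicPaths hT hM.le hr.le hr1, ?_⟩
  rintro - ⟨i, rfl⟩
  dsimp only
  rw [Measure.map_apply (measurable_of_measurable_eval hT (hA i))
    (isClosed_dyadicPaths hT M r).measurableSet.compl]
  let inc : ℕ → ℕ → S i → ℝ := fun k j a =>
    rescaledPath hT (A i a) ((j + 1) / 2 ^ k) - rescaledPath hT (A i a) (j / 2 ^ k)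
  have hsub : A i ⁻¹' (dyadicPaths hT M r)ᶜ ⊆
      ⋃ k : ℕ, ⋃ j ∈ Finset.range (2 ^ k), {a | (M * r ^ k) ^ 2 ≤ inc k j a ^ 2} := by
    intro a ha
    have h00 : rescaledPath hT (A i a) 0 = 0 := h0 i a _ (by simp [projIcc])
    simp only [mem_preimage, mem_compl_iff, dyadicPaths, mem_ofPred_eq, h00, true_and,
      not_forall, not_le] at ha
    obtain ⟨k, j, hj, hlt⟩ := ha
    simp only [mem_iUnion]
    exact ⟨k, j, Finset.mem_range.2 hj,
      by simpa [inc, abs_of_pos (show 0 < M * r ^ k by positivity)] using sq_le_sq.2 (by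
        rw [abs_of_pos (show 0 < M * r ^ k by positivity)]; exact hlt.le)⟩
  -- Chebyshev's inequality for a single increment
  have hcheb : ∀ k j : ℕ, j < 2 ^ k → P i {a | (M * r ^ k) ^ 2 ≤ inc k j a ^ 2} ≤
      ENNReal.ofReal (D * √T ^ 3 / M ^ 2 * (r ^ k) ^ 10) := by
    intro k j hj
    have hp : (0 : ℝ) < 2 ^ k := by positivity
    have hj1 : ((j : ℝ) + 1) / 2 ^ k ≤ 1 := (div_le_one hp).2 (by exact_mod_cast hj)
    have hjle : (j : ℝ) / 2 ^ k ≤ (j + 1) / 2 ^ k := by gcongr; linarith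
    have hmono : projIcc 0 T hT.le ((j : ℝ) / 2 ^ k * T) ≤
        projIcc 0 T hT.le (((j : ℝ) + 1) / 2 ^ k * T) := monotone_projIcc _ (by gcongr)
    have hlen : √((projIcc 0 T hT.le (((j : ℝ) + 1) / 2 ^ k * T) : ℝ) -
        projIcc 0 T hT.le ((j : ℝ) / 2 ^ k * T)) = √T * (r ^ k) ^ 4 := by
      have hm1 : ((j : ℝ) + 1) / 2 ^ k * T ∈ Icc 0 T :=
        ⟨by positivity, mul_le_of_le_one_left hT.le hj1⟩
      have hm0 : (j : ℝ) / 2 ^ k * T ∈ Icc 0 T :=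
        ⟨by positivity, mul_le_of_le_one_left hT.le (hjle.trans hj1)⟩
      rw [projIcc_of_mem hT.le hm1, projIcc_of_mem hT.le hm0]
      have : ((j : ℝ) + 1) / 2 ^ k * T - j / 2 ^ k * T = T * ((r ^ k) ^ 4) ^ 2 := by
        have h8 : (r ^ k) ^ 8 = 1 / 2 ^ k := by
          rw [eq_div_iff hp.ne', mul_comm]; exact hpow k
        rw [← pow_mul, show 4 * 2 = 8 from rfl, h8]
        ring
      rw [this, Real.sqrt_mul hT.le, Real.sqrt_sq (by positivity)]
    have h1 := mul_meas_ge_le_integral_of_nonneg (μ := P i) (f := fun a => inc k j a ^ 2)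
      (ae_of_all _ fun a => sq_nonneg _) (hint i _ _ hmono) ((M * r ^ k) ^ 2)
    have h2 := h1.trans (hle i _ _ hmono)
    rw [hlen] at h2
    rw [← ofReal_measureReal]
    refine ENNReal.ofReal_le_ofReal ?_
    have hpos : 0 < (M * r ^ k) ^ 2 := by positivity
    refine le_of_mul_le_mul_left (h2.trans (le_of_eq ?_)) hpos
    field_simp
  calc P i (A i ⁻¹' (dyadicPaths hT M r)ᶜ)
      ≤ ∑' k : ℕ, P i (⋃ j ∈ Finset.range (2 ^ k), {a | (M * r ^ k) ^ 2 ≤ inc k j a ^ 2}) :=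
        (measure_mono hsub).trans (measure_iUnion_le _)
    _ ≤ ∑' k : ℕ, ENNReal.ofReal (D * √T ^ 3 / M ^ 2 * (r ^ 2) ^ k) := by
        refine ENNReal.tsum_le_tsum fun k => ?_
        refine (measure_biUnion_finset_le _ _).trans ((Finset.sum_le_sum fun j hj =>
          hcheb k j (Finset.mem_range.1 hj)).trans (le_of_eq ?_))
        rw [Finset.sum_const, Finset.card_range, nsmul_eq_mul, Nat.cast_pow, Nat.cast_ofNat,
          ← ENNReal.ofReal_ofNat, ← ENNReal.ofReal_pow zero_le_two,
          ← ENNReal.ofReal_mul (by positivity)]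
        congr 1
        have := hpow k
        calc (2 : ℝ) ^ k * (D * √T ^ 3 / M ^ 2 * (r ^ k) ^ 10)
            = (2 ^ k * (r ^ k) ^ 8) * (D * √T ^ 3 / M ^ 2 * (r ^ k) ^ 2) := by ring
          _ = _ := by rw [this, one_mul, ← pow_mul, mul_comm k 2, pow_mul]
    _ = ENNReal.ofReal (B / M ^ 2) := by
        rw [← ENNReal.ofReal_tsum_of_nonneg (fun k => by positivity)
          ((summable_geometric_of_lt_one (by positivity) hr2).mul_left _), tsum_mul_left,
          tsum_geometric_of_lt_one (by positivity) hr2, hB]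
        congr 1
        field_simp
    _ ≤ ε := (ENNReal.ofReal_le_ofReal hMB).trans hδε

end Tightness

/-! ### The additive functional of the drift -/

section AdditiveFunctional

open Set

variable {S : Type*} [mS : MeasurableSpace S] {ρ : unitInterval} {c : Config → ℝ} {R : Finset ℤ}
  {r : ℤ → Config → ℝ} {n : ℕ+} {P : Measure S} {𝓕 : Filtration ℝ≥0 mS} {η : ℝ≥0 → S → Config}
  {x : ℝ≥0 → S → ℤ}

lemma IsLocal.drift (hr : ∀ z ∈ R, IsLocal (r z)) : IsLocal (drift R r) :=
  IsLocal.sum R fun z hz => (hr z hz).const_mul _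

/-- The second moment of the additive functional, uniformly in the scaling parameter. -/
lemma exists_integral_additiveFunctional_sq_le (ρ : unitInterval) (hc : IsLocal c)
    (hc_elliptic : ∃ ε₀ : ℝ, 0 < ε₀ ∧ ∀ η, ε₀ ≤ c η)
    (hc_reversible : DependsOn c ({0, 1}ᶜ : Set ℤ)) (hr : ∀ z ∈ R, IsLocal (r z))
    (hr0 : ∀ z ∈ R, ∀ η, 0 ≤ r z η) (T : ℝ) :
    ∃ D, 0 ≤ D ∧ ∀ {S : Type*} [mS : MeasurableSpace S] {n : ℕ+} {P : Measure S}
      [IsProbabilityMeasure P] {𝓕 : Filtration ℝ≥0 mS} {η : ℝ≥0 → S → Config} {x : ℝ≥0 → S → ℤ},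
      IsWalkInExclusion ρ c R r n P 𝓕 η x → ∀ t ∈ Icc 0 T, ∀ τ ∈ Icc 0 T,
        ∫ a, additiveFunctional ρ R r n η x t (t + τ) a ^ 2 ∂P ≤ D * √τ ^ 3 := by
  obtain ⟨ε₀, hε₀, hε⟩ := hc_elliptic
  obtain ⟨C, hC, hE⟩ := exists_energy_estimate ρ hc hε₀ hε hc_reversible hr hr0
  obtain ⟨D, hD, h⟩ := exists_integral_sq_le (IsLocal.drift hr) ρ hC hε₀ T
  refine ⟨D, hD, fun hw t ht τ hτ => ?_⟩
  exact h (hw.solvesMartingaleProblem hc hr) hc hr (hE _) (fun f hf => hw.integral_initial hf)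
    t ht τ hτ

namespace IsWalkInExclusion

lemma rightContinuous_drift (h : IsWalkInExclusion ρ c R r n P 𝓕 η x)
    (hr : ∀ z ∈ R, IsLocal (r z)) (a : S) (s : ℝ) :
    ContinuousWithinAt (fun s : ℝ => drift R r (seenEnvironment η x s.toNNReal a) - speed ρ R r)
      (Ici s) s :=
  ((IsLocal.drift hr).continuous.continuousAt.comp_continuousWithinAt
    (h.rightContinuous_seenEnvironment a s)).sub continuousWithinAt_const

lemma intervalIntegrable_drift (h : IsWalkInExclusion ρ c R r n P 𝓕 η x)
    (hr : ∀ z ∈ R, IsLocal (r z)) (a : S) (p q : ℝ) :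
    IntervalIntegrable (fun s : ℝ => drift R r (seenEnvironment η x s.toNNReal a) - speed ρ R r)
      volume p q := by
  obtain ⟨b, -, hb⟩ := ((IsLocal.drift hr).sub (IsLocal.const (speed ρ R r))).exists_bound
  exact intervalIntegrable_of_rightContinuous (h.rightContinuous_drift hr a) (fun s => hb _) p q

lemma continuous_additiveFunctional (h : IsWalkInExclusion ρ c R r n P 𝓕 η x)
    (hr : ∀ z ∈ R, IsLocal (r z)) (a : S) :
    Continuous fun t => additiveFunctional ρ R r n η x 0 t a :=
  continuous_const.mul
    (intervalIntegral.continuous_primitive (fun p q => h.intervalIntegrable_drift hr a p q) 0)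

lemma additiveFunctional_sub (h : IsWalkInExclusion ρ c R r n P 𝓕 η x)
    (hr : ∀ z ∈ R, IsLocal (r z)) (s t : ℝ) (a : S) :
    additiveFunctional ρ R r n η x 0 t a - additiveFunctional ρ R r n η x 0 s a =
      additiveFunctional ρ R r n η x s t a := by
  rw [additiveFunctional, additiveFunctional, ← mul_sub,
    intervalIntegral.integral_interval_sub_left (h.intervalIntegrable_drift hr a _ _)
      (h.intervalIntegrable_drift hr a _ _), additiveFunctional]

lemma exists_abs_additiveFunctional_le {Ω : Type*} {η : ℝ≥0 → Ω → Config}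
    {x : ℝ≥0 → Ω → ℤ} (hr : ∀ z ∈ R, IsLocal (r z)) (s t : ℝ) :
    ∃ b, ∀ a, |additiveFunctional ρ R r n η x s t a| ≤ b := by
  obtain ⟨b, -, hb⟩ := ((IsLocal.drift hr).sub (IsLocal.const (speed ρ R r))).exists_bound
  refine ⟨√(n : ℝ) * (b * |t - s|), fun a => ?_⟩
  rw [additiveFunctional, abs_mul, abs_of_nonneg (Real.sqrt_nonneg _)]
  exact mul_le_mul_of_nonneg_left (abs_intervalIntegral_le (fun s => hb _) _ _)
    (Real.sqrt_nonneg _)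

variable [IsProbabilityMeasure P]

lemma measurable_additiveFunctional (h : IsWalkInExclusion ρ c R r n P 𝓕 η x)
    (hc : IsLocal c) (hr : ∀ z ∈ R, IsLocal (r z)) (s t : ℝ) :
    Measurable (additiveFunctional ρ R r n η x s t) :=
  ((h.solvesMartingaleProblem hc hr).measurable_integral
    ((IsLocal.drift hr).sub (IsLocal.const (speed ρ R r))) s t).const_mul _

lemma integrable_abs_additiveFunctional_rpow (h : IsWalkInExclusion ρ c R r n P 𝓕 η x)
    (hc : IsLocal c) (hr : ∀ z ∈ R, IsLocal (r z)) (s t : ℝ) {p : ℝ} (hp : 0 ≤ p) :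
    Integrable (fun a => |additiveFunctional ρ R r n η x s t a| ^ p) P := by
  obtain ⟨b, hb⟩ := exists_abs_additiveFunctional_le (ρ := ρ) (n := n) (η := η) (x := x) hr s t
  refine Integrable.of_bound
    ((h.measurable_additiveFunctional hc hr s t).abs.pow_const p).aestronglyMeasurable
    (b ^ p) (ae_of_all _ fun a => ?_)
  rw [Real.norm_eq_abs, abs_of_nonneg (by positivity)]
  exact Real.rpow_le_rpow (abs_nonneg _) (hb a) hp

lemma integrable_additiveFunctional_sq (h : IsWalkInExclusion ρ c R r n P 𝓕 η x)
    (hc : IsLocal c) (hr : ∀ z ∈ R, IsLocal (r z)) (s t : ℝ) :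
    Integrable (fun a => additiveFunctional ρ R r n η x s t a ^ 2) P := by
  simpa using h.integrable_abs_additiveFunctional_rpow hc hr s t zero_le_two

end IsWalkInExclusion

end AdditiveFunctional

/-- Moments of order `p ≤ 2` in terms of the second moment, with a free scale `s`. -/
lemma abs_rpow_le_of_scale {y s p : ℝ} (hs : 0 < s) (hp : 0 ≤ p) (hp2 : p ≤ 2) :
    |y| ^ p ≤ s ^ p * (1 + y ^ 2 / s ^ 2) := by
  have h : |y| ^ p = s ^ p * (|y| / s) ^ p := by
    rw [← Real.mul_rpow hs.le (by positivity), mul_div_cancel₀ _ hs.ne']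
  rw [h, ← sq_abs y, ← div_pow]
  refine mul_le_mul_of_nonneg_left ?_ (by positivity)
  obtain h1 | h1 := le_total (|y| / s) 1
  · exact (Real.rpow_le_one (by positivity) h1 hp).trans (le_add_of_nonneg_right (by positivity))
  · refine (Real.rpow_le_rpow_of_exponent_le h1 hp2).trans ?_
    rw [Real.rpow_two]
    linarith

end ExclusionWalk

theorem mainTheorem5
    (ρ : unitInterval) (hρ : ρ ∈ Set.Ioo (0 : unitInterval) 1)
    (c : Config → ℝ) (hc_local : IsLocal c)
    (hc_elliptic : ∃ ε₀ : ℝ, 0 < ε₀ ∧ ∀ η, ε₀ ≤ c η)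
    (hc_reversible : DependsOn c ({0, 1}ᶜ : Set ℤ))
    (R : Finset ℤ) (hR : (0 : ℤ) ∉ R)
    (r : ℤ → Config → ℝ) (hr_local : ∀ z ∈ R, IsLocal (r z))
    (hr_nonneg : ∀ z ∈ R, ∀ η, 0 ≤ r z η)
    (T : ℝ) (hT : 0 < T) :
    (∀ lam ∈ Set.Ioo (1 : ℝ) 2, ∃ C : ℝ,
      ∀ (n : ℕ+) (S : Type*) [MeasurableSpace S] (P : Measure S) [IsProbabilityMeasure P]
        (𝓕 : Filtration ℝ≥0 (inferInstance : MeasurableSpace S))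
        (η : ℝ≥0 → S → Config) (x : ℝ≥0 → S → ℤ),
        IsWalkInExclusion ρ c R r n P 𝓕 η x →
        ∀ t ∈ Set.Icc 0 T, ∀ τ ∈ Set.Icc 0 T,
          Integrable (fun a => |additiveFunctional ρ R r n η x t (t + τ) a| ^ lam) P ∧
          ∫ a, |additiveFunctional ρ R r n η x t (t + τ) a| ^ lam ∂P ≤ C * τ ^ (3 * lam / 4)) ∧
    (∀ (S : ℕ+ → Type*) [∀ n, MeasurableSpace (S n)]
      (P : ∀ n, Measure (S n)) [∀ n, IsProbabilityMeasure (P n)]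
      (𝓕 : ∀ n, Filtration ℝ≥0 (inferInstance : MeasurableSpace (S n)))
      (η : ∀ n, ℝ≥0 → S n → Config) (x : ∀ n, ℝ≥0 → S n → ℤ),
      (∀ n, IsWalkInExclusion ρ c R r n (P n) (𝓕 n) (η n) (x n)) →
      ∃ A : ∀ n, S n → C(Set.Icc (0 : ℝ) T, ℝ),
        (∀ n a (t : Set.Icc (0 : ℝ) T),
          A n a t = additiveFunctional ρ R r n (η n) (x n) 0 t a) ∧
        (∀ n, Measurable (A n)) ∧
        IsTightMeasureSet (Set.range fun n => (P n).map (A n))) := by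
  constructor
  · intro lam hlam
    obtain ⟨D, hD, hle⟩ := exists_integral_additiveFunctional_sq_le ρ hc_local hc_elliptic
      hc_reversible hr_local hr_nonneg T
    refine ⟨1 + D, fun n S _ P _ 𝓕 η x h t ht τ hτ => ?_⟩
    have hlam0 : 0 ≤ lam := zero_le_one.trans hlam.1.le
    have hint := h.integrable_abs_additiveFunctional_rpow hc_local hr_local t (t + τ) hlam0
    refine ⟨hint, ?_⟩
    obtain h0 | h0 := hτ.1.eq_or_lt
    · have : (3 * lam / 4) ≠ 0 := by linarith [hlam.1]
      simp [← h0, additiveFunctional, Real.zero_rpow this,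
        Real.zero_rpow (zero_lt_one.trans hlam.1).ne']
    -- the typical size of the additive functional is `s = τ ^ (3 / 4)`
    set s := τ ^ (3 / 4 : ℝ) with hs_def
    have hs : 0 < s := Real.rpow_pos_of_pos h0 _
    have hs2 : √τ ^ 3 = s ^ 2 := by
      rw [Real.sqrt_eq_rpow, ← Real.rpow_natCast, ← Real.rpow_natCast, ← Real.rpow_mul h0.le,
        ← Real.rpow_mul h0.le]
      norm_num
    have hsl : s ^ lam = τ ^ (3 * lam / 4) := by
      rw [← Real.rpow_mul h0.le]
      congr 1
      ring
    have hsq := h.integrable_additiveFunctional_sq hc_local hr_local t (t + τ)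
    calc ∫ a, |additiveFunctional ρ R r n η x t (t + τ) a| ^ lam ∂P
        ≤ ∫ a, s ^ lam * (1 + additiveFunctional ρ R r n η x t (t + τ) a ^ 2 / s ^ 2) ∂P :=
          integral_mono hint (((integrable_const _).add (hsq.div_const _)).const_mul _)
            fun a => abs_rpow_le_of_scale hs hlam0 hlam.2.le
      _ = s ^ lam * (1 + (∫ a, additiveFunctional ρ R r n η x t (t + τ) a ^ 2 ∂P) / s ^ 2) := by
          rw [integral_const_mul, integral_add (integrable_const _) (hsq.div_const _),
            integral_div]
          simp
      _ ≤ s ^ lam * (1 + D * s ^ 2 / s ^ 2) := by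
          rw [← hs2]
          gcongr
          exact hle h t ht τ hτ
      _ = (1 + D) * τ ^ (3 * lam / 4) := by
          rw [mul_div_cancel_right₀ _ (by positivity), hsl, mul_comm]
  · intro S _ P _ 𝓕 η x h
    obtain ⟨D, hD, hle⟩ := exists_integral_additiveFunctional_sq_le ρ hc_local hc_elliptic
      hc_reversible hr_local hr_nonneg T
    let A : ∀ n, S n → C(Set.Icc (0 : ℝ) T, ℝ) := fun n a =>
      ⟨fun t => additiveFunctional ρ R r n (η n) (x n) 0 t a,
        ((h n).continuous_additiveFunctional hr_local a).comp continuous_subtype_val⟩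
    have hA : ∀ n t, Measurable fun a => A n a t := fun n t =>
      (h n).measurable_additiveFunctional hc_local hr_local _ _
    have hinc : ∀ n (s t : Set.Icc (0 : ℝ) T) a, A n a t - A n a s =
        additiveFunctional ρ R r n (η n) (x n) s (s + (t - s : ℝ)) a := fun n s t a => by
      rw [add_sub_cancel]
      exact (h n).additiveFunctional_sub hr_local _ _ _
    refine ⟨A, fun n a t => rfl, fun n => measurable_of_measurable_eval hT (hA n),
      isTightMeasureSet_of_integral_sq_le hT hA (fun n a t ht => ?_) hD
        (fun n s t hst => ?_) fun n s t hst => ?_⟩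
    · change additiveFunctional ρ R r n (η n) (x n) 0 t a = 0
      simp [additiveFunctional, ht]
    · simp only [hinc]
      exact (h n).integrable_additiveFunctional_sq hc_local hr_local _ _
    · simp only [hinc]
      exact hle (h n) _ s.2 _ ⟨sub_nonneg.2 hst, (sub_le_self _ s.2.1).trans t.2.2⟩
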